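/- The logic $K^{\#}$ has formulas and linear expressions given by $$\varphi ::= p \mid \lnot\varphi \mid \varphi\lor\varphi \mid E\ge 0, \qquad E ::= c \mid 1_\varphi \mid \#\varphi \mid E+E \mid c\times E,$$ where $p$ ranges over a countably infinite set of atomic propositions and $c$ over $\mathbb Z$. They are evaluated at a vertex $u$ of a finite directed graph $G$ whose vertices are labeled with valuations of the atomic propositions: Boolean connectives, constants, sums and integer multiples have their usual meaning, $1_\varphi$ has value $1$ if $\varphi$ is true at $u$ and $0$ otherwise, $\#\varphi$ has as value the number of successors of $u$ at which $\varphi$ is true, and $E\ge 0$ is true at $u$ if the value of $E$ at $u$ is nonnegative. A formula is satisfiable if it is true at some vertex of some finite labeled directed graph. The satisfiability problem of $K^{\#}$ is: given a formula $\varphi$, is $\varphi$ satisfiable? The input $\varphi$ is written as a string that lists, children before parents, the nodes of a directed acyclic graph representing $\varphi$, in which common subformulas and subexpressions may be shared (a syntax tree being the special case without sharing); integers, indices of propositions and references to nodes are written in binary. **Theorem.** The satisfiability problem of $K^{\#}$ is decidable and belongs to $\mathsf{EXPTIME}^{\mathsf{NP}}$, i.e. there are a language $O\in\mathsf{NP}$,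 a polynomial $p$ and a deterministic Turing machine with oracle $O$ that decides the problem in at most $2^{p(n)}$ steps on inputs of length $n$. (An oracle query counts as one step, and the query words may be exponentially long.) -/

import Mathlib

/-! ## The logic `K^#`: syntax and semantics -/

namespace KSharp

mutual

/-- Formulas `φ ::= p | ¬φ | φ ∨ φ | E ≥ 0`; the atomic propositions are indexed by `ℕ`. -/
inductive Form : Type
  | atom : ℕ → Form
  | neg : Form → Form
  | or : Form → Form → Form
  | nonneg : Expr → Form

/-- Linear expressions `E ::= c | 1_φ | #φ | E + E | c × E` with `c ∈ ℤ`. -/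
inductive Expr : Type
  | const : ℤ → Expr
  | ind : Form → Expr
  | count : Form → Expr
  | add : Expr → Expr → Expr
  | smul : ℤ → Expr → Expr

end

/-- A labeled directed graph on the vertex type `V`: any set of directed edges (loops allowed), and
a valuation of the atomic propositions at every vertex. Finiteness of `V` is required where
satisfiability is defined. -/
structure Graph (V : Type) where
  edge : V → V → Prop
  label : V → ℕ → Prop

open scoped Classical in
mutual

/-- Truth of a formula at a vertex, `(G, u) ⊨ φ`. -/
noncomputable def Form.Holds {V : Type} (G : Graph V) : Form → V → Prop
  | .atom p, u => G.label u p
  | .neg φ, u => ¬ φ.Holds G u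
  | .or φ ψ, u => φ.Holds G u ∨ ψ.Holds G u
  | .nonneg E, u => 0 ≤ E.value G u

/-- Value of an expression at a vertex, `[[E]]_{G,u}`. -/
noncomputable def Expr.value {V : Type} (G : Graph V) : Expr → V → ℤ
  | .const c, _ => c
  | .ind φ, u => if φ.Holds G u then 1 else 0
  | .count φ, u => ({v : V | G.edge u v ∧ φ.Holds G v}.ncard : ℤ)
  | .add E F, u => E.value G u + F.value G u
  | .smul c E, u => c * E.value G u

end

/-- A formula is satisfiable if it is true at some vertex of some finite labeled graph. -/
def Form.Satisfiable (φ : Form) : Prop :=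
  ∃ (V : Type) (_ : Finite V) (G : Graph V) (u : V), φ.Holds G u

/-! ## Formulas as inputs of algorithms

A formula is given as a directed acyclic graph (DAG) in which common subformulas and subexpressions
may be shared; a syntax tree is the special case without sharing. The DAG is written down as the
list of its nodes, each node naming its children by their positions (counted from `0`) in the part
of the list that precedes it; the last node is the root. -/

/-- A node of a DAG. The arguments of type `ℕ` are the positions of the children, except for
`atom p`, where `p` is the atomic proposition. -/
inductive Node : Type
  | atom (p : ℕ)
  | neg (i : ℕ)
  | or (i j : ℕ)
  | nonneg (i : ℕ)
  | const (c : ℤ)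
  | ind (i : ℕ)
  | count (i : ℕ)
  | add (i j : ℕ)
  | smul (c : ℤ) (i : ℕ)

/-- The formula at position `i`, if `i` is in range and there is a formula (not an expression). -/
def formAt (env : List (Form ⊕ Expr)) (i : ℕ) : Option Form :=
  env[i]?.bind Sum.getLeft?

/-- The expression at position `i`, if `i` is in range and there is an expression. -/
def exprAt (env : List (Form ⊕ Expr)) (i : ℕ) : Option Expr :=
  env[i]?.bind Sum.getRight?

/-- The formula or expression at a node, given those at the preceding nodes; `none` if a reference
is out of range or of the wrong sort. -/
def Node.denote (env : List (Form ⊕ Expr)) : Node → Option (Form ⊕ Expr)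
  | .atom p => some (.inl (.atom p))
  | .neg i => (formAt env i).map fun φ => .inl (.neg φ)
  | .or i j => (formAt env i).bind fun φ => (formAt env j).map fun ψ => .inl (.or φ ψ)
  | .nonneg i => (exprAt env i).map fun E => .inl (.nonneg E)
  | .const c => some (.inr (.const c))
  | .ind i => (formAt env i).map fun φ => .inr (.ind φ)
  | .count i => (formAt env i).map fun φ => .inr (.count φ)
  | .add i j => (exprAt env i).bind fun E => (exprAt env j).map fun F => .inr (.add E F)
  | .smul c i => (exprAt env i).map fun E => .inr (.smul c E)

/-- Unfold the nodes of a DAG from left to right, after those with the values `env`. -/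
def denoteFrom : List (Form ⊕ Expr) → List Node → Option (List (Form ⊕ Expr))
  | env, [] => some env
  | env, nd :: nds => (nd.denote env).bind fun x => denoteFrom (env ++ [x]) nds

/-- The list `nds` is a well-formed DAG whose root is the formula `φ`. -/
def Represents (nds : List Node) (φ : Form) : Prop :=
  ∃ env : List (Form ⊕ Expr), denoteFrom [] nds = some env ∧ env.getLast? = some (.inl φ)

/-- The alphabet of the input strings. -/
inductive Token : Type
  | atom | neg | or | nonneg | const | ind | count | add | smul
  | minus | comma | bit0 | bit1
  deriving DecidableEq

instance : Fintype Token where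
  elems := {.atom, .neg, .or, .nonneg, .const, .ind, .count, .add, .smul,
    .minus, .comma, .bit0, .bit1}
  complete := by intro t; cases t <;> decide

/-- Coding of the finite alphabet; which enumeration is used is irrelevant. -/
noncomputable instance : Primcodable Token :=
  Primcodable.ofEquiv (Fin (Fintype.card Token)) (Fintype.equivFin Token)

/-- Natural numbers in binary, least significant bit first (`0` is the empty string). -/
def encodeNat (n : ℕ) : List Token :=
  (Nat.bits n).map fun b => if b then Token.bit1 else Token.bit0

/-- Integers in binary, with a sign in front of the negative ones. -/
def encodeInt (c : ℤ) : List Token :=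
  (if c < 0 then [Token.minus] else []) ++ encodeNat c.natAbs

/-- A node is the name of its constructor, followed by the arguments. -/
def Node.encode : Node → List Token
  | .atom p => .atom :: encodeNat p
  | .neg i => .neg :: encodeNat i
  | .or i j => .or :: (encodeNat i ++ .comma :: encodeNat j)
  | .nonneg i => .nonneg :: encodeNat i
  | .const c => .const :: encodeInt c
  | .ind i => .ind :: encodeNat i
  | .count i => .count :: encodeNat i
  | .add i j => .add :: (encodeNat i ++ .comma :: encodeNat j)
  | .smul c i => .smul :: (encodeInt c ++ .comma :: encodeNat i)

/-- The string for a list of nodes. -/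
def encode (nds : List Node) : List Token :=
  nds.flatMap Node.encode

/-- The satisfiability problem of `K^#`, as a language: the strings that represent a satisfiable
formula. -/
def SAT : Language Token :=
  {w | ∃ (nds : List Node) (φ : Form), encode nds = w ∧ Represents nds φ ∧ φ.Satisfiable}

end KSharp

/-! ## Oracle Turing machines and complexity classes -/

namespace Complexity

open Turing

/-- A deterministic multi-tape oracle Turing machine with input alphabet `A`, over Mathlib's
`Turing.TM2` machines: the work tapes are finitely many stacks (a tape is a pair of stacks), and
there are finitely many tape symbols, control labels and internal states. In addition some labels
are oracle labels: `ask l = some (yes, no)` means that at `l` the machine asks whether the word on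
the query stack belongs to the oracle and goes on at `yes` or at `no`. A halted machine accepts or
rejects according to its internal state. -/
structure OracleTM (A : Type) where
  /-- index type of the stacks -/
  K : Type
  [decEqK : DecidableEq K]
  [finK : Fintype K]
  /-- tape alphabet -/
  Γ : Type
  [finΓ : Fintype Γ]
  /-- control labels -/
  Λ : Type
  [finΛ : Fintype Λ]
  /-- internal states -/
  σ : Type
  [finσ : Fintype σ]
  /-- the input alphabet is part of the tape alphabet -/
  inSym : A ↪ Γ
  /-- input stack -/
  input : K
  /-- query stack -/
  query : K
  /-- initial label -/
  start : Λ
  /-- initial internal state -/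
  init : σ
  /-- the program at the labels that are not oracle labels -/
  prog : Λ → TM2.Stmt (fun _ : K => Γ) Λ σ
  /-- the oracle labels -/
  ask : Λ → Option (Λ × Λ)
  /-- accepting internal states -/
  accepting : σ → Bool

attribute [instance] OracleTM.decEqK OracleTM.finK OracleTM.finΓ OracleTM.finΛ OracleTM.finσ

namespace OracleTM

variable {A : Type} (M : OracleTM A)

/-- Configurations: the current label (`none` when halted), the internal state, the stacks. -/
abbrev Cfg : Type := TM2.Cfg (fun _ : M.K => M.Γ) M.Λ M.σ

/-- The initial configuration: the input word is on the input stack, its first letter on top. -/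
def initial (x : List A) : M.Cfg :=
  ⟨some M.start, M.init, Function.update (fun _ => []) M.input (x.map M.inSym)⟩

open scoped Classical in
/-- One step with oracle `O`. An oracle query is one step whatever the length of the word; the word
is read from the top of the query stack and stays there. A halted machine stays as it is. -/
noncomputable def step (O : Language M.Γ) : M.Cfg → M.Cfg
  | ⟨none, v, S⟩ => ⟨none, v, S⟩
  | ⟨some l, v, S⟩ =>
    match M.ask l with
    | none => TM2.stepAux (M.prog l) v S
    | some (yes, no) => ⟨some (if S M.query ∈ O then yes else no), v, S⟩

/-- The configuration after `t` steps on input `x`. -/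
noncomputable def run (O : Language M.Γ) (x : List A) (t : ℕ) : M.Cfg :=
  (M.step O)^[t] (M.initial x)

/-- With oracle `O`, the machine halts on every input `x` within `t |x|` steps, and accepts exactly
the words of `L`. -/
def DecidesInTime (O : Language M.Γ) (L : Language A) (t : ℕ → ℕ) : Prop :=
  ∀ x : List A, (M.run O x (t x.length)).l = none ∧
    (M.accepting (M.run O x (t x.length)).var = true ↔ x ∈ L)

end OracleTM

/-- `P`: decidable in polynomial time by a deterministic machine (with the empty oracle). -/
def InP {A : Type} (L : Language A) : Prop :=
  ∃ (M : OracleTM A) (p : Polynomial ℕ), M.DecidesInTime 0 L fun n => p.eval n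

/-- `NP`: there are binary certificates of polynomial length that can be verified in polynomial
time. A verifier reads the word followed by the certificate, over the disjoint union of the
alphabets. -/
def InNP {A : Type} (L : Language A) : Prop :=
  ∃ (R : Language (A ⊕ Bool)) (p : Polynomial ℕ), InP R ∧
    ∀ x : List A, x ∈ L ↔
      ∃ y : List Bool, y.length ≤ p.eval x.length ∧ x.map Sum.inl ++ y.map Sum.inr ∈ R

/-- `EXPTIME^NP`: decidable in time `2 ^ p(n)`, for some polynomial `p`, by a deterministic machine
with an oracle in `NP`. -/
def InEXPTIMEwithNP {A : Type} (L : Language A) : Prop :=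
  ∃ (M : OracleTM A) (O : Language M.Γ) (p : Polynomial ℕ),
    InNP O ∧ M.DecidesInTime O L fun n => 2 ^ p.eval n

end Complexity

/-!
The proof rests on certificates of exponential size for satisfiability. Only finitely many *types*
of vertices matter, a type being the set of the formulas of the DAG that are true at a vertex, and
the values of all formulas and expressions at a vertex are determined by its labeling, its own type
and the numbers of its successors of each type. A certificate (`KSharp.checkCert`) is a list of
entries, one for each type that occurs, with the truth values and the values of expressions (as
differences of natural numbers in unary), the labeling, and a list of successors, each given by the
position of its entry; a type may be listed several times. It is correct if all values obey the
local semantic rules.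

*Soundness* (`KSharp.mem_SAT_of_checkCert`). Take as many copies of each entry as the longest list
of successors has members, and let the `b`-th successor of every copy of an entry be the `b`-th
copy of the `b`-th type listed there (`KSharp.copies`). By induction along the DAG, all values are
correct in this graph.

*Completeness* (`KSharp.exists_cert`). Given a model, choose one vertex of each type. The difficulty
is that a vertex may have far too many successors. Each successor contributes an integer vector to
the values of the expressions, with one coordinate for each of the `m` nodes and with entries that
are at most exponential, and only the signs of the total values matter. By the Steinitz lemma
(`exists_order_of_sum_eq_zero`), integer vectors with sum zero can be ordered such that all partial
sums stay in a box of side polynomial in the bound on the vectors; a partial sum that occurs twice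
allows the vectors in between to be deleted. Hence an exponential number of successors suffices to
preserve all signs (`exists_small_subsum`, `KSharp.exists_small_subset`), and there is a certificate
of size `2 ^ (2 * (n + 2) ^ 2)` for inputs of length `n`.

*Complexity.* The machine writes the input and `2 ^ (2 * (n + 2) ^ 2)` pads on the query stack and
asks a single question (`KSharp.inEXPTIMEwithNP_SAT`). The oracle contains the words for which there
is an accepted certificate that is not longer than the word, and since the pads make words long, it
belongs to `NP`. That checking a certificate takes polynomial time is proved by means of `PTime`, a
class of functions on binary trees that are computed by structured stack programs `Cmd`; these are
compiled to oracle machines by `Cmd.toMachine`. The class is closed under composition, pairing, case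
distinction and iteration with polynomially bounded values (`PTime.iterate`), and further closure
properties are derived from these, without looking at machines again.

*Decidability.* The functions in `PTime` are primitive recursive on representations, and so is the
bound on the certificates: an exhaustive search decides the problem (`KSharp.computablePred_SAT`).
-/

/-! ### Structured stack programs and their compilation to oracle machines -/

open Turing

/-- Structured programs over stacks indexed by `K` with alphabet `Γ`. `case k f` branches on the
top symbol of stack `k` (without removing it), `loop k p c` repeats `c` as long as the top symbol
of `k` satisfies `p`, and `ask k c d` branches on whether the word on the query stack is in the
oracle. -/
inductive Cmd (K Γ : Type) : Type
  | skip : Cmd K Γ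
  | push : K → Γ → Cmd K Γ
  | pop : K → Cmd K Γ
  | seq : Cmd K Γ → Cmd K Γ → Cmd K Γ
  | case : K → (Option Γ → Cmd K Γ) → Cmd K Γ
  | loop : K → (Option Γ → Bool) → Cmd K Γ → Cmd K Γ
  | ask : Cmd K Γ → Cmd K Γ → Cmd K Γ

namespace Cmd

variable {K Γ : Type}

/-- Contents of the stacks. -/
abbrev Stacks (K Γ : Type) : Type := K → List Γ

/-- `Runs q O c S S' t`: with query stack `q` and oracle `O`, the program `c` started with stacks
`S` terminates with stacks `S'` after exactly `t` steps of the compiled machine. -/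
inductive Runs [DecidableEq K] (q : K) (O : Language Γ) :
    Cmd K Γ → Stacks K Γ → Stacks K Γ → ℕ → Prop
  | skip (S) : Runs q O skip S S 1
  | push (k a S) : Runs q O (push k a) S (Function.update S k (a :: S k)) 1
  | pop (k S) : Runs q O (pop k) S (Function.update S k (S k).tail) 1
  | seq {c d S S' S'' t t'} : Runs q O c S S' t → Runs q O d S' S'' t' →
      Runs q O (seq c d) S S'' (t + t')
  | case {k f S S' t} : Runs q O (f (S k).head?) S S' t → Runs q O (case k f) S S' (1 + t)
  | loop_done {k p c S} : p (S k).head? = false → Runs q O (loop k p c) S S 1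
  | loop_step {k p c S S' S'' t t'} : p (S k).head? = true → Runs q O c S S' t →
      Runs q O (loop k p c) S' S'' t' → Runs q O (loop k p c) S S'' (1 + t + t')
  | ask_yes {c d S S' t} : S q ∈ O → Runs q O c S S' t → Runs q O (ask c d) S S' (1 + t)
  | ask_no {c d S S' t} : S q ∉ O → Runs q O d S S' t → Runs q O (ask c d) S S' (1 + t)

/-- Control points of a program; these become the labels of the compiled machine. -/
def Pos : Cmd K Γ → Type
  | skip => Unit
  | push _ _ => Unit
  | pop _ => Unit
  | seq c d => Pos c ⊕ Pos d
  | case _ f => Option (Σ a, Pos (f a))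
  | loop _ _ c => Option (Pos c)
  | ask c d => Option (Pos c ⊕ Pos d)

theorem finite_pos [Finite Γ] : ∀ c : Cmd K Γ, Finite (Pos c)
  | skip => inferInstanceAs (Finite Unit)
  | push _ _ => inferInstanceAs (Finite Unit)
  | pop _ => inferInstanceAs (Finite Unit)
  | seq c d =>
    have := finite_pos c; have := finite_pos d; inferInstanceAs (Finite (Pos c ⊕ Pos d))
  | case _ f =>
    have := fun a => finite_pos (f a); inferInstanceAs (Finite (Option (Σ a, Pos (f a))))
  | loop _ _ c => have := finite_pos c; inferInstanceAs (Finite (Option (Pos c)))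
  | ask c d =>
    have := finite_pos c; have := finite_pos d
    inferInstanceAs (Finite (Option (Pos c ⊕ Pos d)))

/-- The control point at which execution of a program starts. -/
def entry : (c : Cmd K Γ) → Pos c
  | skip => ()
  | push _ _ => ()
  | pop _ => ()
  | seq c _ => .inl (entry c)
  | case _ _ => none
  | loop _ _ _ => none
  | ask _ _ => none

/-- What the compiled machine does at a control point of `c`: a statement, or an oracle query with
two continuations. Control points are turned into labels by `emb`, and after `c` control passes to
the label `next`. The internal state holds the symbol that was inspected last. -/
def instr {Λ : Type} : (c : Cmd K Γ) → (Pos c → Λ) → Λ → Pos c →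
    TM2.Stmt (fun _ : K => Γ) Λ (Option Γ) ⊕ (Λ × Λ)
  | skip, _, next, _ => .inl (.goto fun _ => next)
  | push k a, _, next, _ => .inl (.push k (fun _ => a) (.goto fun _ => next))
  | pop k, _, next, _ => .inl (.pop k (fun v _ => v) (.goto fun _ => next))
  | seq c d, emb, _, .inl l => instr c (fun l => emb (.inl l)) (emb (.inr (entry d))) l
  | seq _ d, emb, next, .inr l => instr d (fun l => emb (.inr l)) next l
  | case k f, emb, _, none =>
    .inl (.peek k (fun _ a => a) (.goto fun a => emb (some ⟨a, entry (f a)⟩)))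
  | case _ f, emb, next, some ⟨a, l⟩ => instr (f a) (fun l => emb (some ⟨a, l⟩)) next l
  | loop k p c, emb, next, none =>
    .inl (.peek k (fun _ a => a) (.goto fun a => if p a then emb (some (entry c)) else next))
  | loop _ _ c, emb, _, some l => instr c (fun l => emb (some l)) (emb none) l
  | ask c d, emb, _, none =>
    .inr (emb (some (.inl (entry c))), emb (some (.inr (entry d))))
  | ask c _, emb, next, some (.inl l) => instr c (fun l => emb (some (.inl l))) next l
  | ask _ d, emb, next, some (.inr l) => instr d (fun l => emb (some (.inr l))) next l

/-- The oracle machine with labels `Λ` and the given code at each label: a statement, or an oracle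
query with two continuations. It accepts iff the symbol inspected last is `acc`. -/
noncomputable def machineOf {A Λ : Type} [DecidableEq K] [Fintype K] [DecidableEq Γ] [Fintype Γ]
    [Finite Λ] (code : Λ → TM2.Stmt (fun _ : K => Γ) Λ (Option Γ) ⊕ (Λ × Λ)) (start : Λ)
    (inSym : A ↪ Γ) (input query : K) (acc : Γ) : Complexity.OracleTM A where
  K := K
  Γ := Γ
  Λ := Λ
  finΛ := Fintype.ofFinite _
  σ := Option Γ
  inSym := inSym
  input := input
  query := query
  start := start
  init := none
  prog l := (code l).elim id fun _ => .halt
  ask l := (code l).elim (fun _ => none) some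
  accepting v := v = some acc

section Compile

variable {A Λ : Type} [DecidableEq K] [Fintype K] [DecidableEq Γ] [Fintype Γ] [Finite Λ]
  {code : Λ → TM2.Stmt (fun _ : K => Γ) Λ (Option Γ) ⊕ (Λ × Λ)} {start : Λ} {inSym : A ↪ Γ}
  {input query : K} {acc : Γ}

theorem machineOf_step_inl (O : Language Γ) {l : Λ} {s} (h : code l = .inl s) (v S) :
    (machineOf code start inSym input query acc).step O ⟨some l, v, S⟩ = TM2.stepAux s v S := by
  have h1 : (machineOf code start inSym input query acc).ask l = none := by
    simp [machineOf, h]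
  have h2 : (machineOf code start inSym input query acc).prog l = s := by
    simp [machineOf, h]
  unfold Complexity.OracleTM.step
  simp only [h1, h2]
  rfl

open scoped Classical in
theorem machineOf_step_inr (O : Language Γ) {l : Λ} {r} (h : code l = .inr r) (v S) :
    (machineOf code start inSym input query acc).step O ⟨some l, v, S⟩ =
      ⟨some (if S query ∈ O then r.1 else r.2), v, S⟩ := by
  have h1 : (machineOf code start inSym input query acc).ask l = some r := by
    simp [machineOf, h]
  unfold Complexity.OracleTM.step
  simp only [h1]
  rfl

theorem iterate_of_runs {c : Cmd K Γ} {O : Language Γ} {S S' : Stacks K Γ} {t : ℕ}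
    (h : Runs query O c S S' t) :
    ∀ (emb : Pos c → Λ) (next : Λ), (∀ l, code (emb l) = instr c emb next l) → ∀ v, ∃ v',
      ((machineOf code start inSym input query acc).step O)^[t] ⟨some (emb (entry c)), v, S⟩ =
        ⟨some next, v', S'⟩ := by
  induction h with
  | skip S =>
    intro emb next he v
    exact ⟨v, machineOf_step_inl O (he (entry skip)) v S⟩
  | push k a S =>
    intro emb next he v
    exact ⟨v, machineOf_step_inl O (he (entry (push k a))) v S⟩
  | pop k S =>
    intro emb next he v
    exact ⟨v, machineOf_step_inl O (he (entry (pop k))) v S⟩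
  | @seq c d S S' S'' t t' _ _ ih1 ih2 =>
    intro emb next he v
    obtain ⟨v1, h1⟩ := ih1 (fun l => emb (.inl l)) (emb (.inr (entry d))) (fun l => he (.inl l)) v
    obtain ⟨v2, h2⟩ := ih2 (fun l => emb (.inr l)) next (fun l => he (.inr l)) v1
    refine ⟨v2, ?_⟩
    rw [Nat.add_comm, Function.iterate_add_apply]
    exact (congrArg _ h1).trans h2
  | @case k f S S' t _ ih =>
    intro emb next he v
    obtain ⟨v1, h1⟩ := ih (fun l => emb (some ⟨(S k).head?, l⟩)) next (fun l => he (some ⟨_, l⟩))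
      (S k).head?
    refine ⟨v1, ?_⟩
    rw [Nat.add_comm, Function.iterate_succ_apply]
    exact (congrArg _ (machineOf_step_inl O (he none) v S)).trans h1
  | @loop_done k p c S hp =>
    intro emb next he v
    refine ⟨(S k).head?, (machineOf_step_inl O (he none) v S).trans ?_⟩
    simp [TM2.stepAux, hp]
    rfl
  | @loop_step k p c S S' S'' t t' hp _ _ ih1 ih2 =>
    intro emb next he v
    obtain ⟨v1, h1⟩ := ih1 (fun l => emb (some l)) (emb none) (fun l => he (some l)) (S k).head?
    obtain ⟨v2, h2⟩ := ih2 emb next he v1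
    refine ⟨v2, ?_⟩
    rw [Nat.add_comm, Function.iterate_add_apply, Nat.add_comm, Function.iterate_succ_apply]
    refine (congrArg _ (congrArg _ ((machineOf_step_inl O (he none) v S).trans ?_))).trans
      ((congrArg _ h1).trans h2)
    simp [TM2.stepAux, hp]
    rfl
  | @ask_yes c d S S' t hq _ ih =>
    intro emb next he v
    obtain ⟨v1, h1⟩ := ih (fun l => emb (some (.inl l))) next (fun l => he (some (.inl l))) v
    refine ⟨v1, ?_⟩
    rw [Nat.add_comm, Function.iterate_succ_apply]
    refine (congrArg _ ((machineOf_step_inr O (he none) v S).trans ?_)).trans h1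
    exact congrArg (fun z => (⟨some z, v, S⟩ : TM2.Cfg _ _ _)) (if_pos hq)
  | @ask_no c d S S' t hq _ ih =>
    intro emb next he v
    obtain ⟨v1, h1⟩ := ih (fun l => emb (some (.inr l))) next (fun l => he (some (.inr l))) v
    refine ⟨v1, ?_⟩
    rw [Nat.add_comm, Function.iterate_succ_apply]
    refine (congrArg _ ((machineOf_step_inr O (he none) v S).trans ?_)).trans h1
    exact congrArg (fun z => (⟨some z, v, S⟩ : TM2.Cfg _ _ _)) (if_neg hq)

/-- The oracle machine that runs `c` and then accepts iff the top symbol of stack `out` is `acc`.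
The additional label `none` is the one at which the result is inspected. -/
noncomputable def toMachine (c : Cmd K Γ) (inSym : A ↪ Γ) (input query out : K) (acc : Γ) :
    Complexity.OracleTM A :=
  have := finite_pos c
  machineOf (Λ := Option (Pos c))
    (fun l => l.elim (.inl (.peek out (fun _ a => a) .halt)) (instr c some none))
    (some (entry c)) inSym input query acc

theorem toMachine_decides (c : Cmd K Γ) {out : K} {O : Language Γ} {L : Language A} {T : ℕ → ℕ}
    (h : ∀ x : List A, ∃ S' t, t + 1 ≤ T x.length ∧
      Runs query O c (Function.update (fun _ => []) input (x.map inSym)) S' t ∧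
        ((S' out).head? = some acc ↔ x ∈ L)) :
    (toMachine c inSym input query out acc).DecidesInTime O L T := by
  have := finite_pos c
  intro x
  obtain ⟨S', t, ht, hr, hx⟩ := h x
  obtain ⟨v, hv⟩ := iterate_of_runs (start := some (entry c)) (inSym := inSym) (input := input)
    (acc := acc)
    (code := fun l => l.elim (.inl (.peek out (fun _ a => a) .halt)) (instr c some none))
    hr some none (fun l => rfl) none
  have key : (toMachine c inSym input query out acc).run O x (t + 1) =
      ⟨none, (S' out).head?, S'⟩ := by
    unfold Complexity.OracleTM.run
    rw [Nat.add_comm, Function.iterate_add_apply]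
    refine (congrArg _ hv).trans ?_
    exact machineOf_step_inl (l := (none : Option (Pos c)))
      (s := .peek out (fun _ a => a) .halt) O rfl v S'
  have key2 : (toMachine c inSym input query out acc).run O x (T x.length) =
      ⟨none, (S' out).head?, S'⟩ := by
    obtain ⟨d, hd⟩ := Nat.exists_eq_add_of_le ht
    unfold Complexity.OracleTM.run
    rw [hd, Nat.add_comm, Function.iterate_add_apply]
    refine (congrArg _ key).trans ?_
    exact Function.iterate_fixed rfl d
  rw [key2]
  refine ⟨rfl, ?_⟩
  rw [← hx]
  exact decide_eq_true_iff

end Compile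

end Cmd

/-! ### Binary trees on a stack -/

/-- Binary trees, the data on which the polynomial-time functions below operate. A list is the
tree `cons x₁ (cons x₂ ⋯ nil)`. -/
inductive Data : Type
  | nil : Data
  | cons : Data → Data → Data
  deriving DecidableEq

namespace Data

/-- Number of nodes and leaves. -/
def size : Data → ℕ
  | nil => 1
  | cons x y => x.size + y.size + 1

def hd : Data → Data
  | nil => nil
  | cons x _ => x

def tl : Data → Data
  | nil => nil
  | cons _ y => y

/-- A tree seen as a list. -/
def toList : Data → List Data
  | nil => []
  | cons x y => x :: y.toList

/-- Length of a tree as a list; also the natural number that a tree stands for in unary. -/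
def len (d : Data) : ℕ := d.toList.length

@[simp] theorem len_nil : nil.len = 0 := rfl

@[simp] theorem len_cons (x y : Data) : (cons x y).len = y.len + 1 := rfl

theorem size_pos (d : Data) : 0 < d.size := by cases d <;> simp [size]

theorem size_hd_le (d : Data) : d.hd.size ≤ d.size := by cases d <;> simp [size, hd]; omega

theorem size_tl_le (d : Data) : d.tl.size ≤ d.size := by cases d <;> simp [size, tl]; omega

theorem len_lt_size (d : Data) : d.len < d.size := by
  induction d with
  | nil => simp [size]
  | cons x y _ ih => simp only [len_cons, size]; omega

end Data

/-- Auxiliary tape symbols: `zero` and `one` are the digits of the prefix code of trees, `pad` is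
used to make query words long. -/
inductive Aux : Type
  | zero | one | pad
  deriving DecidableEq

instance : Fintype Aux where
  elems := {.zero, .one, .pad}
  complete := by intro t; cases t <;> decide

/-- The tape alphabet for the input alphabet `A`. -/
abbrev TapeSym (A : Type) : Type := A ⊕ Aux

/-- The stacks: `main` holds a stack of trees, `a`, `b` and `cnt` are empty between the basic
operations on trees, and the others are not touched by computations on trees. -/
inductive Reg : Type
  | main | a | b | cnt | inp | query | pad
  deriving DecidableEq

instance : Fintype Reg where
  elems := {.main, .a, .b, .cnt, .inp, .query, .pad}
  complete := by intro t; cases t <;> decide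

/-- Prefix code of a tree. -/
def Data.code {A : Type} : Data → List (TapeSym A)
  | nil => [.inr .zero]
  | cons x y => .inr .one :: (x.code ++ y.code)

theorem Data.length_code {A : Type} (d : Data) : (d.code (A := A)).length = d.size := by
  induction d with
  | nil => rfl
  | cons x y hx hy => simp [code, size, hx, hy]

theorem Polynomial.eval_mono_nat (p : Polynomial ℕ) {m n : ℕ} (h : m ≤ n) :
    p.eval m ≤ p.eval n := by
  rw [Polynomial.eval_eq_sum_range, Polynomial.eval_eq_sum_range]
  exact Finset.sum_le_sum fun i _ => Nat.mul_le_mul_left _ (Nat.pow_le_pow_left h i)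

namespace Cmd

variable {K Γ : Type} [DecidableEq K]

/-- The program `c` turns the stacks `S` into `S'` in at most `n` steps, without consulting the
oracle. -/
def Does (c : Cmd K Γ) (S S' : Stacks K Γ) (n : ℕ) : Prop :=
  ∀ (q : K) (O : Language Γ), ∃ t ≤ n, Runs q O c S S' t

theorem Does.mono {c : Cmd K Γ} {S S' : Stacks K Γ} {m n : ℕ} (h : Does c S S' m) (hmn : m ≤ n) :
    Does c S S' n := fun q O =>
  let ⟨t, ht, hr⟩ := h q O
  ⟨t, ht.trans hmn, hr⟩

theorem Does.of_eq {c : Cmd K Γ} {S S' S'' : Stacks K Γ} {n : ℕ} (h : Does c S S' n)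
    (hS : S' = S'') : Does c S S'' n := hS ▸ h

theorem Does.of_eq' {c : Cmd K Γ} {S S' S'' : Stacks K Γ} {n : ℕ} (h : Does c S S' n)
    (hS : S'' = S) : Does c S'' S' n := hS ▸ h

theorem Does.seq {c d : Cmd K Γ} {S S' S'' : Stacks K Γ} {m n : ℕ} (h : Does c S S' m)
    (h' : Does d S' S'' n) : Does (seq c d) S S'' (m + n) := fun q O =>
  let ⟨t, ht, hr⟩ := h q O
  let ⟨t', ht', hr'⟩ := h' q O
  ⟨t + t', Nat.add_le_add ht ht', .seq hr hr'⟩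

theorem does_push (k : K) (a : Γ) (S : Stacks K Γ) :
    Does (push k a) S (Function.update S k (a :: S k)) 1 := fun _ _ => ⟨1, le_rfl, .push k a S⟩

theorem does_pop (k : K) (S : Stacks K Γ) :
    Does (pop k) S (Function.update S k (S k).tail) 1 := fun _ _ => ⟨1, le_rfl, .pop k S⟩

theorem Does.case {k : K} {f : Option Γ → Cmd K Γ} {S S' : Stacks K Γ} {n : ℕ} {o : Option Γ}
    (ho : (S k).head? = o) (h : Does (f o) S S' n) : Does (case k f) S S' (1 + n) := fun q O =>
  let ⟨t, ht, hr⟩ := h q O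
  ⟨1 + t, Nat.add_le_add_left ht 1, .case (ho ▸ hr)⟩

theorem does_loop_done {k : K} {p : Option Γ → Bool} {c : Cmd K Γ} {S : Stacks K Γ}
    (h : p (S k).head? = false) : Does (loop k p c) S S 1 := fun _ _ => ⟨1, le_rfl, .loop_done h⟩

theorem Does.loop {k : K} {p : Option Γ → Bool} {c : Cmd K Γ} {S S' S'' : Stacks K Γ} {m n : ℕ}
    (hp : p (S k).head? = true) (h : Does c S S' m) (h' : Does (loop k p c) S' S'' n) :
    Does (loop k p c) S S'' (1 + m + n) := fun q O =>
  let ⟨t, ht, hr⟩ := h q O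
  let ⟨t', ht', hr'⟩ := h' q O
  ⟨1 + t + t', by omega, .loop_step hp hr hr'⟩

/-- Pour stack `i` onto stack `j`. -/
def pour (i j : K) : Cmd K Γ :=
  loop i Option.isSome (case i fun o => o.elim skip fun s => seq (pop i) (push j s))

theorem does_pour {i j : K} (hij : i ≠ j) (l : List Γ) :
    ∀ S : Stacks K Γ, S i = l →
      Does (pour i j) S (Function.update (Function.update S i []) j (l.reverse ++ S j))
        (4 * l.length + 1) := by
  induction l with
  | nil =>
    intro S hS
    have : Function.update (Function.update S i []) j ([].reverse ++ S j) = S := by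
      funext k
      by_cases hi : k = i <;> by_cases hj : k = j <;> simp_all [Function.update_apply]
    rw [this]
    exact does_loop_done (by simp [hS])
  | cons s l ih =>
    intro S hS
    have h1 := does_pop i S
    have h2 := does_push j s (Function.update S i (S i).tail)
    have h3 := ih _ (show Function.update (Function.update S i (S i).tail) j
      (s :: Function.update S i (S i).tail j) i = l by simp [hij, hS])
    refine Does.of_eq ((Does.loop (by simp [hS]) (Does.case (o := some s) (by simp [hS]) (h1.seq h2))
      h3).mono ?_) ?_
    · simp; omega
    · funext k
      by_cases hi : k = i <;> by_cases hj : k = j <;> simp_all [Function.update_apply]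

/-- Remove stack `i`. -/
def clear (i : K) : Cmd K Γ :=
  loop i Option.isSome (pop i)

theorem does_clear {i : K} (l : List Γ) :
    ∀ S : Stacks K Γ, S i = l → Does (clear i) S (Function.update S i []) (2 * l.length + 1) := by
  induction l with
  | nil =>
    intro S hS
    exact (does_loop_done (by simp [hS])).of_eq (by rw [← hS]; simp)
  | cons s l ih =>
    intro S hS
    have h3 := ih (Function.update S i (S i).tail) (by simp [hS])
    refine ((Does.loop (by simp [hS]) (does_pop i S) h3).mono ?_).of_eq ?_
    · simp; omega
    · simp

/-- Pour stack `i` onto both `j` and `k`. -/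
def pour₂ (i j k : K) : Cmd K Γ :=
  loop i Option.isSome (case i fun o => o.elim skip fun s => seq (pop i) (seq (push j s) (push k s)))

theorem does_pour₂ {i j k : K} (hij : i ≠ j) (hik : i ≠ k) (hjk : j ≠ k) (l : List Γ) :
    ∀ S : Stacks K Γ, S i = l →
      Does (pour₂ i j k) S (Function.update (Function.update (Function.update S i [])
        j (l.reverse ++ S j)) k (l.reverse ++ S k)) (5 * l.length + 1) := by
  induction l with
  | nil =>
    intro S hS
    refine (does_loop_done (by simp [hS])).of_eq ?_
    funext m
    by_cases hi : m = i <;> by_cases hj : m = j <;> by_cases hk : m = k <;>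
      simp_all [Function.update_apply]
  | cons s l ih =>
    intro S hS
    have h1 := does_pop i S
    have h2 := does_push j s (Function.update S i (S i).tail)
    have h2' := does_push k s (Function.update (Function.update S i (S i).tail) j
      (s :: Function.update S i (S i).tail j))
    have h3 := ih _ (show Function.update (Function.update (Function.update S i (S i).tail) j
      (s :: Function.update S i (S i).tail j)) k (s :: Function.update (Function.update S i
        (S i).tail) j (s :: Function.update S i (S i).tail j) k) i = l by simp [hij, hik, hS])
    refine ((Does.loop (by simp [hS]) (Does.case (o := some s) (by simp [hS])
      (h1.seq (h2.seq h2'))) h3).mono ?_).of_eq ?_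
    · simp; omega
    · funext m
      by_cases hi : m = i <;> by_cases hj : m = j <;> by_cases hk : m = k <;>
        simp_all [Function.update_apply]

/-! ### Operations on the topmost trees -/

variable {A : Type}

/-- Test for the digit `one`. -/
def isOne : Option (TapeSym A) → Bool
  | some (.inr .one) => true
  | _ => false

/-- Move the topmost tree of stack `i` to stack `j`, which reverses its code. The stack `cnt`
counts the subtrees that have still to be read. -/
def take (i j : Reg) : Cmd Reg (TapeSym A) :=
  seq (push .cnt (.inr .one)) (loop .cnt isOne (case i fun o =>
    if isOne o then seq (seq (pop i) (push j (.inr .one))) (push .cnt (.inr .one))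
    else seq (seq (pop i) (push j (.inr .zero))) (pop .cnt)))

/-- Reading one tree decreases the counter by one. The rest of the run is passed as `h`, since the
loop goes on if further subtrees are to be read. -/
theorem does_take_loop {i j : Reg} (hij : i ≠ j) (hi : i ≠ .cnt) (hj : j ≠ .cnt) (d : Data) :
    ∀ (S : Stacks Reg (TapeSym A)) (r C : List (TapeSym A)) (S' : Stacks Reg (TapeSym A)) (n : ℕ),
      S i = d.code ++ r → S .cnt = .inr .one :: C →
      Does (loop .cnt isOne (case i fun o =>
        if isOne o then seq (seq (pop i) (push j (.inr .one))) (push .cnt (.inr .one))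
        else seq (seq (pop i) (push j (.inr .zero))) (pop .cnt)))
        (Function.update (Function.update (Function.update S i r) j (d.code.reverse ++ S j))
          .cnt C) S' n →
      Does (loop .cnt isOne (case i fun o =>
        if isOne o then seq (seq (pop i) (push j (.inr .one))) (push .cnt (.inr .one))
        else seq (seq (pop i) (push j (.inr .zero))) (pop .cnt))) S S' (5 * d.size + n) := by
  induction d with
  | nil =>
    intro S r C S' n hS hC h
    have h1 := does_pop i S
    have h2 := does_push j (.inr .zero) (Function.update S i (S i).tail)
    have h3 := does_pop .cnt (Function.update (Function.update S i (S i).tail) j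
      (.inr .zero :: Function.update S i (S i).tail j))
    refine (Does.loop (by simp [hC, isOne]) (Does.case (o := some (.inr .zero))
      (by simp [hS, Data.code]) ((h1.seq h2).seq h3)) (h.of_eq' ?_)).mono ?_
    · funext m
      by_cases h1 : m = i <;> by_cases h2 : m = j <;> by_cases h3 : m = .cnt <;>
        simp_all [Function.update_apply, Data.code]
    · simp [Data.size]
  | cons x y hx hy =>
    intro S r C S' n hS hC h
    have hi' := hi.symm
    have hj' := hj.symm
    have hij' := hij.symm
    have h1 := does_pop i S
    have h2 := does_push j (.inr .one) (Function.update S i (S i).tail)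
    have h3 := does_push .cnt (.inr .one) (Function.update (Function.update S i (S i).tail) j
      (.inr .one :: Function.update S i (S i).tail j))
    refine (Does.loop (by simp [hC, isOne]) (Does.case (o := some (.inr .one))
      (by simp [hS, Data.code]) ((h1.seq h2).seq h3)) (hx _ (y.code ++ r) (.inr .one :: C) _ _
        ?_ ?_ (hy _ r C S' n ?_ ?_ (h.of_eq' ?_)))).mono ?_
    · simp_all [Data.code]
    · simp_all [Data.code]
    · simp_all [Data.code]
    · simp_all [Data.code]
    · funext m
      by_cases h1 : m = i <;> by_cases h2 : m = j <;> by_cases h3 : m = .cnt <;>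
        simp_all [Data.code]
    · simp [Data.size]; omega

theorem does_take {i j : Reg} (hij : i ≠ j) (hi : i ≠ .cnt) (hj : j ≠ .cnt) (d : Data)
    (S : Stacks Reg (TapeSym A)) (r : List (TapeSym A)) (hS : S i = d.code ++ r)
    (hC : S .cnt = []) :
    Does (take i j) S (Function.update (Function.update S i r) j (d.code.reverse ++ S j))
      (5 * d.size + 2) := by
  refine ((does_push .cnt (.inr .one) S).seq (does_take_loop hij hi hj d _ r [] _ 1 ?_ ?_
    ((does_loop_done ?_).of_eq ?_))).mono ?_
  · simp [hi, hS]
  · simp [hC]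
  · simp [isOne]
  · funext m
    by_cases h1 : m = i <;> by_cases h2 : m = j <;> by_cases h3 : m = .cnt <;>
      simp_all [Function.update_apply]
  · omega

/-- The stacks `a`, `b` and `cnt` are empty. -/
def Clean (S : Stacks Reg (TapeSym A)) : Prop := S .a = [] ∧ S .b = [] ∧ S .cnt = []

/-- Replace the contents of the main stack. -/
abbrev withMain (S : Stacks Reg (TapeSym A)) (l : List (TapeSym A)) : Stacks Reg (TapeSym A) :=
  Function.update S .main l

theorem Clean.withMain {S : Stacks Reg (TapeSym A)} (h : Clean S) (l : List (TapeSym A)) :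
    Clean (withMain S l) := by
  simpa [Clean, Cmd.withMain] using h

/-- The program `c` rewrites the top `u` of the main stack into `v` in at most `n` steps, whatever
lies below. -/
def Rewrites (c : Cmd Reg (TapeSym A)) (u v : List (TapeSym A)) (n : ℕ) : Prop :=
  ∀ (S : Stacks Reg (TapeSym A)) (r : List (TapeSym A)), S .main = u ++ r → Clean S →
    Does c S (withMain S (v ++ r)) n

theorem Rewrites.mono {c : Cmd Reg (TapeSym A)} {u v : List (TapeSym A)} {m n : ℕ}
    (h : Rewrites c u v m) (hmn : m ≤ n) : Rewrites c u v n :=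
  fun S r hS hc => (h S r hS hc).mono hmn

theorem Rewrites.seq {c d : Cmd Reg (TapeSym A)} {u v w : List (TapeSym A)} {m n : ℕ}
    (h : Rewrites c u v m) (h' : Rewrites d v w n) : Rewrites (seq c d) u w (m + n) :=
  fun S r hS hc => ((h S r hS hc).seq (h' _ r (by simp) (hc.withMain _))).of_eq (by simp)

theorem Rewrites.append {c : Cmd Reg (TapeSym A)} {u v : List (TapeSym A)} {n : ℕ}
    (h : Rewrites c u v n) (r : List (TapeSym A)) : Rewrites c (u ++ r) (v ++ r) n :=
  fun S r' hS hc => (h S (r ++ r') (by simpa using hS) hc).of_eq (by simp)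

theorem rewrites_skip (u : List (TapeSym A)) : Rewrites skip u u 1 := fun S r hS _ =>
  Does.of_eq (fun _ _ => ⟨1, le_rfl, .skip S⟩) (by rw [← hS]; simp)

theorem rewrites_push (s : TapeSym A) (u : List (TapeSym A)) :
    Rewrites (push .main s) u (s :: u) 1 :=
  fun S r hS _ => (does_push _ s S).of_eq (by simp [hS])

theorem rewrites_pop (s : TapeSym A) (u : List (TapeSym A)) :
    Rewrites (pop .main) (s :: u) u 1 :=
  fun S r hS _ => (does_pop _ S).of_eq (by simp [hS])

theorem Rewrites.case {f : Option (TapeSym A) → Cmd Reg (TapeSym A)} {u v : List (TapeSym A)}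
    {n : ℕ} {s : TapeSym A} (hu : u.head? = some s) (h : Rewrites (f (some s)) u v n) :
    Rewrites (case .main f) u v (1 + n) :=
  fun S r hS hc => Does.case (by simp [hS, hu]) (h S r hS hc)

theorem rewrites_loop_done {p : Option (TapeSym A) → Bool} {c : Cmd Reg (TapeSym A)}
    {u : List (TapeSym A)} {s : TapeSym A} (hu : u.head? = some s) (hp : p (some s) = false) :
    Rewrites (loop .main p c) u u 1 :=
  fun S r hS _ => (does_loop_done (by simp [hS, hu, hp])).of_eq (by rw [← hS]; simp)

theorem Rewrites.loop {p : Option (TapeSym A) → Bool} {c : Cmd Reg (TapeSym A)}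
    {u v w : List (TapeSym A)} {s : TapeSym A} {m n : ℕ} (hu : u.head? = some s)
    (hp : p (some s) = true) (h : Rewrites c u v m) (h' : Rewrites (loop .main p c) v w n) :
    Rewrites (loop .main p c) u w (1 + m + n) := fun S r hS hc =>
  (Does.loop (by simp [hS, hu, hp]) (h S r hS hc) (h' _ r (by simp) (hc.withMain _))).of_eq
    (by simp)

/-- Remove the topmost tree. -/
def drop : Cmd Reg (TapeSym A) := seq (take .main .a) (clear .a)

theorem rewrites_drop (x : Data) (u : List (TapeSym A)) :
    Rewrites drop (x.code ++ u) u (10 * x.size) := by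
  intro S r hS hc
  have h1 := does_take (i := .main) (j := .a) (by simp) (by simp) (by simp) x S (u ++ r)
    (by simpa using hS) hc.2.2
  refine ((h1.seq (does_clear x.code.reverse _ (by simp [hc.1]))).mono ?_).of_eq ?_
  · have := x.size_pos
    simp [Data.length_code]; omega
  · funext m
    cases m <;> simp [hc.1]

/-- Duplicate the topmost tree. -/
def dup : Cmd Reg (TapeSym A) :=
  seq (take .main .a) (seq (pour₂ .a .main .b) (seq (pour .b .a) (pour .a .main)))

theorem rewrites_dup (x : Data) (u : List (TapeSym A)) :
    Rewrites dup (x.code ++ u) (x.code ++ (x.code ++ u)) (24 * x.size) := by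
  intro S r hS hc
  have h1 := does_take (i := .main) (j := .a) (by simp) (by simp) (by simp) x S (u ++ r)
    (by simpa using hS) hc.2.2
  have h2 := does_pour₂ (i := Reg.a) (j := .main) (k := .b) (by simp) (by simp) (by simp)
    (x.code.reverse) _ (show Function.update (Function.update S .main (u ++ r)) .a
      (x.code.reverse ++ S .a) .a = x.code.reverse by simp [hc.1])
  have h3 := fun S => does_pour (K := Reg) (Γ := TapeSym A) (i := .b) (j := .a) (by simp)
    x.code S
  have h4 := fun S => does_pour (K := Reg) (Γ := TapeSym A) (i := .a) (j := .main) (by simp)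
    x.code.reverse S
  refine ((h1.seq (h2.seq ((h3 _ ?_).seq (h4 _ ?_)))).mono ?_).of_eq ?_
  · simp [hc.2.1]
  · simp
  · have := x.size_pos
    simp [Data.length_code]; omega
  · funext m
    cases m <;> simp [hc.1, hc.2.1]

/-- Exchange the two topmost trees. -/
def swap : Cmd Reg (TapeSym A) :=
  seq (take .main .a) (seq (take .main .b) (seq (pour .a .main) (pour .b .main)))

theorem rewrites_swap (x y : Data) (u : List (TapeSym A)) :
    Rewrites swap (x.code ++ (y.code ++ u)) (y.code ++ (x.code ++ u))
      (12 * (x.size + y.size)) := by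
  intro S r hS hc
  have h1 := does_take (i := .main) (j := .a) (by simp) (by simp) (by simp) x S
    (y.code ++ (u ++ r)) (by simpa using hS) hc.2.2
  have h2 := does_take (i := .main) (j := .b) (by simp) (by simp) (by simp) y _ (u ++ r)
    (show Function.update (Function.update S .main (y.code ++ (u ++ r))) .a
      (x.code.reverse ++ S .a) .main = y.code ++ (u ++ r) by simp) (by simp [hc.2.2])
  have h3 := fun S => does_pour (K := Reg) (Γ := TapeSym A) (i := .a) (j := .main) (by simp)
    x.code.reverse S
  have h4 := fun S => does_pour (K := Reg) (Γ := TapeSym A) (i := .b) (j := .main) (by simp)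
    y.code.reverse S
  refine ((h1.seq (h2.seq ((h3 _ ?_).seq (h4 _ ?_)))).mono ?_).of_eq ?_
  · simp [hc.1]
  · simp [hc.2.1]
  · have := x.size_pos
    have := y.size_pos
    simp [Data.length_code]; omega
  · funext m
    cases m <;> simp [hc.1, hc.2.1]

end Cmd

/-! ### Polynomial-time functions on trees -/

namespace Data

/-- The number of a tree, by means of the pairing function. -/
def toNat : Data → ℕ
  | nil => 0
  | cons x y => Nat.pair x.toNat y.toNat + 1

/-- The tree with a given number. -/
def ofNat : ℕ → Data
  | 0 => nil
  | n + 1 => cons (ofNat n.unpair.1) (ofNat n.unpair.2)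
decreasing_by
  · exact Nat.lt_succ_of_le n.unpair_left_le
  · exact Nat.lt_succ_of_le n.unpair_right_le

/-- Trees are in bijection with the natural numbers. -/
def equivNat : Data ≃ ℕ where
  toFun := toNat
  invFun := ofNat
  left_inv d := by
    induction d with
    | nil => simp [toNat, ofNat]
    | cons x y hx hy => simp [toNat, ofNat, hx, hy]
  right_inv n := by
    induction n using Nat.strong_induction_on with
    | _ n ih =>
      cases n with
      | zero => simp [toNat, ofNat]
      | succ n =>
        rw [ofNat, toNat, ih _ (Nat.lt_succ_of_le n.unpair_left_le),
          ih _ (Nat.lt_succ_of_le n.unpair_right_le), Nat.pair_unpair]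

instance : Primcodable Data := Primcodable.ofEquiv ℕ equivNat

theorem primrec_cons : Primrec₂ cons := by
  have h : Primrec₂ fun x y : Data => equivNat.symm (Nat.pair (equivNat x) (equivNat y) + 1) :=
    Primrec.of_equiv_symm.comp (Primrec.succ.comp (Primrec₂.natPair.comp
      (Primrec.of_equiv.comp Primrec.fst) (Primrec.of_equiv.comp Primrec.snd)))
  refine h.of_eq fun x y => ?_
  rw [Equiv.symm_apply_eq]
  rfl

theorem primrec_hd : Primrec hd := by
  have h : Primrec fun x : Data => equivNat.symm (equivNat x).pred.unpair.1 :=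
    Primrec.of_equiv_symm.comp (Primrec.fst.comp (Primrec.unpair.comp
      (Primrec.pred.comp Primrec.of_equiv)))
  refine h.of_eq fun x => ?_
  rw [Equiv.symm_apply_eq]
  cases x <;> simp [equivNat, toNat, hd]

theorem primrec_tl : Primrec tl := by
  have h : Primrec fun x : Data => equivNat.symm (equivNat x).pred.unpair.2 :=
    Primrec.of_equiv_symm.comp (Primrec.snd.comp (Primrec.unpair.comp
      (Primrec.pred.comp Primrec.of_equiv)))
  refine h.of_eq fun x => ?_
  rw [Equiv.symm_apply_eq]
  cases x <;> simp [equivNat, toNat, tl]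

theorem primrec_len : Primrec len := by
  let step : Data × ℕ → Data × ℕ := fun s => if s.1 = nil then s else (s.1.tl, s.2 + 1)
  have hstep : Primrec step :=
    Primrec.ite (Primrec.eq.comp Primrec.fst (Primrec.const nil)) Primrec.id
      (Primrec.pair (primrec_tl.comp Primrec.fst) (Primrec.succ.comp Primrec.snd))
  have hlen : ∀ (n : ℕ) (d : Data) (m : ℕ), d.len ≤ n → step^[n] (d, m) = (nil, m + d.len) := by
    intro n
    induction n with
    | zero =>
      intro d m h
      cases d with
      | nil => rfl
      | cons x y => simp at h
    | succ n ih =>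
      intro d m h
      rw [Function.iterate_succ_apply]
      cases d with
      | nil => exact ih nil m (by simp)
      | cons x y =>
        rw [len_cons] at h
        rw [show step (cons x y, m) = (y, m + 1) by simp [step, tl], ih y _ (by omega), len_cons]
        congr 1
        omega
  have hle : ∀ d : Data, d.len ≤ equivNat d := by
    intro d
    induction d with
    | nil => simp
    | cons x y _ ih =>
      rw [len_cons]
      exact Nat.succ_le_succ (ih.trans (Nat.right_le_pair _ _))
  have h : Primrec fun d : Data => (step^[equivNat d] (d, 0)).2 :=
    Primrec.snd.comp (Primrec.nat_iterate Primrec.of_equiv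
      (Primrec.pair Primrec.id (Primrec.const 0)) (hstep.comp Primrec.snd).to₂)
  refine h.of_eq fun d => ?_
  rw [hlen _ _ _ (hle d)]
  simp

end Data

/-- Types whose elements are represented by trees. -/
class Enc (α : Type) where
  enc : α → Data

open Enc (enc)

instance : Enc Data := ⟨fun d => d⟩

instance : Enc Unit := ⟨fun _ => .nil⟩

instance : Enc Bool := ⟨fun b => if b then .cons .nil .nil else .nil⟩

instance {α β : Type} [Enc α] [Enc β] : Enc (α × β) := ⟨fun p => .cons (enc p.1) (enc p.2)⟩

instance {α : Type} [Enc α] : Enc (List α) :=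
  ⟨fun l => l.foldr (fun a d => .cons (enc a) d) .nil⟩

/-- Natural numbers are represented in unary. -/
instance : Enc ℕ := ⟨fun n => enc (List.replicate n ())⟩

/-- The size of the representation. -/
def esize {α : Type} [Enc α] (a : α) : ℕ := (enc a).size

section Enc

variable {α β γ σ : Type} [Enc α] [Enc β] [Enc γ] [Enc σ]

theorem enc_data (d : Data) : enc d = d := rfl

theorem enc_pair (a : α) (b : β) : enc (a, b) = .cons (enc a) (enc b) := rfl

theorem enc_nil : enc ([] : List α) = .nil := rfl

theorem enc_cons (a : α) (l : List α) : enc (a :: l) = .cons (enc a) (enc l) := rfl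

theorem enc_zero : enc 0 = .nil := rfl

theorem enc_succ (n : ℕ) : enc (n + 1) = .cons .nil (enc n) := rfl

theorem esize_pos (a : α) : 0 < esize a := Data.size_pos _

theorem esize_pair (a : α) (b : β) : esize (a, b) = esize a + esize b + 1 := rfl

theorem esize_nil : esize ([] : List α) = 1 := rfl

theorem esize_cons (a : α) (l : List α) : esize (a :: l) = esize a + esize l + 1 := rfl

theorem esize_bool (b : Bool) : esize b ≤ 3 := by cases b <;> simp [esize, enc, Data.size]

theorem esize_nat (n : ℕ) : esize n = 2 * n + 1 := by
  induction n with
  | zero => rfl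
  | succ n ih => simp only [esize, enc_succ, Data.size] at *; omega

theorem len_enc_list (l : List α) : (enc l).len = l.length := by
  induction l with
  | nil => rfl
  | cons a l ih => rw [enc_cons, Data.len_cons, ih, List.length_cons]

theorem len_enc_nat (n : ℕ) : (enc n).len = n := (len_enc_list _).trans List.length_replicate

/-- Functions that are computed in polynomial time by a stack program (over any input alphabet),
and are primitive recursive on representations. The bound on the size of the values is a consequence
of the time bound, but it is convenient to have it at hand; primitive recursiveness serves to prove
decidability. -/
@[fun_prop]
structure PTime (f : α → β) : Prop where
  size_le : ∃ p : Polynomial ℕ, ∀ a, esize (f a) ≤ p.eval (esize a)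
  prog : ∀ A : Type, ∃ (c : Cmd Reg (TapeSym A)) (p : Polynomial ℕ), ∀ a,
    Cmd.Rewrites c (enc a).code (enc (f a)).code (p.eval (esize a))
  primrec : ∃ F : Data → Data, Primrec F ∧ ∀ a, F (enc a) = enc (f a)

namespace PTime

open Cmd Polynomial

@[fun_prop]
theorem id : PTime fun a : α => a where
  size_le := ⟨X, by simp⟩
  prog A := ⟨skip, 1, fun x => by simpa using rewrites_skip (enc x).code⟩
  primrec := ⟨_, Primrec.id, fun _ => rfl⟩

/-- Only the representations of arguments and values matter. -/
theorem of_enc {α' β' : Type} [Enc α'] [Enc β'] {f : α → β} {f' : α' → β'} (hf : PTime f)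
    (h : ∀ a', ∃ a, enc a' = enc a ∧ enc (f' a') = enc (f a)) : PTime f' where
  size_le := by
    obtain ⟨p, hp⟩ := hf.size_le
    refine ⟨p, fun a' => ?_⟩
    obtain ⟨a, h1, h2⟩ := h a'
    simpa [esize, h1, h2] using hp a
  prog A := by
    obtain ⟨c, p, hp⟩ := hf.prog A
    refine ⟨c, p, fun a' => ?_⟩
    obtain ⟨a, h1, h2⟩ := h a'
    simpa [esize, h1, h2] using hp a
  primrec := by
    obtain ⟨F, hF, h'⟩ := hf.primrec
    refine ⟨F, hF, fun a' => ?_⟩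
    obtain ⟨a, h1, h2⟩ := h a'
    rw [h1, h2, h']

theorem of_enc_eq {f : α → β} {f' : α → γ} (hf : PTime f) (h : ∀ a, enc (f' a) = enc (f a)) :
    PTime f' := hf.of_enc fun a => ⟨a, rfl, h a⟩

@[fun_prop]
theorem toData : PTime fun a : α => enc a := id.of_enc_eq fun _ => rfl

theorem rewrites_pushes {A : Type} (l : List (TapeSym A)) :
    ∃ c : Cmd Reg (TapeSym A), ∀ u, Rewrites c u (l ++ u) (l.length + 1) := by
  induction l with
  | nil => exact ⟨skip, rewrites_skip⟩
  | cons s l ih =>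
    obtain ⟨c, hc⟩ := ih
    exact ⟨seq c (push .main s), fun u => (hc u).seq (rewrites_push s _)⟩

@[fun_prop]
theorem const (b : β) : PTime fun _ : α => b where
  size_le := ⟨C (esize b), by simp⟩
  prog A := by
    obtain ⟨c, hc⟩ := rewrites_pushes (A := A) (enc b).code
    refine ⟨seq drop c, C 10 * X + C ((enc b).size + 1), fun x => ?_⟩
    have := (rewrites_drop (A := A) (enc x) []).seq (hc [])
    simpa [Data.length_code, esize] using this
  primrec := ⟨_, Primrec.const _, fun _ => rfl⟩

@[fun_prop]
theorem comp {f : β → γ} {g : α → β} (hf : PTime f) (hg : PTime g) :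
    PTime fun x => f (g x) where
  size_le := by
    obtain ⟨p, hp⟩ := hf.size_le
    obtain ⟨q, hq⟩ := hg.size_le
    refine ⟨p.comp q, fun x => (hp _).trans ?_⟩
    rw [eval_comp]
    exact p.eval_mono_nat (hq x)
  prog A := by
    obtain ⟨c, p, hc⟩ := hf.prog A
    obtain ⟨d, q, hd⟩ := hg.prog A
    obtain ⟨s, hs⟩ := hg.size_le
    refine ⟨seq d c, q + p.comp s, fun x => ((hd x).seq (hc (g x))).mono ?_⟩
    rw [eval_add, eval_comp]
    exact Nat.add_le_add_left (p.eval_mono_nat (hs x)) _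
  primrec := by
    obtain ⟨F, hF, hf⟩ := hf.primrec
    obtain ⟨G, hG, hg⟩ := hg.primrec
    exact ⟨_, hF.comp hG, fun a => by rw [hg, hf]⟩

@[fun_prop]
theorem pair {f : α → β} {g : α → γ} (hf : PTime f) (hg : PTime g) :
    PTime fun x => (f x, g x) where
  size_le := by
    obtain ⟨p, hp⟩ := hf.size_le
    obtain ⟨q, hq⟩ := hg.size_le
    exact ⟨p + q + 1, fun x => by simpa [esize_pair] using Nat.add_le_add (hp x) (hq x)⟩
  prog A := by
    obtain ⟨c, p, hc⟩ := hf.prog A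
    obtain ⟨d, q, hd⟩ := hg.prog A
    obtain ⟨s, hs⟩ := hg.size_le
    -- The code of `(y, z)` is the digit `one` followed by those of `y` and `z`, so that `g x` has
    -- to be computed before `f x`.
    refine ⟨seq dup (seq d (seq swap (seq c (push .main (.inr .one))))),
      C 24 * X + (q + (C 12 * (s + X) + (p + 1))), fun x => ?_⟩
    have h1 := rewrites_dup (A := A) (enc x) []
    have h2 := (hd x).append ((enc x).code ++ [])
    have h3 := rewrites_swap (A := A) (enc (g x)) (enc x) []
    have h4 := (hc x).append ((enc (g x)).code ++ [])
    have h5 := rewrites_push (A := A) (.inr .one) ((enc (f x)).code ++ ((enc (g x)).code ++ []))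
    have h := (h1.seq (h2.seq (h3.seq (h4.seq h5))))
    rw [List.append_nil, List.append_nil] at h
    refine h.mono ?_
    simp only [eval_add, eval_mul, eval_C, eval_X, eval_one]
    have := hs x
    simp only [esize] at *
    omega
  primrec := by
    obtain ⟨F, hF, hf⟩ := hf.primrec
    obtain ⟨G, hG, hg⟩ := hg.primrec
    exact ⟨_, Data.primrec_cons.comp hF hG, fun a => by rw [hf, hg]; rfl⟩

@[fun_prop]
theorem data_hd : PTime Data.hd where
  size_le := ⟨X, fun x => by simpa [esize, enc_data] using x.size_hd_le⟩
  prog A := by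
    refine ⟨case .main fun o => if isOne o then seq (pop .main) (seq swap drop) else skip,
      C 22 * X + 2, fun x => ?_⟩
    simp only [enc_data]
    cases x with
    | nil => exact (Rewrites.case rfl (rewrites_skip _)).mono (by simp)
    | cons x y =>
      have h1 := (rewrites_pop (A := A) (.inr .one) _).seq ((rewrites_swap x y []).seq
        (rewrites_drop y _))
      rw [List.append_nil, List.append_nil] at h1
      refine (Rewrites.case (s := .inr .one) rfl h1).mono ?_
      simp [esize, enc_data, Data.size]; omega
  primrec := ⟨_, Data.primrec_hd, fun _ => rfl⟩

@[fun_prop]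
theorem data_tl : PTime Data.tl where
  size_le := ⟨X, fun x => by simpa [esize, enc_data] using x.size_tl_le⟩
  prog A := by
    refine ⟨case .main fun o => if isOne o then seq (pop .main) drop else skip,
      C 10 * X + 2, fun x => ?_⟩
    simp only [enc_data]
    cases x with
    | nil => exact (Rewrites.case rfl (rewrites_skip _)).mono (by simp)
    | cons x y =>
      refine (Rewrites.case (s := .inr .one) rfl ((rewrites_pop _ _).seq
        (rewrites_drop x _))).mono ?_
      simp [esize, enc_data, Data.size]; omega
  primrec := ⟨_, Data.primrec_tl, fun _ => rfl⟩

/-- Branching on whether a list is empty. -/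
theorem ite_nil {f : α → Data} {g h : α → β} (hf : PTime f) (hg : PTime g) (hh : PTime h) :
    PTime fun x => if f x = .nil then g x else h x where
  size_le := by
    obtain ⟨p, hp⟩ := hg.size_le
    obtain ⟨q, hq⟩ := hh.size_le
    refine ⟨p + q, fun x => ?_⟩
    have := hp x
    have := hq x
    rw [eval_add]
    split_ifs <;> omega
  prog A := by
    obtain ⟨c, p, hc⟩ := hf.prog A
    obtain ⟨d, q, hd⟩ := hg.prog A
    obtain ⟨e, r, he⟩ := hh.prog A
    obtain ⟨s, hs⟩ := hf.size_le
    refine ⟨seq dup (seq c (case .main fun o => if isOne o then seq drop e else seq drop d)),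
      C 24 * X + (p + (1 + (C 10 * s + (q + r)))), fun x => ?_⟩
    have h1 := rewrites_dup (A := A) (enc x) []
    have h2 := (hc x).append ((enc x).code ++ [])
    have h3 : Rewrites (case .main fun o => if isOne o then seq drop e else seq drop d)
        ((f x).code ++ ((enc x).code ++ [])) (enc (if f x = .nil then g x else h x)).code
        (1 + (10 * (f x).size + (q.eval (esize x) + r.eval (esize x)))) := by
      have h4 := rewrites_drop (A := A) (f x) (enc x).code
      rw [List.append_nil]
      cases hx : f x with
      | nil =>
        rw [hx] at h4
        exact (Rewrites.case (s := .inr .zero) rfl (h4.seq (hd x))).mono (by omega)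
      | cons y z =>
        rw [hx] at h4
        exact (Rewrites.case (s := .inr .one) rfl (h4.seq (he x))).mono (by omega)
    have h := (h1.seq (h2.seq h3))
    rw [List.append_nil] at h
    refine h.mono ?_
    have := hs x
    simp only [eval_add, eval_mul, eval_C, eval_X, eval_one]
    simp only [esize, enc_data] at *
    omega
  primrec := by
    obtain ⟨F, hF, hf⟩ := hf.primrec
    obtain ⟨G, hG, hg⟩ := hg.primrec
    obtain ⟨H, hH, hh⟩ := hh.primrec
    refine ⟨_, Primrec.ite (Primrec.eq.comp hF (Primrec.const .nil)) hG hH, fun a => ?_⟩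
    simp only [hf, hg, hh, enc_data]
    split_ifs <;> rfl

@[fun_prop]
theorem cond {f : α → Bool} {g h : α → β} (hf : PTime f) (hg : PTime g) (hh : PTime h) :
    PTime fun x => bif f x then g x else h x :=
  (ite_nil (toData.comp hf) hh hg).of_enc_eq fun a => by cases f a <;> simp [enc]

/-- Iteration of `f`, as often as the length of the list `g x`, provided that all intermediate
values are of polynomial size. -/
theorem iterate {f : σ → σ} {g : α → Data} {h : α → σ} (hf : PTime f) (hg : PTime g)
    (hh : PTime h) (hb : ∃ p : Polynomial ℕ, ∀ x, ∀ i ≤ (g x).len,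
      esize (f^[i] (h x)) ≤ p.eval (esize x)) :
    PTime fun x => f^[(g x).len] (h x) where
  size_le := hb.imp fun p hp x => hp x _ le_rfl
  prog A := by
    obtain ⟨c, p, hc⟩ := hf.prog A
    obtain ⟨d, q, hd⟩ := hg.prog A
    obtain ⟨e, r, he⟩ := hh.prog A
    obtain ⟨s, hs⟩ := hg.size_le
    obtain ⟨b, hb⟩ := hb
    -- The main stack holds the rest of the list `g x` and, below, the current value.
    let body : Cmd Reg (TapeSym A) := seq (pop .main) (seq drop (seq swap (seq c swap)))
    let T : Polynomial ℕ := C 3 + C 34 * s + C 24 * b + p.comp b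
    refine ⟨seq dup (seq e (seq swap (seq d (seq (loop .main isOne body) (pop .main))))),
      C 24 * X + (r + (C 12 * (b + X) + (q + ((s * T + 1) + 1)))), fun x => ?_⟩
    have hloop : ∀ (l : Data) (z : σ), l.size ≤ s.eval (esize x) →
        (∀ i ≤ l.len, esize (f^[i] z) ≤ b.eval (esize x)) →
        Rewrites (loop .main isOne body) (l.code ++ ((enc z).code ++ []))
          (.inr .zero :: (enc (f^[l.len] z)).code) (l.len * T.eval (esize x) + 1) := by
      intro l
      induction l with
      | nil =>
        intro z _ _
        simpa [Data.code] using rewrites_loop_done (A := A) (c := body)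
          (u := .inr .zero :: (enc z).code) (p := isOne) rfl rfl
      | cons a l _ ih =>
        intro z hl hz
        have h1 := rewrites_pop (A := A) (.inr .one) (a.code ++ l.code ++ ((enc z).code ++ []))
        have h2 := rewrites_drop (A := A) a (l.code ++ ((enc z).code ++ []))
        have h3 := rewrites_swap (A := A) l (enc z) []
        have h4 := (hc z).append (l.code ++ [])
        have h5 := rewrites_swap (A := A) (enc (f z)) l []
        have h6 := ih (f z) (by simp [Data.size] at hl; omega) fun i hi => by
          rw [← Function.iterate_succ_apply]
          exact hz _ (by simpa using hi)
        rw [List.append_assoc] at h1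
        have h7 := h1.seq (h2.seq (h3.seq (h4.seq h5)))
        have h8 : Rewrites (loop .main isOne body) ((Data.cons a l).code ++ ((enc z).code ++ []))
          (.inr .zero :: (enc (f^[(Data.cons a l).len] z)).code) _ :=
          Rewrites.loop (s := .inr .one) rfl rfl
            (by simpa [Data.code] using h7) h6
        refine h8.mono ?_
        have e1 := hz 0 (by simp)
        have e2 := hz 1 (by simp)
        simp only [Function.iterate_zero_apply, Function.iterate_one] at e1 e2
        have e3 := p.eval_mono_nat e1
        simp only [Data.size] at hl
        simp only [T, Data.len_cons, eval_add, eval_mul, eval_C, eval_comp, Nat.add_mul, one_mul]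
        simp only [esize] at *
        omega
    have h1 := rewrites_dup (A := A) (enc x) []
    have h2 := (he x).append ((enc x).code ++ [])
    have h3 := rewrites_swap (A := A) (enc (h x)) (enc x) []
    have h4 := (hd x).append ((enc (h x)).code ++ [])
    have h5 := hloop (g x) (h x) (hs x) (hb x)
    have h6 := rewrites_pop (A := A) (.inr .zero) (enc (f^[(g x).len] (h x))).code
    have h := h1.seq (h2.seq (h3.seq (h4.seq (h5.seq h6))))
    rw [List.append_nil] at h
    refine h.mono ?_
    have e1 := hb x 0 (by simp)
    have e2 : (g x).len * T.eval (esize x) ≤ s.eval (esize x) * T.eval (esize x) :=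
      Nat.mul_le_mul_right _ ((g x).len_lt_size.le.trans (hs x))
    simp only [Function.iterate_zero_apply] at e1
    simp only [eval_add, eval_mul, eval_C, eval_X, eval_one]
    simp only [esize] at *
    omega
  primrec := by
    obtain ⟨F, hF, hf⟩ := hf.primrec
    obtain ⟨G, hG, hg⟩ := hg.primrec
    obtain ⟨H, hH, hh⟩ := hh.primrec
    refine ⟨_, Primrec.nat_iterate (Data.primrec_len.comp hG) hH (hF.comp Primrec.snd).to₂,
      fun a => ?_⟩
    rw [hg, hh]
    have hs : Function.Semiconj (enc : σ → Data) f F := fun s => (hf s).symm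
    exact ((hs.iterate_right _) (h a)).symm

end PTime

/-! ### A library of polynomial-time functions -/

theorem esize_append (l l' : List α) : esize (l ++ l') + 1 = esize l + esize l' := by
  induction l with
  | nil => simp [esize_nil, Nat.add_comm]
  | cons a l ih => rw [List.cons_append, esize_cons, esize_cons]; omega

theorem esize_le_of_mem {a : α} {l : List α} (h : a ∈ l) : esize a ≤ esize l := by
  induction l with
  | nil => simp at h
  | cons b l ih =>
    rw [esize_cons]
    rcases List.mem_cons.1 h with rfl | h
    · omega
    · have := ih h; omega

theorem length_lt_esize (l : List α) : l.length < esize l := by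
  rw [← len_enc_list]; exact Data.len_lt_size _

theorem esize_drop_le (n : ℕ) (l : List α) : esize (l.drop n) ≤ esize l := by
  have := esize_append (l.take n) (l.drop n)
  rw [List.take_append_drop] at this
  have := esize_pos (l.take n)
  omega

theorem enc_data_list (d : Data) : enc d.toList = d := by
  induction d with
  | nil => rfl
  | cons x y _ ih => rw [Data.toList, enc_cons, ih]; rfl

namespace PTime

open Polynomial

@[fun_prop]
theorem fst {f : α → β × γ} (hf : PTime f) : PTime fun x => (f x).1 :=
  (data_hd.comp (toData.comp hf)).of_enc_eq fun _ => rfl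

@[fun_prop]
theorem snd {f : α → β × γ} (hf : PTime f) : PTime fun x => (f x).2 :=
  (data_tl.comp (toData.comp hf)).of_enc_eq fun _ => rfl

@[fun_prop]
theorem not {f : α → Bool} (hf : PTime f) : PTime fun x => !f x :=
  (hf.cond (const false) (const true)).of_enc_eq fun a => by cases f a <;> rfl

@[fun_prop]
theorem and {f g : α → Bool} (hf : PTime f) (hg : PTime g) : PTime fun x => f x && g x :=
  (hf.cond hg (const false)).of_enc_eq fun a => by cases f a <;> rfl

@[fun_prop]
theorem or {f g : α → Bool} (hf : PTime f) (hg : PTime g) : PTime fun x => f x || g x :=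
  (hf.cond (const true) hg).of_enc_eq fun a => by cases f a <;> rfl

@[fun_prop]
theorem data_cons {f g : α → Data} (hf : PTime f) (hg : PTime g) :
    PTime fun x => Data.cons (f x) (g x) := (hf.pair hg).of_enc_eq fun _ => rfl

@[fun_prop]
theorem data_isNil {f : α → Data} (hf : PTime f) : PTime fun x => decide (f x = .nil) :=
  (ite_nil hf (const true) (const false)).of_enc_eq fun a => by split_ifs <;> simp [*]

@[fun_prop]
theorem list_cons {f : α → β} {g : α → List β} (hf : PTime f) (hg : PTime g) :
    PTime fun x => f x :: g x := (hf.pair hg).of_enc_eq fun _ => rfl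

@[fun_prop]
theorem tail {f : α → List β} (hf : PTime f) : PTime fun x => (f x).tail :=
  (data_tl.comp (toData.comp hf)).of_enc_eq fun a => by cases f a <;> rfl

@[fun_prop]
theorem headD {f : α → List β} {g : α → β} (hf : PTime f) (hg : PTime g) :
    PTime fun x => (f x).headD (g x) :=
  (ite_nil (toData.comp hf) (toData.comp hg) (data_hd.comp (toData.comp hf))).of_enc_eq fun a => by
    cases f a <;> rfl

@[fun_prop]
theorem data_toList {f : α → Data} (hf : PTime f) : PTime fun x => (f x).toList :=
  hf.of_enc_eq fun _ => enc_data_list _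

theorem replicate_unit {f : α → ℕ} (hf : PTime f) : PTime fun x => List.replicate (f x) () :=
  hf.of_enc_eq fun _ => rfl

/-- Folding over a list, provided that all intermediate values are of polynomial size. -/
theorem foldl [Inhabited β] {f : α → List β} {g : α → σ} {h : α → σ → β → σ} (hf : PTime f)
    (hg : PTime g) (hh : PTime fun p : α × σ × β => h p.1 p.2.1 p.2.2)
    (hb : ∃ p : Polynomial ℕ, ∀ a, ∀ i ≤ (f a).length,
      esize (((f a).take i).foldl (h a) (g a)) ≤ p.eval (esize a)) :
    PTime fun a => (f a).foldl (h a) (g a) := by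
  let step : α × σ × List β → α × σ × List β := fun s =>
    (s.1, h s.1 s.2.1 (s.2.2.headD default), s.2.2.tail)
  have hstep : PTime step := by
    have h1 : PTime fun s : α × σ × List β => h s.1 s.2.1 (s.2.2.headD default) :=
      hh.comp (g := fun s : α × σ × List β => (s.1, s.2.1, s.2.2.headD default)) (by fun_prop)
    fun_prop
  have hiter : ∀ (a : α) (i : ℕ) (s : σ) (l : List β), i ≤ l.length →
      step^[i] (a, s, l) = (a, (l.take i).foldl (h a) s, l.drop i) := by
    intro a i
    induction i with
    | zero => intro s l _; simp
    | succ i ih =>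
      intro s l hl
      cases l with
      | nil => simp at hl
      | cons b l =>
        rw [Function.iterate_succ_apply]
        exact ih (h a s b) l (by simpa using hl)
  have key := iterate (g := fun a => enc (f a)) (h := fun a => (a, g a, f a)) hstep (by fun_prop)
    (by fun_prop) ?_
  · refine (fst (snd key)).of_enc_eq fun a => ?_
    rw [len_enc_list, hiter _ _ _ _ le_rfl]
    simp
  · obtain ⟨p, hp⟩ := hb
    obtain ⟨q, hq⟩ := hf.size_le
    refine ⟨X + (p + q + 1) + 1, fun a i hi => ?_⟩
    rw [len_enc_list] at hi
    rw [hiter _ _ _ _ hi, esize_pair, esize_pair]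
    have h1 := hp a i hi
    have h2 := hq a
    have h3 := esize_drop_le i (f a)
    simp only [eval_add, eval_X, eval_one]
    omega

theorem esize_foldl_le {δ : Type} {h : σ → δ → σ} {c : ℕ} (l : List δ) :
    (∀ s, ∀ b ∈ l, esize (h s b) ≤ esize s + c) →
    ∀ s, esize (l.foldl h s) ≤ esize s + l.length * c := by
  induction l with
  | nil => intro _ s; simp
  | cons b l ih =>
    intro hl s
    have h1 := ih (fun s b hb => hl s b (List.mem_cons_of_mem _ hb)) (h s b)
    have h2 := hl s b List.mem_cons_self
    rw [List.foldl_cons, List.length_cons, Nat.add_mul]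
    omega

/-- Folding over a list, if each step increases the size by a bounded amount only. -/
theorem foldl_of_add [Inhabited β] {f : α → List β} {g : α → σ} {h : α → σ → β → σ}
    (hf : PTime f) (hg : PTime g) (hh : PTime fun p : α × σ × β => h p.1 p.2.1 p.2.2)
    (hb : ∃ q : Polynomial ℕ, ∀ a s b, esize (h a s b) ≤ esize s + q.eval (esize a + esize b)) :
    PTime fun a => (f a).foldl (h a) (g a) := by
  refine foldl hf hg hh ?_
  obtain ⟨q, hq⟩ := hb
  obtain ⟨p, hp⟩ := hf.size_le
  obtain ⟨r, hr⟩ := hg.size_le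
  refine ⟨r + p * q.comp (X + p), fun a i _ => ?_⟩
  refine (esize_foldl_le (c := (q.comp (X + p)).eval (esize a)) _ (fun s b hb => ?_) _).trans ?_
  · refine (hq a s b).trans (Nat.add_le_add_left ?_ _)
    rw [eval_comp, eval_add, eval_X]
    exact q.eval_mono_nat (Nat.add_le_add_left
      ((esize_le_of_mem (List.mem_of_mem_take hb)).trans (hp a)) _)
  · rw [eval_add, eval_mul]
    refine Nat.add_le_add (hr a) (Nat.mul_le_mul_right _ ?_)
    exact (List.length_take_le' _ _).trans ((length_lt_esize _).le.trans (hp a))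

@[fun_prop]
theorem reverse [Inhabited β] {f : α → List β} (hf : PTime f) : PTime fun a => (f a).reverse := by
  have := foldl_of_add (h := fun (_ : α) (s : List β) b => b :: s) hf (const []) (by fun_prop)
    ⟨X + 1, fun a s b => by simp [esize_cons]; omega⟩
  exact this.of_enc_eq fun a => by rw [List.foldl_flip_cons_eq_append']; simp

theorem foldr_of_add [Inhabited β] {f : α → List β} {g : α → σ} {h : α → β → σ → σ}
    (hf : PTime f) (hg : PTime g) (hh : PTime fun p : α × σ × β => h p.1 p.2.2 p.2.1)
    (hb : ∃ q : Polynomial ℕ, ∀ a b s, esize (h a b s) ≤ esize s + q.eval (esize a + esize b)) :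
    PTime fun a => (f a).foldr (h a) (g a) := by
  have := foldl_of_add (h := fun a s b => h a b s) (reverse hf) hg hh
    (hb.imp fun q hq a s b => hq a b s)
  simpa using this

@[fun_prop]
theorem append [Inhabited β] {f g : α → List β} (hf : PTime f) (hg : PTime g) :
    PTime fun a => f a ++ g a := by
  have := foldr_of_add (h := fun (_ : α) b (s : List β) => b :: s) hf hg (by fun_prop)
    ⟨X + 1, fun a s b => by simp [esize_cons]; omega⟩
  simpa using this

@[fun_prop]
theorem map [Inhabited β] {f : α → List β} {h : α → β → γ} (hf : PTime f)
    (hh : PTime fun p : α × β => h p.1 p.2) : PTime fun a => (f a).map (h a) := by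
  have h1 : PTime fun p : α × List γ × β => h p.1 p.2.2 :=
    hh.comp (g := fun p : α × List γ × β => (p.1, p.2.2)) (by fun_prop)
  have := foldr_of_add (h := fun a b (s : List γ) => h a b :: s) hf (const []) (by fun_prop) ?_
  · exact this.of_enc_eq fun a => by rw [List.map_eq_foldr]
  · obtain ⟨p, hp⟩ := hh.size_le
    refine ⟨p.comp (X + 1) + 1, fun a b s => ?_⟩
    have := hp (a, b)
    dsimp only at this
    rw [esize_pair] at this
    simp only [eval_add, eval_comp, eval_X, eval_one, esize_cons]
    omega

@[fun_prop]
theorem filter [Inhabited β] {f : α → List β} {P : α → β → Bool} (hf : PTime f)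
    (hP : PTime fun p : α × β => P p.1 p.2) : PTime fun a => (f a).filter (P a) := by
  have h1 : PTime fun p : α × List β × β => P p.1 p.2.2 :=
    hP.comp (g := fun p : α × List β × β => (p.1, p.2.2)) (by fun_prop)
  have := foldr_of_add (h := fun a b (s : List β) => bif P a b then b :: s else s) hf (const [])
    (by fun_prop) ⟨X + 1, fun a b s => by
      cases P a b <;> simp only [cond_true, cond_false, esize_cons, eval_add, eval_X, eval_one] <;>
        omega⟩
  refine this.of_enc_eq fun a => ?_
  congr 1
  induction f a with
  | nil => rfl
  | cons b l ih => rw [List.foldr_cons, ← ih, List.filter_cons]; cases P a b <;> rfl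

@[fun_prop]
theorem flatMap [Inhabited β] [Inhabited γ] {f : α → List β} {h : α → β → List γ} (hf : PTime f)
    (hh : PTime fun p : α × β => h p.1 p.2) : PTime fun a => (f a).flatMap (h a) := by
  have h1 : PTime fun p : α × List γ × β => h p.1 p.2.2 :=
    hh.comp (g := fun p : α × List γ × β => (p.1, p.2.2)) (by fun_prop)
  have := foldr_of_add (h := fun a b (s : List γ) => h a b ++ s) hf (const []) (by fun_prop) ?_
  · refine this.of_enc_eq fun a => ?_
    congr 1
    induction f a with
    | nil => rfl
    | cons b l ih => rw [List.foldr_cons, ← ih, List.flatMap_cons]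
  · obtain ⟨p, hp⟩ := hh.size_le
    refine ⟨p.comp (X + 1), fun a b s => ?_⟩
    have := hp (a, b)
    dsimp only at this
    rw [esize_pair] at this
    have := esize_append (h a b) s
    simp only [eval_add, eval_comp, eval_X, eval_one]
    omega

@[fun_prop]
theorem all [Inhabited β] {f : α → List β} {P : α → β → Bool} (hf : PTime f)
    (hP : PTime fun p : α × β => P p.1 p.2) : PTime fun a => (f a).all (P a) := by
  have h1 : PTime fun p : α × Bool × β => P p.1 p.2.2 :=
    hP.comp (g := fun p : α × Bool × β => (p.1, p.2.2)) (by fun_prop)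
  have := foldr_of_add (h := fun a b (s : Bool) => P a b && s) hf (const true) (by fun_prop)
    ⟨C 3, fun a b s => (esize_bool _).trans (by simp)⟩
  refine this.of_enc_eq fun a => ?_
  congr 1
  induction f a with
  | nil => rfl
  | cons b l ih => rw [List.foldr_cons, ← ih, List.all_cons]

@[fun_prop]
theorem any [Inhabited β] {f : α → List β} {P : α → β → Bool} (hf : PTime f)
    (hP : PTime fun p : α × β => P p.1 p.2) : PTime fun a => (f a).any (P a) :=
  (not (all (P := fun a b => !P a b) hf (not hP))).of_enc_eq fun a => by
    simp [List.all_eq_not_any_not]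

@[fun_prop]
theorem drop {f : α → ℕ} {g : α → List β} (hf : PTime f) (hg : PTime g) :
    PTime fun a => (g a).drop (f a) := by
  have := foldl_of_add (h := fun (_ : α) (s : List β) () => s.tail) (replicate_unit hf) hg
    (by fun_prop) ⟨0, fun a s b => by cases s <;> simp [esize_cons]; omega⟩
  refine this.of_enc_eq fun a => ?_
  congr 1
  generalize g a = l
  induction f a generalizing l with
  | zero => rfl
  | succ n ih => rw [List.replicate_succ, List.foldl_cons, ← ih, List.drop_tail, Nat.add_comm]

@[fun_prop]
theorem getD {f : α → List β} {g : α → ℕ} {h : α → β} (hf : PTime f) (hg : PTime g)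
    (hh : PTime h) : PTime fun a => (f a).getD (g a) (h a) := by
  have : PTime fun a => ((f a).drop (g a)).headD (h a) := by fun_prop
  exact this.of_enc_eq fun a => by simp [List.getD_eq_getElem?_getD]

@[fun_prop]
theorem length [Inhabited β] {f : α → List β} (hf : PTime f) : PTime fun a => (f a).length := by
  have : PTime fun a => (f a).map fun _ => () := by fun_prop
  exact this.of_enc_eq fun a => by rw [List.map_const']; rfl

@[fun_prop]
theorem data_len {f : α → Data} (hf : PTime f) : PTime fun a => (f a).len :=
  have : Inhabited Data := ⟨.nil⟩
  length (data_toList hf)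

@[fun_prop]
theorem nat_add {f g : α → ℕ} (hf : PTime f) (hg : PTime g) : PTime fun a => f a + g a :=
  (append (replicate_unit hf) (replicate_unit hg)).of_enc_eq fun a => by
    rw [List.replicate_append_replicate]; rfl

@[fun_prop]
theorem nat_mul {f g : α → ℕ} (hf : PTime f) (hg : PTime g) : PTime fun a => f a * g a := by
  have h1 := replicate_unit hf
  have h2 := replicate_unit hg
  have := flatMap (h := fun a _ => List.replicate (g a) ()) h1 (h2.comp (fst id))
  refine (length this).of_enc_eq fun a => ?_
  simp

@[fun_prop]
theorem nat_sub {f g : α → ℕ} (hf : PTime f) (hg : PTime g) : PTime fun a => f a - g a :=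
  (length (drop hg (replicate_unit hf))).of_enc_eq fun a => by simp

@[fun_prop]
theorem nat_le {f g : α → ℕ} (hf : PTime f) (hg : PTime g) : PTime fun a => decide (f a ≤ g a) :=
  (data_isNil (toData.comp (nat_sub hf hg))).of_enc_eq fun a => by
    congr 1
    rw [decide_eq_decide, ← Nat.sub_eq_zero_iff_le]
    cases f a - g a <;> simp [enc_zero, enc_succ]

@[fun_prop]
theorem nat_lt {f g : α → ℕ} (hf : PTime f) (hg : PTime g) : PTime fun a => decide (f a < g a) :=
  nat_le (nat_add hf (const 1)) hg

@[fun_prop]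
theorem nat_eq {f g : α → ℕ} (hf : PTime f) (hg : PTime g) : PTime fun a => decide (f a = g a) :=
  (and (nat_le hf hg) (nat_le hg hf)).of_enc_eq fun a => by
    rw [← Bool.decide_and]
    simp only [le_antisymm_iff]

/-- Bounded universal quantification. -/
@[fun_prop]
theorem all_range {f : α → ℕ} {P : α → ℕ → Bool} (hf : PTime f)
    (hP : PTime fun p : α × ℕ => P p.1 p.2) : PTime fun a => (List.range (f a)).all (P a) := by
  have h1 : PTime fun p : α × (ℕ × Bool) × Unit => P p.1 p.2.1.1 :=
    hP.comp (g := fun p : α × (ℕ × Bool) × Unit => (p.1, p.2.1.1)) (by fun_prop)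
  have := foldl_of_add (h := fun a (s : ℕ × Bool) () => (s.1 + 1, s.2 && P a s.1))
    (replicate_unit hf) (const (0, true)) (by fun_prop) ⟨C 5, fun a s b => by
      obtain ⟨n, c⟩ := s
      have h1 := esize_bool (c && P a n)
      have h2 := esize_pos c
      simp only [esize_pair, esize_nat, eval_C]
      omega⟩
  refine this.snd.of_enc_eq fun a => ?_
  have key : ∀ n : ℕ, (List.replicate n ()).foldl
      (fun (s : ℕ × Bool) () => (s.1 + 1, s.2 && P a s.1)) (0, true) =
        (n, (List.range n).all (P a)) := by
    intro n
    induction n with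
    | zero => rfl
    | succ n ih => rw [List.replicate_succ', List.foldl_append, ih, List.range_succ]; simp
  rw [key]

end PTime

end Enc

/-! ### The verifier -/

namespace KSharp

/-- Successor of a number in binary, least significant bit first. -/
def incBits : List Bool → List Bool
  | [] => [true]
  | false :: l => true :: l
  | true :: l => false :: incBits l

theorem bits_succ (n : ℕ) : Nat.bits (n + 1) = incBits (Nat.bits n) := by
  induction n using Nat.binaryRecFromOne with
  | zero => simp [incBits]
  | one => decide
  | bit b n hn ih =>
    cases b with
    | false =>
      rw [show Nat.bit false n + 1 = Nat.bit true n from rfl, Nat.bits_append_bit _ _ (by simp),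
        Nat.bits_append_bit _ _ (by simp [hn])]
      rfl
    | true =>
      rw [show Nat.bit true n + 1 = Nat.bit false (n + 1) by simp [Nat.bit]; ring,
        Nat.bits_append_bit _ _ (by simp), Nat.bits_append_bit _ _ (by simp), ih]
      rfl

end KSharp

instance : Inhabited Data := ⟨.nil⟩

/-- The entry of a list at position `i`, with `nil` beyond the end. -/
def Data.nth (d : Data) (i : ℕ) : Data := d.toList.getD i .nil

/-- Truth value of a tree. -/
def Data.truth (d : Data) : Bool := !decide (d = .nil)

namespace PTime

variable {α : Type} [Enc α]

open Polynomial

@[fun_prop]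
theorem data_nth {f : α → Data} {g : α → ℕ} (hf : PTime f) (hg : PTime g) :
    PTime fun a => (f a).nth (g a) := by
  unfold Data.nth; fun_prop

@[fun_prop]
theorem data_truth {f : α → Data} (hf : PTime f) : PTime fun a => (f a).truth := by
  unfold Data.truth; fun_prop

@[fun_prop]
theorem bool_beq {f g : α → Bool} (hf : PTime f) (hg : PTime g) : PTime fun a => f a == g a :=
  (hf.cond hg hg.not).of_enc_eq fun a => by cases f a <;> cases g a <;> rfl

/-- The state of the fold consists of the carry and the digits of the result, in reverse order. -/
@[fun_prop]
theorem incBits {f : α → List Bool} (hf : PTime f) : PTime fun a => KSharp.incBits (f a) := by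
  have h := foldl_of_add (g := fun _ => (true, []))
    (h := fun (_ : α) (s : Bool × List Bool) b => (s.1 && b, (bif s.1 then !b else b) :: s.2))
    hf (const _) (by fun_prop) ⟨C 6, fun a s b => by
      obtain ⟨c, o⟩ := s
      have h1 := esize_bool (bif c then !b else b)
      have h2 := esize_bool (c && b)
      have h3 := esize_pos c
      simp only [esize_pair, esize_cons, eval_C]
      omega⟩
  have h2 := reverse (h.fst.cond (list_cons (const true) h.snd) h.snd)
  refine h2.of_enc_eq fun a => ?_
  congr 1
  have key : ∀ (l : List Bool) (c : Bool) (o : List Bool),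
      (bif (l.foldl (fun (s : Bool × List Bool) b => (s.1 && b, (bif s.1 then !b else b) :: s.2))
        (c, o)).1 then true :: (l.foldl (fun (s : Bool × List Bool) b =>
          (s.1 && b, (bif s.1 then !b else b) :: s.2)) (c, o)).2
        else (l.foldl (fun (s : Bool × List Bool) b =>
          (s.1 && b, (bif s.1 then !b else b) :: s.2)) (c, o)).2).reverse =
      o.reverse ++ bif c then KSharp.incBits l else l := by
    intro l
    induction l with
    | nil => intro c o; cases c <;> simp [KSharp.incBits]
    | cons b l ih =>
      intro c o
      rw [List.foldl_cons, ih]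
      cases c <;> cases b <;> simp [KSharp.incBits]
  exact (by simpa using (key (f a) true []).symm)

@[fun_prop]
theorem bits {f : α → ℕ} (hf : PTime f) : PTime fun a => Nat.bits (f a) := by
  have h := foldl_of_add (g := fun _ => []) (h := fun (_ : α) (s : List Bool) () =>
    KSharp.incBits s) (replicate_unit hf) (const _) (by fun_prop) ⟨C 4, fun a s b => by
      rw [eval_C]
      induction s with
      | nil => decide
      | cons b s ih =>
        cases b with
        | false =>
          simp only [KSharp.incBits, esize_cons]
          have : esize true ≤ esize false + 4 := by decide
          omega
        | true =>
          simp only [KSharp.incBits, esize_cons]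
          have : esize false ≤ esize true := by decide
          omega⟩
  refine h.of_enc_eq fun a => ?_
  congr 1
  induction f a with
  | zero => simp
  | succ n ih => rw [List.replicate_succ', List.foldl_append, ← ih, KSharp.bits_succ]; rfl

/-- Equality of lists of numbers. -/
@[fun_prop]
theorem nat_list_eq {f g : α → List ℕ} (hf : PTime f) (hg : PTime g) :
    PTime fun a => decide (f a = g a) := by
  have : PTime fun a => decide ((f a).length = (g a).length) &&
      (List.range (f a).length).all fun k => decide ((f a).getD k 0 = (g a).getD k 0) := by
    fun_prop
  refine this.of_enc_eq fun a => ?_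
  congr 1
  rw [Bool.eq_iff_iff]
  simp only [decide_eq_true_eq, Bool.and_eq_true, List.all_eq_true, List.mem_range]
  refine ⟨fun h => by simp [h], fun ⟨h1, h2⟩ => List.ext_getElem h1 fun k hk hk' => ?_⟩
  have := h2 k hk
  rwa [List.getD_eq_getElem _ _ hk, List.getD_eq_getElem _ _ hk'] at this

end PTime

namespace KSharp

/-! #### Trees as nodes of a DAG -/

/-- The position of a token in a list of the alphabet. The first nine tokens are the names of the
constructors of `Node`. -/
def Token.index : Token → ℕ
  | .atom => 0
  | .neg => 1
  | .or => 2
  | .nonneg => 3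
  | .const => 4
  | .ind => 5
  | .count => 6
  | .add => 7
  | .smul => 8
  | .minus => 9
  | .comma => 10
  | .bit0 => 11
  | .bit1 => 12

theorem Token.index_injective : Function.Injective Token.index := by
  intro s t; cases s <;> cases t <;> simp [Token.index]

/-! A node is represented by a list of five trees: the index of the constructor, two arguments in
unary (children, or an atomic proposition), and sign and absolute value of an integer. -/

def nodeTag (d : Data) : ℕ := (d.nth 0).len
def nodeArg₁ (d : Data) : ℕ := (d.nth 1).len
def nodeArg₂ (d : Data) : ℕ := (d.nth 2).len
def nodeSign (d : Data) : Bool := (d.nth 3).truth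
def nodeAbs (d : Data) : ℕ := (d.nth 4).len
def nodeInt (d : Data) : ℤ := bif nodeSign d then -(nodeAbs d : ℤ) else nodeAbs d

/-- The node represented by a tree; every tree represents some node. -/
def toNode (d : Data) : Node :=
  bif decide (nodeTag d = 0) then .atom (nodeArg₁ d)
  else bif decide (nodeTag d = 1) then .neg (nodeArg₁ d)
  else bif decide (nodeTag d = 2) then .or (nodeArg₁ d) (nodeArg₂ d)
  else bif decide (nodeTag d = 3) then .nonneg (nodeArg₁ d)
  else bif decide (nodeTag d = 4) then .const (nodeInt d)
  else bif decide (nodeTag d = 5) then .ind (nodeArg₁ d)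
  else bif decide (nodeTag d = 6) then .count (nodeArg₁ d)
  else bif decide (nodeTag d = 7) then .add (nodeArg₁ d) (nodeArg₂ d)
  else .smul (nodeInt d) (nodeArg₁ d)

/-- Indices of the tokens of a binary number. -/
def natCode (n : ℕ) : List ℕ := (Nat.bits n).map fun b => bif b then 12 else 11

/-- Indices of the tokens of the integer with sign `s` (negative if `true`) and absolute value `n`;
there is no sign at `0`. -/
def intCode (s : Bool) (n : ℕ) : List ℕ :=
  (bif s && !decide (n = 0) then [9] else []) ++ natCode n

/-- Indices of the tokens that a node is written with. -/
def nodeCode (d : Data) : List ℕ :=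
  bif decide (nodeTag d = 0) then 0 :: natCode (nodeArg₁ d)
  else bif decide (nodeTag d = 1) then 1 :: natCode (nodeArg₁ d)
  else bif decide (nodeTag d = 2) then 2 :: (natCode (nodeArg₁ d) ++ 10 :: natCode (nodeArg₂ d))
  else bif decide (nodeTag d = 3) then 3 :: natCode (nodeArg₁ d)
  else bif decide (nodeTag d = 4) then 4 :: intCode (nodeSign d) (nodeAbs d)
  else bif decide (nodeTag d = 5) then 5 :: natCode (nodeArg₁ d)
  else bif decide (nodeTag d = 6) then 6 :: natCode (nodeArg₁ d)
  else bif decide (nodeTag d = 7) then 7 :: (natCode (nodeArg₁ d) ++ 10 :: natCode (nodeArg₂ d))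
  else 8 :: (intCode (nodeSign d) (nodeAbs d) ++ 10 :: natCode (nodeArg₁ d))

theorem map_encodeNat (n : ℕ) : (encodeNat n).map Token.index = natCode n := by
  simp only [encodeNat, natCode, List.map_map]
  congr 1
  funext b
  cases b <;> rfl

theorem map_encodeInt (d : Data) :
    (encodeInt (nodeInt d)).map Token.index = intCode (nodeSign d) (nodeAbs d) := by
  rw [encodeInt, intCode, nodeInt, List.map_append, map_encodeNat]
  cases nodeSign d
  · simp
  · by_cases h : nodeAbs d = 0
    · simp [h]
    · simp [h, Nat.pos_of_ne_zero h, Token.index]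

theorem map_encode_node (d : Data) : (toNode d).encode.map Token.index = nodeCode d := by
  unfold toNode nodeCode
  simp only [Bool.cond_decide]
  split_ifs <;>
    simp only [Node.encode, List.map_cons, List.map_append, map_encodeNat, map_encodeInt] <;> rfl

theorem map_encode (l : List Data) :
    (encode (l.map toNode)).map Token.index = l.flatMap nodeCode := by
  rw [encode, List.flatMap_map, List.map_flatMap]
  simp only [map_encode_node]

/-! #### Local conditions -/

/-- The formula constructors. -/
def Node.isForm : Node → Bool
  | .atom _ | .neg _ | .or _ _ | .nonneg _ => true
  | _ => false

/-- The node at position `k` refers to earlier nodes of the right sort, when `s i` tells whether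
there is a formula at position `i`. -/
def Node.RefsOK (s : ℕ → Bool) (k : ℕ) : Node → Prop
  | .atom _ => True
  | .neg i => i < k ∧ s i = true
  | .or i j => (i < k ∧ s i = true) ∧ (j < k ∧ s j = true)
  | .nonneg i => i < k ∧ s i = false
  | .const _ => True
  | .ind i => i < k ∧ s i = true
  | .count i => i < k ∧ s i = true
  | .add i j => (i < k ∧ s i = false) ∧ (j < k ∧ s j = false)
  | .smul _ i => i < k ∧ s i = false

/-- The values at a vertex are correct at the node at position `k`, relative to those at earlier
nodes. The formula at position `i` has the truth value `T i`, and the expression at position `i`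
has the value `P i - N i`. The labeling is `lab`, and `cnt i` is the number of successors at which
the formula at position `i` is true. -/
def Node.ValuesOK (T : ℕ → Bool) (P N : ℕ → ℕ) (lab : ℕ → Bool) (cnt : ℕ → ℕ) (k : ℕ) :
    Node → Prop
  | .atom p => T k = lab p
  | .neg i => T k = !T i
  | .or i j => T k = (T i || T j)
  | .nonneg i => T k = decide (N i ≤ P i)
  | .const c => P k = c.toNat ∧ N k = (-c).toNat
  | .ind i => P k = (bif T i then 1 else 0) ∧ N k = 0
  | .count i => P k = cnt i ∧ N k = 0
  | .add i j => P k = P i + P j ∧ N k = N i + N j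
  | .smul c i => P k = c.toNat * P i + (-c).toNat * N i ∧ N k = c.toNat * N i + (-c).toNat * P i

def nodeIsForm (d : Data) : Bool := decide (nodeTag d ≤ 3)

/-- Boolean version of `Node.RefsOK`, with the list `D` of nodes. -/
def checkRefs (D : Data) (k : ℕ) : Bool :=
  let d := D.nth k
  let i := nodeArg₁ d
  let j := nodeArg₂ d
  let fi := decide (i < k) && nodeIsForm (D.nth i)
  let fj := decide (j < k) && nodeIsForm (D.nth j)
  let ei := decide (i < k) && !nodeIsForm (D.nth i)
  let ej := decide (j < k) && !nodeIsForm (D.nth j)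
  bif decide (nodeTag d = 0) then true
  else bif decide (nodeTag d = 1) then fi
  else bif decide (nodeTag d = 2) then fi && fj
  else bif decide (nodeTag d = 3) then ei
  else bif decide (nodeTag d = 4) then true
  else bif decide (nodeTag d = 5) then fi
  else bif decide (nodeTag d = 6) then fi
  else bif decide (nodeTag d = 7) then ei && ej
  else ei

/-! An entry of a certificate is a vertex type: the values at the nodes, the labeling, and the list
of the successors, given by the positions of their entries. -/

def entryTruth (e : Data) (k : ℕ) : Bool := (e.hd.nth k).hd.truth
def entryPos (e : Data) (k : ℕ) : ℕ := (e.hd.nth k).tl.hd.len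
def entryNeg (e : Data) (k : ℕ) : ℕ := (e.hd.nth k).tl.tl.len
def entryLabel (e : Data) (p : ℕ) : Bool := (e.tl.hd.nth p).truth

/-- The number of successors at which the formula at position `i` is true. -/
def entryCount (E e : Data) (i : ℕ) : ℕ :=
  (e.tl.tl.toList.filter fun c => entryTruth (E.nth c.len) i).length

/-- Boolean version of `Node.ValuesOK`, with the list `D` of nodes and the list `E` of entries. -/
def checkValues (D E e : Data) (k : ℕ) : Bool :=
  let d := D.nth k
  let i := nodeArg₁ d
  let j := nodeArg₂ d
  let pn (p n : ℕ) := decide (entryPos e k = p) && decide (entryNeg e k = n)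
  bif decide (nodeTag d = 0) then entryTruth e k == entryLabel e i
  else bif decide (nodeTag d = 1) then entryTruth e k == !entryTruth e i
  else bif decide (nodeTag d = 2) then entryTruth e k == (entryTruth e i || entryTruth e j)
  else bif decide (nodeTag d = 3) then entryTruth e k == decide (entryNeg e i ≤ entryPos e i)
  else bif decide (nodeTag d = 4) then
    bif nodeSign d then pn 0 (nodeAbs d) else pn (nodeAbs d) 0
  else bif decide (nodeTag d = 5) then pn (bif entryTruth e i then 1 else 0) 0
  else bif decide (nodeTag d = 6) then pn (entryCount E e i) 0
  else bif decide (nodeTag d = 7) then pn (entryPos e i + entryPos e j) (entryNeg e i + entryNeg e j)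
  else bif nodeSign d then pn (nodeAbs d * entryNeg e i) (nodeAbs d * entryPos e i)
    else pn (nodeAbs d * entryPos e i) (nodeAbs d * entryNeg e i)

theorem isForm_toNode (d : Data) : (toNode d).isForm = nodeIsForm d := by
  unfold toNode nodeIsForm
  simp only [Bool.cond_decide]
  split_ifs <;> simp [Node.isForm] <;> omega

theorem checkRefs_iff (D : Data) (k : ℕ) : checkRefs D k = true ↔
    (toNode (D.nth k)).RefsOK (fun i => (toNode (D.nth i)).isForm) k := by
  unfold checkRefs
  simp only [isForm_toNode]
  generalize D.nth k = d
  unfold toNode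
  simp only [Bool.cond_decide]
  split_ifs <;> simp [Node.RefsOK]

theorem checkValues_iff (D E e : Data) (k : ℕ) : checkValues D E e k = true ↔
    (toNode (D.nth k)).ValuesOK (entryTruth e) (entryPos e) (entryNeg e) (entryLabel e)
      (entryCount E e) k := by
  unfold checkValues
  generalize D.nth k = d
  unfold toNode nodeInt
  simp only [Bool.cond_decide]
  split_ifs <;> cases nodeSign d <;> simp [Node.ValuesOK]

/-- The verifier: `w` consists of the indices of the tokens of the input, and the certificate `C`
of a list of nodes and a list of entries. -/
def checkCert (w : List ℕ) (C : Data) : Bool :=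
  decide (w = C.hd.toList.flatMap nodeCode) &&
  ((List.range C.hd.len).all fun k => checkRefs C.hd k) &&
  nodeIsForm (C.hd.nth (C.hd.len - 1)) && decide (0 < C.hd.len) &&
  (C.tl.toList.any fun e => entryTruth e (C.hd.len - 1)) &&
  C.tl.toList.all fun e =>
    (e.tl.tl.toList.all fun c => decide (c.len < C.tl.len)) &&
    (List.range C.hd.len).all fun k => checkValues C.hd C.tl e k

end KSharp

namespace PTime

open KSharp

variable {α : Type} [Enc α]

@[fun_prop]
theorem nodeTag : PTime KSharp.nodeTag := by unfold KSharp.nodeTag; fun_prop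
@[fun_prop]
theorem nodeArg₁ : PTime KSharp.nodeArg₁ := by unfold KSharp.nodeArg₁; fun_prop
@[fun_prop]
theorem nodeArg₂ : PTime KSharp.nodeArg₂ := by unfold KSharp.nodeArg₂; fun_prop
@[fun_prop]
theorem nodeSign : PTime KSharp.nodeSign := by unfold KSharp.nodeSign; fun_prop
@[fun_prop]
theorem nodeAbs : PTime KSharp.nodeAbs := by unfold KSharp.nodeAbs; fun_prop
@[fun_prop]
theorem nodeIsForm : PTime KSharp.nodeIsForm := by unfold KSharp.nodeIsForm; fun_prop
@[fun_prop]
theorem natCode : PTime KSharp.natCode := by unfold KSharp.natCode; fun_prop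

@[fun_prop]
theorem intCode {f : α → Bool} {g : α → ℕ} (hf : PTime f) (hg : PTime g) :
    PTime fun a => KSharp.intCode (f a) (g a) := by unfold KSharp.intCode; fun_prop

@[fun_prop]
theorem nodeCode : PTime KSharp.nodeCode := by unfold KSharp.nodeCode; fun_prop

@[fun_prop]
theorem checkRefs {f : α → Data} {g : α → ℕ} (hf : PTime f) (hg : PTime g) :
    PTime fun a => KSharp.checkRefs (f a) (g a) := by unfold KSharp.checkRefs; fun_prop

@[fun_prop]
theorem entryTruth {f : α → Data} {g : α → ℕ} (hf : PTime f) (hg : PTime g) :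
    PTime fun a => KSharp.entryTruth (f a) (g a) := by unfold KSharp.entryTruth; fun_prop
@[fun_prop]
theorem entryPos {f : α → Data} {g : α → ℕ} (hf : PTime f) (hg : PTime g) :
    PTime fun a => KSharp.entryPos (f a) (g a) := by unfold KSharp.entryPos; fun_prop
@[fun_prop]
theorem entryNeg {f : α → Data} {g : α → ℕ} (hf : PTime f) (hg : PTime g) :
    PTime fun a => KSharp.entryNeg (f a) (g a) := by unfold KSharp.entryNeg; fun_prop
@[fun_prop]
theorem entryLabel {f : α → Data} {g : α → ℕ} (hf : PTime f) (hg : PTime g) :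
    PTime fun a => KSharp.entryLabel (f a) (g a) := by unfold KSharp.entryLabel; fun_prop

@[fun_prop]
theorem entryCount {f g : α → Data} {h : α → ℕ} (hf : PTime f) (hg : PTime g) (hh : PTime h) :
    PTime fun a => KSharp.entryCount (f a) (g a) (h a) := by unfold KSharp.entryCount; fun_prop

@[fun_prop]
theorem checkValues {f g h : α → Data} {i : α → ℕ} (hf : PTime f) (hg : PTime g) (hh : PTime h)
    (hi : PTime i) : PTime fun a => KSharp.checkValues (f a) (g a) (h a) (i a) := by
  unfold KSharp.checkValues
  dsimp only
  fun_prop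

theorem checkCert : PTime fun p : List ℕ × Data => KSharp.checkCert p.1 p.2 := by
  unfold KSharp.checkCert; fun_prop

end PTime

/-! ### Correctness of the certificates: from entries to a model -/

namespace KSharp

theorem denoteFrom_append (l l' : List Node) : ∀ env, denoteFrom env (l ++ l') =
    (denoteFrom env l).bind fun env' => denoteFrom env' l' := by
  induction l with
  | nil => intro env; rfl
  | cons nd l ih =>
    intro env
    simp only [List.cons_append, denoteFrom, ih, Option.bind_assoc]

theorem denoteFrom_snoc (l : List Node) (nd : Node) : denoteFrom [] (l ++ [nd]) =
    (denoteFrom [] l).bind fun env => (nd.denote env).map fun x => env ++ [x] := by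
  rw [denoteFrom_append]
  congr 1
  funext env
  simp only [denoteFrom]
  cases nd.denote env <;> rfl

theorem formAt_eq_some {env : List (Form ⊕ Expr)} {i : ℕ} {φ : Form} :
    formAt env i = some φ ↔ env[i]? = some (.inl φ) := by
  rw [formAt]
  cases h : env[i]? with
  | none => simp
  | some x => cases x <;> simp

theorem exprAt_eq_some {env : List (Form ⊕ Expr)} {i : ℕ} {E : Expr} :
    exprAt env i = some E ↔ env[i]? = some (.inr E) := by
  rw [exprAt]
  cases h : env[i]? with
  | none => simp
  | some x => cases x <;> simp

theorem card_filter_getElem {ι : Type} (l : List ι) (p : ι → Bool) :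
    (Finset.univ.filter fun b : Fin l.length => p l[b] = true).card = l.countP p := by
  induction l with
  | nil => rfl
  | cons a l ih =>
    rw [List.countP_cons, ← ih, Finset.card_filter, Finset.card_filter]
    refine (Fin.sum_univ_succ (n := l.length) _).trans ?_
    rw [Nat.add_comm]
    rfl

section Model

variable {ι : Type} (T : ι → ℕ → Bool) (P N : ι → ℕ → ℕ) (lab : ι → ℕ → Bool) (cs : ι → List ι)
  (B : ℕ)

/-- The graph with `B` copies of each vertex type. A vertex of type `e` has as its `b`-th successor
the `b`-th copy of the `b`-th type in the list `cs e`, so that repetitions in the list are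
counted. -/
def copies : Graph (ι × Fin B) where
  edge u v := (cs u.1)[v.2.1]? = some v.1
  label u p := lab u.1 p = true

variable {T P N lab cs B}

theorem ncard_copies (hB : ∀ e, (cs e).length ≤ B) (u : ι × Fin B) (p : ι → Bool) :
    {v : ι × Fin B | (copies lab cs B).edge u v ∧ p v.1 = true}.ncard = (cs u.1).countP p := by
  rw [← card_filter_getElem, ← Set.ncard_coe_finset]
  symm
  refine Set.ncard_congr (fun b _ => ((cs u.1)[b], ⟨b, b.2.trans_le (hB _)⟩)) ?_ ?_ ?_
  · intro b hb
    simpa [copies] using hb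
  · intro a b _ _ h
    simp only [Prod.mk.injEq, Fin.mk.injEq] at h
    exact Fin.ext h.2
  · rintro ⟨e, b⟩ ⟨h1, h2⟩
    obtain ⟨hb, he⟩ := List.getElem?_eq_some_iff.1 h1
    exact ⟨⟨b, hb⟩, by simpa [he] using h2, by simp [he]⟩

/-- What is required of the formula or expression at position `k`. -/
def Meaning {V : Type} (G : Graph V) (T : V → ℕ → Bool) (P N : V → ℕ → ℕ) (s : ℕ → Bool) (k : ℕ) :
    Form ⊕ Expr → Prop
  | .inl φ => s k = true ∧ ∀ v, φ.Holds G v ↔ T v k = true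
  | .inr E => s k = false ∧ ∀ v, E.value G v = (P v k : ℤ) - N v k

theorem natCast_toNat_sub (c : ℤ) : ((c.toNat : ℤ) - ((-c).toNat : ℤ)) = c := by omega

/-- If all values satisfy the local conditions, then they are correct in the graph `copies`. -/
theorem exists_env_of_valuesOK (hB : ∀ e, (cs e).length ≤ B) (s : ℕ → Bool) (l : List Node)
    (hs : ∀ k (nd : Node), l[k]? = some nd → s k = nd.isForm)
    (hr : ∀ k (nd : Node), l[k]? = some nd → nd.RefsOK s k)
    (hv : ∀ e k (nd : Node), l[k]? = some nd → nd.ValuesOK (T e) (P e) (N e) (lab e)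
      (fun i => (cs e).countP fun c => T c i) k) :
    ∃ env, denoteFrom [] l = some env ∧ env.length = l.length ∧ ∀ k x, env[k]? = some x →
      Meaning (copies lab cs B) (fun v => T v.1) (fun v => P v.1) (fun v => N v.1) s k x := by
  induction l using List.reverseRecOn with
  | nil => exact ⟨[], rfl, rfl, by simp⟩
  | append_singleton l nd ih =>
    have hl : ∀ {k nd'}, l[k]? = some nd' → (l ++ [nd])[k]? = some nd' := fun h => by
      rw [List.getElem?_append_left (List.getElem?_eq_some_iff.1 h).1, h]
    have hnd : (l ++ [nd])[l.length]? = some nd := by simp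
    obtain ⟨env, h1, h2, h3⟩ := ih (fun k nd' h => hs k nd' (hl h)) (fun k nd' h => hr k nd' (hl h))
      (fun e k nd' h => hv e k nd' (hl h))
    have hform : ∀ i, i < l.length ∧ s i = true → ∃ φ, formAt env i = some φ ∧
        ∀ v, φ.Holds (copies lab cs B) v ↔ T v.1 i = true := by
      rintro i ⟨hi, hsi⟩
      have hi' : env[i]? = some env[i] := List.getElem?_eq_getElem (h2 ▸ hi)
      have h4 := h3 i _ hi'
      cases hx : env[i] with
      | inl φ => rw [hx] at h4 hi'; exact ⟨φ, formAt_eq_some.2 hi', h4.2⟩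
      | inr E => rw [hx] at h4; exact absurd (hsi.symm.trans h4.1) (by simp)
    have hexpr : ∀ i, i < l.length ∧ s i = false → ∃ E, exprAt env i = some E ∧
        ∀ v, E.value (copies lab cs B) v = (P v.1 i : ℤ) - N v.1 i := by
      rintro i ⟨hi, hsi⟩
      have hi' : env[i]? = some env[i] := List.getElem?_eq_getElem (h2 ▸ hi)
      have h4 := h3 i _ hi'
      cases hx : env[i] with
      | inl φ => rw [hx] at h4; exact absurd (hsi.symm.trans h4.1) (by simp)
      | inr E => rw [hx] at h4 hi'; exact ⟨E, exprAt_eq_some.2 hi', h4.2⟩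
    have hr' := hr _ _ hnd
    have hs' := hs _ _ hnd
    have hv' := fun e => hv e _ _ hnd
    suffices ∃ x, nd.denote env = some x ∧ Meaning (copies lab cs B) (fun v => T v.1)
        (fun v => P v.1) (fun v => N v.1) s l.length x by
      obtain ⟨x, hx, hm⟩ := this
      refine ⟨env ++ [x], by simp [denoteFrom_snoc, h1, hx], by simp [h2], fun k y hk => ?_⟩
      by_cases hk' : k < env.length
      · rw [List.getElem?_append_left hk'] at hk
        exact h3 k y hk
      · have hk2 := (List.getElem?_eq_some_iff.1 hk).1
        rw [List.length_append, List.length_singleton] at hk2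
        obtain rfl : k = env.length := by omega
        simp only [List.getElem?_concat_length, Option.some.injEq] at hk
        rw [← hk, h2]
        exact hm
    suffices (∃ φ, nd.denote env = some (.inl φ) ∧ s l.length = true ∧
        ∀ v, φ.Holds (copies lab cs B) v ↔ T v.1 l.length = true) ∨
        ∃ E, nd.denote env = some (.inr E) ∧ s l.length = false ∧
          ∀ v, E.value (copies lab cs B) v = (P v.1 l.length : ℤ) - N v.1 l.length by
      rcases this with ⟨φ, h, h'⟩ | ⟨E, h, h'⟩
      exacts [⟨_, h, h'⟩, ⟨_, h, h'⟩]
    cases nd with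
    | atom p =>
      exact .inl ⟨_, rfl, hs', fun v => by rw [hv' v.1]; simp [Form.Holds, copies]⟩
    | neg i =>
      obtain ⟨φ, hφ, hφ'⟩ := hform i hr'
      exact .inl ⟨_, by rw [Node.denote, hφ]; rfl, hs', fun v => by
        rw [hv' v.1]; simp [Form.Holds, hφ']⟩
    | or i j =>
      obtain ⟨φ, hφ, hφ'⟩ := hform i hr'.1
      obtain ⟨ψ, hψ, hψ'⟩ := hform j hr'.2
      exact .inl ⟨_, by rw [Node.denote, hφ, hψ]; rfl, hs', fun v => by
        rw [hv' v.1]; simp [Form.Holds, hφ', hψ']⟩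
    | nonneg i =>
      obtain ⟨E, hE, hE'⟩ := hexpr i hr'
      exact .inl ⟨_, by rw [Node.denote, hE]; rfl, hs', fun v => by
        rw [hv' v.1]; simp [Form.Holds, hE']⟩
    | const c =>
      exact .inr ⟨_, rfl, hs', fun v => by
        rw [(hv' v.1).1, (hv' v.1).2, Expr.value, natCast_toNat_sub]⟩
    | ind i =>
      obtain ⟨φ, hφ, hφ'⟩ := hform i hr'
      exact .inr ⟨_, by rw [Node.denote, hφ]; rfl, hs', fun v => by
        rw [(hv' v.1).1, (hv' v.1).2, Expr.value]
        cases h : T v.1 i <;> simp [hφ', h]⟩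
    | count i =>
      obtain ⟨φ, hφ, hφ'⟩ := hform i hr'
      exact .inr ⟨_, by rw [Node.denote, hφ]; rfl, hs', fun v => by
        rw [(hv' v.1).1, (hv' v.1).2, Expr.value]
        simp only [hφ', ncard_copies hB v fun c => T c i]
        simp⟩
    | add i j =>
      obtain ⟨E, hE, hE'⟩ := hexpr i hr'.1
      obtain ⟨F, hF, hF'⟩ := hexpr j hr'.2
      exact .inr ⟨_, by rw [Node.denote, hE, hF]; rfl, hs', fun v => by
        rw [(hv' v.1).1, (hv' v.1).2, Expr.value, hE', hF']
        push_cast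
        ring⟩
    | smul c i =>
      obtain ⟨E, hE, hE'⟩ := hexpr i hr'
      exact .inr ⟨_, by rw [Node.denote, hE]; rfl, hs', fun v => by
        rw [(hv' v.1).1, (hv' v.1).2, Expr.value, hE']
        conv_lhs => rw [← natCast_toNat_sub c]
        push_cast
        ring⟩

/-- Correct values give a model of the formula represented by the nodes. -/
theorem satisfiable_of_valuesOK [Finite ι] (l : List Node) {nd : Node} (hl : l.getLast? = some nd)
    (hnd : nd.isForm = true) (s : ℕ → Bool) (hs : ∀ k (nd : Node), l[k]? = some nd → s k = nd.isForm)
    (hr : ∀ k (nd : Node), l[k]? = some nd → nd.RefsOK s k)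
    (hv : ∀ e k (nd : Node), l[k]? = some nd → nd.ValuesOK (T e) (P e) (N e) (lab e)
      (fun i => (cs e).countP fun c => T c i) k) (e : ι) (he : T e (l.length - 1) = true) :
    ∃ φ, Represents l φ ∧ φ.Satisfiable := by
  obtain ⟨B, hB⟩ := (Set.finite_range fun e => (cs e).length).bddAbove
  have hB' : ∀ e, (cs e).length ≤ B + 1 := fun e => (hB ⟨e, rfl⟩).trans B.le_succ
  obtain ⟨env, h1, h2, h3⟩ := exists_env_of_valuesOK hB' s l hs hr hv
  have hl' : l[l.length - 1]? = some nd := by rw [← List.getLast?_eq_getElem?, hl]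
  have hlt := (List.getElem?_eq_some_iff.1 hl').1
  have hx : env[l.length - 1]? = some env[l.length - 1] := List.getElem?_eq_getElem (h2 ▸ hlt)
  have h4 := h3 _ _ hx
  cases hy : env[l.length - 1] with
  | inl φ =>
    rw [hy] at h4 hx
    refine ⟨φ, ⟨env, h1, by rw [List.getLast?_eq_getElem?, h2, hx]⟩, _, inferInstance, _, (e, 0),
      (h4.2 (e, 0)).2 he⟩
  | inr E =>
    rw [hy] at h4
    exact absurd (h4.1.symm.trans ((hs _ _ hl').trans hnd)) (by simp)

end Model

/-- Certificates that are accepted witness satisfiability. -/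
theorem mem_SAT_of_checkCert {w : List Token} {C : Data}
    (h : checkCert (w.map Token.index) C = true) : w ∈ SAT := by
  simp only [checkCert, Bool.and_eq_true, decide_eq_true_eq, List.all_eq_true, List.any_eq_true,
    List.mem_range, checkRefs_iff, checkValues_iff] at h
  obtain ⟨⟨⟨⟨⟨hw, hr⟩, hf⟩, hpos⟩, e, he, hroot⟩, hE⟩ := h
  set nds := C.hd.toList.map toNode with hnds
  have hlen : nds.length = C.hd.len := by simp [hnds, Data.len]
  have hget : ∀ k nd, nds[k]? = some nd → k < C.hd.len ∧ nd = toNode (C.hd.nth k) := by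
    intro k nd hk
    obtain ⟨hk1, hk2⟩ := List.getElem?_eq_some_iff.1 hk
    refine ⟨hlen ▸ hk1, ?_⟩
    have hk3 : k < C.hd.toList.length := by simpa [hnds] using hk1
    rw [← hk2, Data.nth, List.getD_eq_getElem _ _ hk3]
    simp [hnds]
  have hwE : encode nds = w := by
    rw [← map_encode] at hw
    exact (List.map_injective_iff.2 Token.index_injective hw).symm
  let ι := Fin C.tl.len
  let ent : ι → Data := fun i => C.tl.nth i
  have hent : ∀ i, ent i ∈ C.tl.toList := fun i => by
    have : (i : ℕ) < C.tl.toList.length := i.2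
    simp only [ent, Data.nth, List.getD_eq_getElem _ _ this]
    exact List.getElem_mem _
  let cs : ι → List ι := fun i => (ent i).tl.tl.toList.attach.map fun c =>
    ⟨c.1.len, (hE _ (hent i)).1 c.1 c.2⟩
  obtain ⟨i₀, hi₀, hi₀'⟩ := List.getElem_of_mem he
  have hroot' : entryTruth (ent ⟨i₀, hi₀⟩) (nds.length - 1) = true := by
    have : ent ⟨i₀, hi₀⟩ = e := by
      simp only [ent, Data.nth, List.getD_eq_getElem _ _ hi₀, hi₀']
    rw [this, hlen]
    exact hroot
  have hlast : nds.getLast? = some (toNode (C.hd.nth (C.hd.len - 1))) := by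
    have h1 : C.hd.len - 1 < nds.length := by omega
    rw [List.getLast?_eq_getElem?, hlen, List.getElem?_eq_getElem h1]
    exact congrArg _ (hget _ _ (List.getElem?_eq_getElem h1)).2
  obtain ⟨φ, hφ, hsat⟩ := satisfiable_of_valuesOK (T := fun i : ι => entryTruth (ent i))
    (P := fun i => entryPos (ent i)) (N := fun i => entryNeg (ent i))
    (lab := fun i => entryLabel (ent i)) (cs := cs) nds hlast (by rw [isForm_toNode]; exact hf)
    (fun i => (toNode (C.hd.nth i)).isForm) (fun k nd hk => by rw [(hget k nd hk).2])
    (fun k nd hk => by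
      rw [(hget k nd hk).2]
      exact hr k (hget k nd hk).1)
    (fun i k nd hk => by
      rw [(hget k nd hk).2]
      have := (hE _ (hent i)).2 k (hget k nd hk).1
      have hcount : (fun j => (cs i).countP fun c => entryTruth (ent c) j) =
          entryCount C.tl (ent i) := by
        funext j
        rw [entryCount, ← List.countP_eq_length_filter, List.countP_map]
        simp only [Function.comp_def, ent]
        exact List.countP_attach (p := fun c : Data => entryTruth (C.tl.nth c.len) j)
      rw [hcount]
      exact this)
    ⟨i₀, hi₀⟩ hroot'
  exact ⟨nds, φ, hwE, hφ, hsat⟩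

end KSharp

/-! ### Rearrangements with small partial sums, and small subsums -/

section Steinitz

variable {κ : Type} [Fintype κ]

/-- A vertex of the polytope of all `μ ∈ [0, 1]^ι` with `∑ μ i = |ι| - |κ| - 1` and
`∑ μ i • v i = 0` has a vanishing coordinate: at most `|κ| + 1` coordinates of a vertex are
fractional, and if no coordinate vanished, the sum of the coordinates would be too large. -/
theorem exists_weights_with_zero {ι : Type} [Fintype ι] [DecidableEq ι] (v : ι → κ → ℝ)
    (hcard : Fintype.card κ < Fintype.card ι) (w : ι → ℝ) (hw : ∀ i, 0 ≤ w i ∧ w i ≤ 1)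
    (hsum : ∑ i, w i = Fintype.card ι - Fintype.card κ) (hv : ∀ k, ∑ i, w i * v i k = 0) :
    ∃ μ : ι → ℝ, (∀ i, 0 ≤ μ i ∧ μ i ≤ 1) ∧ ∑ i, μ i = Fintype.card ι - Fintype.card κ - 1 ∧
      (∀ k, ∑ i, μ i * v i k = 0) ∧ ∃ a, μ a = 0 := by
  set n : ℝ := (Fintype.card ι : ℝ) with hn
  set m : ℝ := (Fintype.card κ : ℝ) with hm
  have hmn : m + 1 ≤ n := by rw [hn, hm]; exact_mod_cast hcard
  let K : Set (ι → ℝ) := {μ | (∀ i, 0 ≤ μ i ∧ μ i ≤ 1) ∧ ∑ i, μ i = n - m - 1 ∧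
    ∀ k, ∑ i, μ i * v i k = 0}
  have hK : IsCompact K := by
    have hsub : K ⊆ Set.Icc 0 1 := fun μ hμ => ⟨fun i => (hμ.1 i).1, fun i => (hμ.1 i).2⟩
    refine isCompact_Icc.of_isClosed_subset ?_ hsub
    have h1 : IsClosed {μ : ι → ℝ | ∀ i, 0 ≤ μ i ∧ μ i ≤ 1} := by
      simp only [Set.ofPred_forall]
      exact isClosed_iInter fun i => (isClosed_le continuous_const (continuous_apply i)).inter
        (isClosed_le (continuous_apply i) continuous_const)
    have h2 : IsClosed {μ : ι → ℝ | ∑ i, μ i = n - m - 1} :=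
      isClosed_eq (by fun_prop) continuous_const
    have h3 : IsClosed {μ : ι → ℝ | ∀ k, ∑ i, μ i * v i k = 0} := by
      simp only [Set.ofPred_forall]
      exact isClosed_iInter fun k => isClosed_eq (by fun_prop) continuous_const
    exact h1.inter (h2.inter h3)
  have hne : K.Nonempty := by
    have h0 : 0 < n - m := by linarith
    have h1 : 0 ≤ (n - m - 1) / (n - m) := div_nonneg (by linarith) h0.le
    have h2 : (n - m - 1) / (n - m) ≤ 1 := (div_le_one h0).2 (by linarith)
    refine ⟨fun i => (n - m - 1) / (n - m) * w i, fun i => ⟨mul_nonneg h1 (hw i).1,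
      mul_le_one₀ h2 (hw i).1 (hw i).2⟩, ?_, fun k => ?_⟩
    · rw [← Finset.mul_sum, hsum, div_mul_cancel₀ _ h0.ne']
    · simp only [mul_assoc, ← Finset.mul_sum, hv, mul_zero]
  obtain ⟨μ, hμ⟩ := hK.extremePoints_nonempty hne
  obtain ⟨hμK, hext⟩ := mem_extremePoints.1 hμ
  refine ⟨μ, hμK.1, hμK.2.1, hμK.2.2, ?_⟩
  by_contra! hpos
  replace hpos : ∀ i, 0 < μ i := fun i => lt_of_le_of_ne (hμK.1 i).1 (hpos i).symm
  let F : Finset ι := Finset.univ.filter fun i => μ i < 1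
  have hFsum : ∑ i ∈ F, (1 - μ i) = m + 1 := by
    have h1 : ∑ i, (1 - μ i) = m + 1 := by
      rw [Finset.sum_sub_distrib, hμK.2.1]
      simp only [Finset.sum_const, Finset.card_univ, nsmul_eq_mul, mul_one, ← hn]
      ring
    rw [← h1]
    refine Finset.sum_subset (Finset.subset_univ _) fun i _ hi => ?_
    have : ¬ μ i < 1 := by simpa [F] using hi
    linarith [(hμK.1 i).2]
  have hFcard : Fintype.card κ + 1 < F.card := by
    have hFne : F.Nonempty := by
      rw [Finset.nonempty_iff_ne_empty]
      rintro h
      rw [h, Finset.sum_empty] at hFsum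
      have : (0 : ℝ) ≤ m := Nat.cast_nonneg _
      linarith
    have h1 : ∑ i ∈ F, (1 - μ i) < ∑ i ∈ F, (1 : ℝ) :=
      Finset.sum_lt_sum_of_nonempty hFne fun i _ => by linarith [hpos i]
    rw [hFsum, Finset.sum_const, nsmul_eq_mul, mul_one, hm] at h1
    exact_mod_cast h1
  let L := Fintype.linearCombination ℝ (fun (i : F) (o : Option κ) => o.elim 1 (v i))
  have hL : LinearMap.ker L ≠ ⊥ := LinearMap.ker_ne_bot_of_finrank_lt (by simpa using hFcard)
  obtain ⟨c, hc, hc0⟩ := (Submodule.ne_bot_iff _).1 hL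
  have hcL : ∀ o : Option κ, ∑ i : F, c i * o.elim 1 (v i) = 0 := fun o => by
    have := congrFun (LinearMap.mem_ker.1 hc) o
    simpa [L, Fintype.linearCombination_apply] using this
  let d : ι → ℝ := fun i => if h : i ∈ F then c ⟨i, h⟩ else 0
  have hd : ∀ o : Option κ, ∑ i, d i * o.elim 1 (v i) = 0 := fun o => by
    rw [← hcL o, ← Finset.sum_subset (Finset.subset_univ F), ← Finset.sum_coe_sort]
    · exact Finset.sum_congr rfl fun i _ => by simp [d]
    · intro i _ hi
      simp [d, hi]
  have hd0 : d ≠ 0 := fun h => hc0 <| funext fun i => by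
    have := congrFun h i
    simpa [d] using this
  have hmem : ∀ᶠ ε : ℝ in nhds 0, (fun i => μ i + ε * d i) ∈ K := by
    have h1 : ∀ᶠ ε : ℝ in nhds 0, ∀ i, 0 ≤ μ i + ε * d i ∧ μ i + ε * d i ≤ 1 := by
      rw [Filter.eventually_all]
      intro i
      have hcont : Filter.Tendsto (fun ε : ℝ => μ i + ε * d i) (nhds 0) (nhds (μ i)) := by
        have : Continuous fun ε : ℝ => μ i + ε * d i := by fun_prop
        simpa using this.tendsto 0
      by_cases hi : i ∈ F
      · have hi1 : μ i < 1 := by simpa [F] using hi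
        filter_upwards [hcont.eventually (lt_mem_nhds (hpos i)),
          hcont.eventually (gt_mem_nhds hi1)] with ε h h' using ⟨h.le, h'.le⟩
      · exact Filter.Eventually.of_forall fun ε => by simpa [d, hi] using hμK.1 i
    filter_upwards [h1] with ε hε
    refine ⟨hε, ?_, fun k => ?_⟩
    · have := hd none
      simp only [Option.elim_none, mul_one] at this
      rw [Finset.sum_add_distrib, ← Finset.mul_sum, this, hμK.2.1]
      ring
    · have := hd (some k)
      simp only [Option.elim_some] at this
      simp only [add_mul, mul_assoc]
      rw [Finset.sum_add_distrib, ← Finset.mul_sum, this, hμK.2.2 k]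
      ring
  obtain ⟨δ, hδ, hball⟩ := Metric.eventually_nhds_iff.1 hmem
  have hin : ∀ ε : ℝ, |ε| < δ → (fun i => μ i + ε * d i) ∈ K := fun ε hε =>
    hball (by simpa [Real.dist_eq] using hε)
  have h1 := hin (δ / 2) (by rw [abs_of_pos (by linarith)]; linarith)
  have h2 := hin (-(δ / 2)) (by rw [abs_neg, abs_of_pos (by linarith)]; linarith)
  have h3 := (hext _ h1 _ h2 ⟨1 / 2, 1 / 2, by norm_num, by norm_num, by norm_num, by
    funext i; simp; ring⟩).1
  refine hd0 (funext fun i => ?_)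
  have := congrFun h3 i
  simp only [add_eq_left, mul_eq_zero] at this
  rcases this with h | h
  · linarith
  · exact h

/-- **Steinitz lemma**: vectors with sum zero can be ordered in such a way that all partial sums
are bounded by the dimension times the bound on the vectors. -/
theorem exists_order_of_sum_eq_zero {ι : Type} [DecidableEq ι] (v : ι → κ → ℝ) (A : Finset ι)
    {Δ : ℝ} (hΔ : 0 ≤ Δ) (hv : ∀ i k, |v i k| ≤ Δ) (hA : ∀ k, ∑ i ∈ A, v i k = 0) :
    ∃ l : List ι, l.Nodup ∧ l.toFinset = A ∧
      ∀ j k, |((l.take j).map fun i => v i k).sum| ≤ Fintype.card κ * Δ := by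
  -- The order is constructed from its end: an element of weight zero is removed repeatedly. As long
  -- as there are weights in `[0, 1]` with sum `|A| - |κ|` that annihilate `v`, the sum over `A` is
  -- one with weights `1 - w i` of total weight `|κ|`, and hence bounded.
  have key : ∀ (N : ℕ) (A : Finset ι), A.card = N →
      (A.card ≤ Fintype.card κ ∨ ∃ w : ι → ℝ, (∀ i ∈ A, 0 ≤ w i ∧ w i ≤ 1) ∧
        ∑ i ∈ A, w i = A.card - Fintype.card κ ∧ ∀ k, ∑ i ∈ A, w i * v i k = 0) →
      ∃ l : List ι, l.Nodup ∧ l.toFinset = A ∧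
        ∀ j k, |((l.take j).map fun i => v i k).sum| ≤ Fintype.card κ * Δ := by
    intro N
    induction N with
    | zero =>
      intro A hN _
      rw [Finset.card_eq_zero.1 hN]
      exact ⟨[], List.nodup_nil, rfl, fun j k => by simp; positivity⟩
    | succ N ih =>
      intro A hN hw
      have hsum : ∀ k, |∑ i ∈ A, v i k| ≤ Fintype.card κ * Δ := by
        intro k
        rcases hw with hw | ⟨w, hw, hw1, hw2⟩
        · refine (Finset.abs_sum_le_sum_abs _ _).trans ?_
          refine (Finset.sum_le_sum fun i _ => hv i k).trans ?_
          rw [Finset.sum_const, nsmul_eq_mul]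
          exact mul_le_mul_of_nonneg_right (by exact_mod_cast hw) hΔ
        · have h1 : ∑ i ∈ A, v i k = ∑ i ∈ A, (1 - w i) * v i k := by
            simp only [sub_mul, one_mul]
            rw [Finset.sum_sub_distrib, hw2 k, sub_zero]
          have h2 : ∑ i ∈ A, (1 - w i) = Fintype.card κ := by
            rw [Finset.sum_sub_distrib, hw1]
            simp
          rw [h1, ← h2, Finset.sum_mul]
          refine (Finset.abs_sum_le_sum_abs _ _).trans (Finset.sum_le_sum fun i hi => ?_)
          have h3 : 0 ≤ 1 - w i := by linarith [(hw i hi).2]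
          rw [abs_mul, abs_of_nonneg h3]
          exact mul_le_mul_of_nonneg_left (hv i k) h3
      have herase : ∃ a ∈ A, ((A.erase a).card ≤ Fintype.card κ ∨
          ∃ w : ι → ℝ, (∀ i ∈ A.erase a, 0 ≤ w i ∧ w i ≤ 1) ∧
            ∑ i ∈ A.erase a, w i = (A.erase a).card - Fintype.card κ ∧
            ∀ k, ∑ i ∈ A.erase a, w i * v i k = 0) := by
        by_cases hle : A.card ≤ Fintype.card κ + 1
        · obtain ⟨a, ha⟩ := Finset.card_pos.1 (by omega : 0 < A.card)
          exact ⟨a, ha, .inl (by rw [Finset.card_erase_of_mem ha]; omega)⟩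
        · obtain ⟨w, hw0, hw1, hw2⟩ := hw.resolve_left (by omega)
          obtain ⟨μ, h0, h1, h2, a, ha⟩ := exists_weights_with_zero (fun (i : A) => v i)
            (by simp only [Fintype.card_coe]; omega) (fun i => w i) (fun i => hw0 i i.2)
            (by rw [Finset.sum_coe_sort A w, hw1, Fintype.card_coe])
            (fun k => by rw [Finset.sum_coe_sort A fun i => w i * v i k, hw2])
          let w' : ι → ℝ := fun i => if h : i ∈ A then μ ⟨i, h⟩ else 0
          have hw' : ∀ i : A, w' i = μ i := fun i => by simp [w']
          have hw'a : w' a = 0 := (hw' a).trans ha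
          refine ⟨a, a.2, .inr ⟨w', fun i hi => ?_, ?_, fun k => ?_⟩⟩
          · have := h0 ⟨i, Finset.mem_of_mem_erase hi⟩
            rwa [← hw'] at this
          · rw [Finset.sum_erase _ hw'a, ← Finset.sum_coe_sort A w',
              Finset.card_erase_of_mem a.2, Nat.cast_sub (by omega)]
            simp only [hw', h1, Fintype.card_coe, Nat.cast_one]
            ring
          · rw [Finset.sum_erase _ (by rw [hw'a, zero_mul]), ← Finset.sum_coe_sort A fun i =>
              w' i * v i k]
            simp only [hw', h2]
      obtain ⟨a, ha, hwa⟩ := herase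
      obtain ⟨l, hl1, hl2, hl3⟩ := ih (A.erase a) (by rw [Finset.card_erase_of_mem ha]; omega) hwa
      have hal : a ∉ l := fun h => by
        have := List.mem_toFinset.2 h
        rw [hl2] at this
        exact (Finset.notMem_erase a A) this
      have hnd : (l ++ [a]).Nodup := by
        rw [List.nodup_append_comm]
        exact List.nodup_cons.2 ⟨hal, hl1⟩
      have hfin : (l ++ [a]).toFinset = A := by
        rw [List.toFinset_append, hl2]
        simp [Finset.union_comm _ {a}, Finset.insert_erase ha]
      refine ⟨l ++ [a], hnd, hfin, fun j k => ?_⟩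
      by_cases hj : j ≤ l.length
      · rw [List.take_append_of_le_length hj]
        exact hl3 j k
      · rw [List.take_of_length_le (by simp; omega)]
        have h4 := hsum k
        rwa [← hfin, List.sum_toFinset _ hnd] at h4
  refine key A.card A rfl ?_
  by_cases hle : A.card ≤ Fintype.card κ
  · exact .inl hle
  · right
    have h1 : (Fintype.card κ : ℝ) ≤ A.card := by exact_mod_cast (not_le.1 hle).le
    have h2 : (0 : ℝ) < A.card := by
      exact_mod_cast (Nat.zero_le _).trans_lt (not_le.1 hle)
    refine ⟨fun _ => (A.card - Fintype.card κ) / A.card, fun i _ => ⟨?_, ?_⟩, ?_, fun k => ?_⟩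
    · exact div_nonneg (by linarith) h2.le
    · exact (div_le_one h2).2 (by linarith [(Nat.cast_nonneg _ : (0 : ℝ) ≤ Fintype.card κ)])
    · rw [Finset.sum_const, nsmul_eq_mul]
      field_simp
    · rw [← Finset.mul_sum, hA, mul_zero]

/-- If a subsum of minimal length of integer vectors vanishes, among those that contain a given
vector, then its length is bounded: in a Steinitz ordering, no two partial sums on the same side of
the given vector are equal. -/
theorem exists_short_zero_sum {ι : Type} [DecidableEq ι] [DecidableEq κ] (u : ι → κ → ℤ)
    (A : Finset ι) (Δ : ℕ) (hu : ∀ i k, |u i k| ≤ Δ) (o : ι) (ho : o ∈ A)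
    (hA : ∀ k, ∑ i ∈ A, u i k = 0) :
    ∃ M ⊆ A, o ∈ M ∧ (∀ k, ∑ i ∈ M, u i k = 0) ∧
      M.card + 1 ≤ 2 * (2 * (Fintype.card κ * Δ) + 1) ^ Fintype.card κ := by
  -- Minimality: deleting the vectors between two equal partial sums on the same side of `o` would
  -- give a shorter sum; the first component of the map to which the pigeonhole principle is applied
  -- records the side.
  let Z := A.powerset.filter fun M => o ∈ M ∧ ∀ k, ∑ i ∈ M, u i k = 0
  have hZ : Z.Nonempty := ⟨A, by simpa [Z, ho] using hA⟩
  obtain ⟨M, hMZ, hmin⟩ := Z.exists_min_image Finset.card hZ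
  simp only [Z, Finset.mem_filter, Finset.mem_powerset] at hMZ hmin
  obtain ⟨hMA, hoM, hM⟩ := hMZ
  refine ⟨M, hMA, hoM, hM, ?_⟩
  obtain ⟨l, hnd, hl, hsteinitz⟩ := exists_order_of_sum_eq_zero (fun i k => (u i k : ℝ)) M
    (Nat.cast_nonneg Δ) (fun i k => by exact_mod_cast hu i k) (fun k => by exact_mod_cast hM k)
  let p : ℕ → κ → ℤ := fun j k => ((l.take j).map fun i => u i k).sum
  let b : ℤ := (Fintype.card κ * Δ : ℕ)
  have hp : ∀ j k, |p j k| ≤ b := fun j k => by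
    have h1 := hsteinitz j k
    have h2 : ((l.take j).map fun i => (u i k : ℝ)).sum = ((p j k : ℤ) : ℝ) := by
      simp [p, Int.cast_list_sum, List.map_map, Function.comp_def]
    rw [h2] at h1
    simp only [b]
    exact_mod_cast h1
  have hlen : l.length = M.card := by rw [← hl, List.toFinset_card_of_nodup hnd]
  let box : Finset (κ → ℤ) := Fintype.piFinset fun _ => Finset.Icc (-b) b
  have hbox : box.card = (2 * (Fintype.card κ * Δ) + 1) ^ Fintype.card κ := by
    simp only [box, Fintype.card_piFinset, Int.card_Icc, Finset.prod_const, Finset.card_univ]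
    congr 1
    simp only [b]
    omega
  by_contra hlt
  rw [← hbox, not_le] at hlt
  obtain ⟨i, hi, j, hj, hij, heq⟩ := Finset.exists_ne_map_eq_of_card_lt_of_maps_to
    (s := Finset.range (M.card + 1)) (t := (Finset.univ : Finset Bool) ×ˢ box)
    (f := fun j => (decide (j ≤ l.idxOf o), p j)) (by simpa using hlt)
    (fun j _ => Finset.mem_coe.2 (Finset.mem_product.2 ⟨Finset.mem_univ _,
      Fintype.mem_piFinset.2 fun k => Finset.mem_Icc.2 (abs_le.1 (hp j k))⟩))
  wlog hlt' : i < j generalizing i j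
  · exact this j hj i hi hij.symm heq.symm (by omega)
  simp only [Prod.mk.injEq, decide_eq_decide] at heq
  have hol : o ∈ l := List.mem_toFinset.1 (hl ▸ hoM)
  have hsplit : ∀ k, p j k + ((l.drop j).map fun i => u i k).sum = 0 := fun k => by
    rw [← hM k, ← hl, List.sum_toFinset _ hnd, ← List.sum_append, ← List.map_append,
      List.take_append_drop]
  have hsub : (l.take i ++ l.drop j).Sublist l := by
    conv_rhs => rw [← List.take_append_drop i l]
    exact (List.Sublist.refl _).append (List.drop_sublist_drop_left l hlt'.le)
  have hnd' := hnd.sublist hsub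
  have h1 := hmin (l.take i ++ l.drop j).toFinset ⟨fun a ha => hMA (by
      rw [← hl]
      exact List.mem_toFinset.2 (hsub.subset (List.mem_toFinset.1 ha))), ?_, fun k => ?_⟩
  · rw [List.toFinset_card_of_nodup hnd', ← hlen, List.length_append, List.length_take,
      List.length_drop] at h1
    simp only [Finset.mem_range] at hj
    omega
  · have hidx : l.idxOf o < l.length := List.idxOf_lt_length_iff.2 hol
    rw [List.mem_toFinset, List.mem_append]
    by_cases hc : l.idxOf o < i
    · left
      rw [List.mem_take_iff_getElem]
      exact ⟨l.idxOf o, by omega, List.getElem_idxOf _⟩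
    · right
      rw [List.mem_drop_iff_getElem]
      exact ⟨l.idxOf o - j, by omega, by
        simp only [show j + (l.idxOf o - j) = l.idxOf o by omega, List.getElem_idxOf]⟩
  · rw [List.sum_toFinset _ hnd', List.map_append, List.sum_append]
    have h2 := hsplit k
    have h3 := congrFun heq.2 k
    simp only [p] at h2 h3
    rw [h3, h2]

/-- A sum of integer vectors that satisfies `0 ≤ b + ∑ v i` can be replaced by a subsum of bounded
length. The inequalities become equations by adding negative unit vectors as slack. -/
theorem exists_small_subsum {ι : Type} [DecidableEq ι] [DecidableEq κ] (v : ι → κ → ℤ)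
    (A : Finset ι) (b : κ → ℤ) (Δ : ℕ) (hΔ : 1 ≤ Δ) (hv : ∀ i k, |v i k| ≤ Δ)
    (hb : ∀ k, |b k| ≤ Δ) (h : ∀ k, 0 ≤ b k + ∑ i ∈ A, v i k) :
    ∃ S ⊆ A, S.card ≤ 2 * (2 * (Fintype.card κ * Δ) + 1) ^ Fintype.card κ ∧
      ∀ k, 0 ≤ b k + ∑ i ∈ S, v i k := by
  let u : Option (ι ⊕ κ × ℕ) → κ → ℤ := fun x => x.elim b fun y => y.elim v fun z k =>
    if z.1 = k then -1 else 0
  let slack : Finset (κ × ℕ) := Finset.univ.sigma (fun k =>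
    Finset.range (b k + ∑ i ∈ A, v i k).toNat) |>.image fun x => (x.1, x.2)
  have hslack : ∀ k, ∑ z ∈ slack, (if z.1 = k then (-1 : ℤ) else 0) =
      -(b k + ∑ i ∈ A, v i k) := fun k => by
    rw [Finset.sum_image (by rintro ⟨a, b⟩ _ ⟨c, d⟩ _ h; simp at h; simp [h]), Finset.sum_sigma]
    rw [Finset.sum_eq_single k]
    · simp [Int.toNat_of_nonneg (h k), add_comm]
    · intro x _ hx
      simp [hx]
    · simp
  have hsum : ∀ (S : Finset ι) (R : Finset (κ × ℕ)) (k : κ),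
      ∑ x ∈ Finset.insertNone (S.disjSum R), u x k =
        b k + (∑ i ∈ S, v i k + ∑ z ∈ R, if z.1 = k then (-1 : ℤ) else 0) := by
    intro S R k
    rw [Finset.sum_insertNone, Finset.sum_disjSum]
    simp [u]
  have hu : ∀ x k, |u x k| ≤ Δ := by
    intro x k
    rcases x with _ | i | z
    · exact hb k
    · exact hv i k
    · simp only [u, Option.elim_some, Sum.elim_inr]
      split_ifs <;> simp [hΔ]
  obtain ⟨M, hMA, hoM, hM, hcard⟩ := exists_short_zero_sum u
    (Finset.insertNone (A.disjSum slack)) Δ hu none (by simp) fun k => by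
      rw [hsum, hslack]
      ring
  have hMeq : M = Finset.insertNone ((Finset.eraseNone M).toLeft.disjSum
      (Finset.eraseNone M).toRight) := by
    rw [Finset.toLeft_disjSum_toRight, Finset.insertNone_eraseNone, Finset.insert_eq_self.2 hoM]
  refine ⟨(Finset.eraseNone M).toLeft, fun i hi => ?_, ?_, fun k => ?_⟩
  · have := hMA (Finset.mem_eraseNone.1 (Finset.mem_toLeft.1 hi))
    simpa using this
  · refine le_trans ?_ ((Nat.le_succ _).trans hcard)
    rw [hMeq, Finset.card_insertNone, Finset.card_disjSum]
    simp only [Finset.eraseNone_insertNone, Finset.toLeft_disjSum]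
    omega
  · have h1 := hM k
    rw [hMeq, hsum] at h1
    have h2 : ∑ z ∈ (Finset.eraseNone M).toRight, (if z.1 = k then (-1 : ℤ) else 0) ≤ 0 :=
      Finset.sum_nonpos fun z _ => by split_ifs <;> simp
    linarith

end Steinitz

/-! ### Values in a model as linear functions of the numbers of successors -/

namespace KSharp

/-- Unfolding a DAG succeeds at every node, relative to the preceding ones. -/
theorem denoteFrom_spec (l : List Node) : ∀ env : List (Form ⊕ Expr), denoteFrom [] l = some env →
    env.length = l.length ∧ ∀ (k : ℕ) (nd : Node), l[k]? = some nd →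
      ∃ x, env[k]? = some x ∧ nd.denote (env.take k) = some x := by
  induction l using List.reverseRecOn with
  | nil =>
    intro env h
    obtain rfl : [] = env := by simpa [denoteFrom] using h
    simp
  | append_singleton l nd ih =>
    intro env h
    rw [denoteFrom_snoc] at h
    obtain ⟨env', h1, h2⟩ := Option.bind_eq_some_iff.1 h
    obtain ⟨x, h3, rfl⟩ := Option.map_eq_some_iff.1 h2
    obtain ⟨h4, h5⟩ := ih env' h1
    refine ⟨by simp [h4], fun k nd' hk => ?_⟩
    by_cases hk' : k < l.length
    · rw [List.getElem?_append_left hk'] at hk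
      obtain ⟨y, hy, hy'⟩ := h5 k nd' hk
      refine ⟨y, by rw [List.getElem?_append_left (h4 ▸ hk'), hy], ?_⟩
      rw [List.take_append_of_le_length (h4 ▸ hk'.le), hy']
    · have hk2 := (List.getElem?_eq_some_iff.1 hk).1
      rw [List.length_append, List.length_singleton] at hk2
      obtain rfl : k = l.length := by omega
      simp only [List.getElem?_concat_length, Option.some.injEq] at hk
      subst hk
      exact ⟨x, by rw [← h4]; simp, by rw [← h4]; simpa using h3⟩

theorem formAt_take {env : List (Form ⊕ Expr)} {i k : ℕ} {φ : Form}
    (h : formAt (env.take k) i = some φ) : i < k ∧ env[i]? = some (.inl φ) := by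
  rw [formAt_eq_some, List.getElem?_take] at h
  split_ifs at h with hi
  exact ⟨hi, h⟩

theorem exprAt_take {env : List (Form ⊕ Expr)} {i k : ℕ} {E : Expr}
    (h : exprAt (env.take k) i = some E) : i < k ∧ env[i]? = some (.inr E) := by
  rw [exprAt_eq_some, List.getElem?_take] at h
  split_ifs at h with hi
  exact ⟨hi, h⟩

/-- Whether there is a formula at position `k`. -/
def sortOf (env : List (Form ⊕ Expr)) (k : ℕ) : Bool :=
  match env[k]? with
  | some (.inl _) => true
  | _ => false

/-- Nodes that can be unfolded refer to earlier nodes of the right sort. -/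
theorem isForm_of_denote {env : List (Form ⊕ Expr)} {nd : Node} {k : ℕ} {x : Form ⊕ Expr}
    (hx : env[k]? = some x) (h : nd.denote (env.take k) = some x) :
    sortOf env k = nd.isForm ∧ nd.RefsOK (sortOf env) k := by
  have hform : ∀ {i φ}, formAt (env.take k) i = some φ → i < k ∧ sortOf env i = true := fun h =>
    ⟨(formAt_take h).1, by rw [sortOf, (formAt_take h).2]⟩
  have hexpr : ∀ {i E}, exprAt (env.take k) i = some E → i < k ∧ sortOf env i = false := fun h =>
    ⟨(exprAt_take h).1, by rw [sortOf, (exprAt_take h).2]⟩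
  cases nd <;>
    simp only [Node.denote, Option.bind_eq_some_iff, Option.map_eq_some_iff, Option.some.injEq] at h
  case atom p => subst h; exact ⟨by rw [sortOf, hx]; rfl, trivial⟩
  case neg i => obtain ⟨φ, h1, rfl⟩ := h; exact ⟨by rw [sortOf, hx]; rfl, hform h1⟩
  case or i j =>
    obtain ⟨φ, h1, ψ, h2, rfl⟩ := h
    exact ⟨by rw [sortOf, hx]; rfl, hform h1, hform h2⟩
  case nonneg i => obtain ⟨φ, h1, rfl⟩ := h; exact ⟨by rw [sortOf, hx]; rfl, hexpr h1⟩
  case const c => subst h; exact ⟨by rw [sortOf, hx]; rfl, trivial⟩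
  case ind i => obtain ⟨φ, h1, rfl⟩ := h; exact ⟨by rw [sortOf, hx]; rfl, hform h1⟩
  case count i => obtain ⟨φ, h1, rfl⟩ := h; exact ⟨by rw [sortOf, hx]; rfl, hform h1⟩
  case add i j =>
    obtain ⟨φ, h1, ψ, h2, rfl⟩ := h
    exact ⟨by rw [sortOf, hx]; rfl, hexpr h1, hexpr h2⟩
  case smul c i => obtain ⟨φ, h1, rfl⟩ := h; exact ⟨by rw [sortOf, hx]; rfl, hexpr h1⟩

/-- Natural numbers whose difference is the value of the expression at position `k`, when constants are
multiplied by `ε`, and the indicator and the number of successors of the formula at position `i`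
are `t i` and `c i`. -/
def linValue (l : List Node) (ε : ℕ) (t c : ℕ → ℕ) (k : ℕ) : ℕ × ℕ :=
  match l[k]? with
  | some (.const z) => (ε * z.toNat, ε * (-z).toNat)
  | some (.ind i) => (t i, 0)
  | some (.count i) => (c i, 0)
  | some (.add i j) => if _ : i < k ∧ j < k then linValue l ε t c i + linValue l ε t c j else 0
  | some (.smul z i) =>
    if _ : i < k then
      (z.toNat * (linValue l ε t c i).1 + (-z).toNat * (linValue l ε t c i).2,
        z.toNat * (linValue l ε t c i).2 + (-z).toNat * (linValue l ε t c i).1)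
    else 0
  | _ => 0
termination_by k
decreasing_by all_goals omega

theorem linValue_add (l : List Node) (ε ε' : ℕ) (t t' c c' : ℕ → ℕ) (k : ℕ) :
    linValue l (ε + ε') (t + t') (c + c') k = linValue l ε t c k + linValue l ε' t' c' k := by
  induction k using Nat.strong_induction_on with
  | _ k ih =>
    rw [linValue, linValue.eq_def l ε, linValue.eq_def l ε']
    rcases l[k]? with _ | nd
    · simp
    cases nd with
    | add i j =>
      by_cases h : i < k ∧ j < k
      · simp only [h, and_self, dif_pos, ih i h.1, ih j h.2]
        exact add_add_add_comm _ _ _ _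
      · simp [h]
    | smul z i =>
      by_cases h : i < k
      · simp only [h, dif_pos, ih i h, Prod.fst_add, Prod.snd_add, Prod.mk_add_mk, Prod.mk.injEq]
        constructor <;> ring
      · simp [h]
    | const z => simp [add_mul]
    | _ => simp

theorem linValue_sum (l : List Node) (ε : ℕ) (t : ℕ → ℕ) {ι : Type} (S : Finset ι)
    (c : ι → ℕ → ℕ) (k : ℕ) :
    linValue l ε t (∑ v ∈ S, c v) k = linValue l ε t 0 k + ∑ v ∈ S, linValue l 0 0 (c v) k := by
  classical
  induction S using Finset.induction_on with
  | empty => simp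
  | insert v S hv ih =>
    rw [Finset.sum_insert hv, Finset.sum_insert hv, add_comm (c v), add_comm (linValue l 0 0 (c v) k),
      ← add_assoc, ← ih, ← linValue_add, add_zero, add_zero]

theorem length_encodeNat (n : ℕ) : (encodeNat n).length = n.size := by
  rw [encodeNat, List.length_map, Nat.size_eq_bits_len]

theorem natAbs_lt_two_pow (z : ℤ) : z.natAbs < 2 ^ (encodeInt z).length := by
  refine (Nat.lt_size_self _).trans_le (Nat.pow_le_pow_right two_pos ?_)
  rw [encodeInt, List.length_append, length_encodeNat]
  omega

theorem length_encode_take_succ {l : List Node} {k : ℕ} {nd : Node} (h : l[k]? = some nd) :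
    (encode (l.take (k + 1))).length = (encode (l.take k)).length + nd.encode.length := by
  obtain ⟨hk, rfl⟩ := List.getElem?_eq_some_iff.1 h
  rw [List.take_succ_eq_append_getElem hk, encode, List.flatMap_append, List.length_append]
  simp [encode]

theorem length_encode_take_le (l : List Node) {i k : ℕ} (h : i ≤ k) :
    (encode (l.take i)).length ≤ (encode (l.take k)).length := by
  obtain ⟨d, rfl⟩ := Nat.exists_eq_add_of_le h
  rw [List.take_add, encode, encode, List.flatMap_append, List.length_append]
  exact Nat.le_add_right _ _

theorem toNat_add_toNat_neg (z : ℤ) : z.toNat + (-z).toNat = z.natAbs := by omega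

/-- Values of expressions are at most exponential in the length of the input. -/
theorem linValue_le (l : List Node) {ε C : ℕ} {t c : ℕ → ℕ} (hε : ε ≤ C) (ht : ∀ i, t i ≤ C)
    (hc : ∀ i, c i ≤ C) (k : ℕ) : (linValue l ε t c k).1 + (linValue l ε t c k).2 ≤
      C * 2 ^ (encode (l.take (k + 1))).length := by
  have hone : ∀ n, C ≤ C * 2 ^ n := fun n => Nat.le_mul_of_pos_right _ (by positivity)
  induction k using Nat.strong_induction_on with
  | _ k ih =>
    have ih' : ∀ i < k, (linValue l ε t c i).1 + (linValue l ε t c i).2 ≤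
        C * 2 ^ (encode (l.take k)).length := fun i hi => (ih i hi).trans
      (Nat.mul_le_mul_left _ (Nat.pow_le_pow_right two_pos (length_encode_take_le l hi)))
    rw [linValue]
    cases hk : l[k]? with
    | none => simp
    | some nd =>
      have hlen := length_encode_take_succ hk
      cases nd with
      | const z =>
        rw [← mul_add, toNat_add_toNat_neg]
        refine Nat.mul_le_mul hε ((natAbs_lt_two_pow z).le.trans
          (Nat.pow_le_pow_right two_pos ?_))
        rw [hlen, Node.encode, List.length_cons]
        omega
      | ind i => exact (ht i).trans (hone _)
      | count i => exact (hc i).trans (hone _)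
      | add i j =>
        dsimp only
        split_ifs with h
        · have h1 := ih' i h.1
          have h2 := ih' j h.2
          have h3 : C * 2 ^ (encode (l.take k)).length * 2 ≤
              C * 2 ^ (encode (l.take (k + 1))).length := by
            rw [mul_assoc, ← pow_succ]
            refine Nat.mul_le_mul_left _ (Nat.pow_le_pow_right two_pos ?_)
            rw [hlen, Node.encode, List.length_cons]
            omega
          simp only [Prod.fst_add, Prod.snd_add]
          omega
        · simp
      | smul z i =>
        dsimp only
        split_ifs with h
        · calc _ = z.natAbs * ((linValue l ε t c i).1 + (linValue l ε t c i).2) := by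
                rw [← toNat_add_toNat_neg]; ring
            _ ≤ 2 ^ (encodeInt z).length * (C * 2 ^ (encode (l.take k)).length) :=
                Nat.mul_le_mul (natAbs_lt_two_pow z).le (ih' i h)
            _ = C * 2 ^ ((encode (l.take k)).length + (encodeInt z).length) := by ring
            _ ≤ _ := by
                refine Nat.mul_le_mul_left _ (Nat.pow_le_pow_right two_pos ?_)
                rw [hlen, Node.encode, List.length_cons, List.length_append]
                omega
        · simp
      | _ => simp

theorem linValue_le' (l : List Node) {ε C : ℕ} {t c : ℕ → ℕ} (hε : ε ≤ C) (ht : ∀ i, t i ≤ C)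
    (hc : ∀ i, c i ≤ C) (k : ℕ) : (linValue l ε t c k).1 + (linValue l ε t c k).2 ≤
      C * 2 ^ (encode l).length := by
  refine (linValue_le l hε ht hc k).trans (Nat.mul_le_mul_left _ (Nat.pow_le_pow_right two_pos ?_))
  have := length_encode_take_le l (le_max_left (k + 1) l.length)
  rwa [List.take_of_length_le (le_max_right _ _)] at this

/-- Value of the expression at position `k`. -/
def linInt (l : List Node) (ε : ℕ) (t c : ℕ → ℕ) (k : ℕ) : ℤ :=
  (linValue l ε t c k).1 - (linValue l ε t c k).2

theorem abs_linInt_le (l : List Node) {ε : ℕ} {t c : ℕ → ℕ} (hε : ε ≤ 1) (ht : ∀ i, t i ≤ 1)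
    (hc : ∀ i, c i ≤ 1) (k : ℕ) : |linInt l ε t c k| ≤ 2 ^ (encode l).length := by
  have h := linValue_le' l hε ht hc k
  rw [one_mul] at h
  have h' : (((linValue l ε t c k).1 + (linValue l ε t c k).2 : ℕ) : ℤ) ≤
    (2 ^ (encode l).length : ℕ) := by exact_mod_cast h
  push_cast at h'
  rw [linInt, abs_le]
  constructor <;> omega

theorem linInt_sum (l : List Node) (ε : ℕ) (t : ℕ → ℕ) {ι : Type} (S : Finset ι)
    (c : ι → ℕ → ℕ) (k : ℕ) :
    linInt l ε t (∑ v ∈ S, c v) k = linInt l ε t 0 k + ∑ v ∈ S, linInt l 0 0 (c v) k := by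
  simp only [linInt, linValue_sum, Prod.fst_add, Prod.snd_add, Prod.fst_sum, Prod.snd_sum,
    Finset.sum_sub_distrib]
  push_cast
  ring

/-- The numbers of successors can be reduced to an exponential number in such a way that the signs
of all expressions are preserved. -/
theorem exists_small_subset (l : List Node) (t : ℕ → ℕ) (ht : ∀ i, t i ≤ 1) {ι : Type}
    (A : Finset ι) (c : ι → ℕ → ℕ) (hc : ∀ v i, c v i ≤ 1) :
    ∃ S ⊆ A, S.card ≤
        2 * (2 * (l.length * 2 ^ ((encode l).length + 1)) + 1) ^ l.length ∧
      ∀ k < l.length, 0 ≤ linInt l 1 t (∑ v ∈ S, c v) k ↔ 0 ≤ linInt l 1 t (∑ v ∈ A, c v) k := by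
  classical
  -- The value at `k` has the same sign as for `A` iff `0 ≤ δ k + σ k * value`.
  let σ : ℕ → ℤ := fun k => if 0 ≤ linInt l 1 t (∑ v ∈ A, c v) k then 1 else -1
  let δ : ℕ → ℤ := fun k => if 0 ≤ linInt l 1 t (∑ v ∈ A, c v) k then 0 else -1
  have hσ : ∀ k, |σ k| = 1 := fun k => by simp only [σ]; split_ifs <;> simp
  have hδ : ∀ k, |δ k| ≤ 1 := fun k => by simp only [δ]; split_ifs <;> simp
  have hpow : (2 : ℤ) ^ (encode l).length + 1 ≤ 2 ^ ((encode l).length + 1) := by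
    have : (1 : ℤ) ≤ 2 ^ (encode l).length := one_le_pow₀ (by norm_num)
    rw [pow_succ]
    linarith
  have hsum : ∀ (S : Finset ι) k, δ k + σ k * linInt l 1 t 0 k +
      ∑ v ∈ S, σ k * linInt l 0 0 (c v) k = δ k + σ k * linInt l 1 t (∑ v ∈ S, c v) k := by
    intro S k
    rw [linInt_sum, ← Finset.mul_sum]
    ring
  obtain ⟨S, hSA, hS, hS'⟩ := exists_small_subsum (κ := Fin l.length)
    (fun v k => σ k * linInt l 0 0 (c v) k) A (fun k => δ k + σ k * linInt l 1 t 0 k)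
    (2 ^ ((encode l).length + 1)) (Nat.one_le_pow _ _ two_pos) (fun v k => by
      rw [abs_mul, hσ, one_mul]
      push_cast
      have := abs_linInt_le l (Nat.zero_le 1) (fun _ => Nat.zero_le 1) (hc v) k
      simp only [Pi.zero_def] at *
      linarith) (fun k => by
      refine (abs_add_le _ _).trans ?_
      rw [abs_mul, hσ, one_mul]
      push_cast
      have := abs_linInt_le l (c := 0) le_rfl ht (fun _ => Nat.zero_le 1) k
      linarith [hδ k]) (fun k => by
      rw [hsum]
      simp only [σ, δ]
      split_ifs <;> omega)
  refine ⟨S, hSA, by simpa using hS, fun k hk => ?_⟩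
  have := hS' ⟨k, hk⟩
  simp only [hsum] at this
  simp only [σ, δ] at this
  split_ifs at this with h
  · exact iff_of_true (by simpa using this) h
  · exact iff_of_false (by linarith) h

end KSharp

/-! ### Completeness: certificates from models -/

theorem Data.toList_enc {α : Type} [Enc α] (l : List α) : (enc l).toList = l.map enc := by
  induction l with
  | nil => rfl
  | cons a l ih => rw [enc_cons, Data.toList, ih, List.map_cons]

theorem Data.nth_enc {α : Type} [Enc α] {l : List α} {i : ℕ} {a : α} (h : l[i]? = some a) :
    (enc l).nth i = enc a := by
  simp [Data.nth, Data.toList_enc, h]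

theorem Data.nth_enc_of_le {α : Type} [Enc α] {l : List α} {i : ℕ} (h : l.length ≤ i) :
    (enc l).nth i = .nil := by
  simp [Data.nth, Data.toList_enc, h]

theorem Data.truth_enc (b : Bool) : (enc b).truth = b := by cases b <;> rfl

theorem esize_list_le {α : Type} [Enc α] {l : List α} {c : ℕ} (h : ∀ a ∈ l, esize a ≤ c) :
    esize l ≤ 1 + l.length * (c + 1) := by
  induction l with
  | nil => simp [esize_nil]
  | cons a l ih =>
    have h1 := h a List.mem_cons_self
    have h2 := ih fun b hb => h b (List.mem_cons_of_mem a hb)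
    rw [esize_cons, List.length_cons, add_mul]
    omega

theorem length_filter_eq_sum {ι : Type} (l : List ι) (p : ι → Bool) :
    (l.filter p).length = (l.map fun v => (p v).toNat).sum := by
  induction l with
  | nil => rfl
  | cons v l ih => cases h : p v <;> simp [h, ih, Nat.add_comm]

namespace KSharp

/-- The tree that represents a node. -/
def nodeTree : Node → Data
  | .atom p => enc [enc 0, enc p, enc 0, enc false, enc 0]
  | .neg i => enc [enc 1, enc i, enc 0, enc false, enc 0]
  | .or i j => enc [enc 2, enc i, enc j, enc false, enc 0]
  | .nonneg i => enc [enc 3, enc i, enc 0, enc false, enc 0]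
  | .const c => enc [enc 4, enc 0, enc 0, enc (decide (c < 0)), enc c.natAbs]
  | .ind i => enc [enc 5, enc i, enc 0, enc false, enc 0]
  | .count i => enc [enc 6, enc i, enc 0, enc false, enc 0]
  | .add i j => enc [enc 7, enc i, enc j, enc false, enc 0]
  | .smul c i => enc [enc 8, enc i, enc 0, enc (decide (c < 0)), enc c.natAbs]

theorem toNode_enc (t i j a : ℕ) (s : Bool) :
    nodeTag (enc [enc t, enc i, enc j, enc s, enc a]) = t ∧
    nodeArg₁ (enc [enc t, enc i, enc j, enc s, enc a]) = i ∧
    nodeArg₂ (enc [enc t, enc i, enc j, enc s, enc a]) = j ∧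
    nodeInt (enc [enc t, enc i, enc j, enc s, enc a]) = bif s then -(a : ℤ) else a := by
  simp only [nodeTag, nodeArg₁, nodeArg₂, nodeInt, nodeSign, nodeAbs, Data.nth, Data.toList_enc]
  simp [enc_data, len_enc_nat, Data.truth_enc]

theorem toNode_nodeTree (nd : Node) : toNode (nodeTree nd) = nd := by
  have hz : ∀ c : ℤ, (bif decide (c < 0) then -(c.natAbs : ℤ) else c.natAbs) = c := fun c => by
    by_cases h : c < 0
    · simp only [h, decide_true, cond_true]; omega
    · simp only [h, decide_false, cond_false]; omega
  cases nd <;> simp [nodeTree, toNode, toNode_enc, hz, -Nat.cast_natAbs]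

theorem esize_nodeTree {nd : Node} {n : ℕ} (h : nd.encode.length ≤ n) :
    esize (nodeTree nd) ≤ 10 * 2 ^ n + 101 := by
  have hn : ∀ i, (encodeNat i).length ≤ n → esize (enc i) ≤ 2 * 2 ^ n + 17 := fun i hi => by
    have h1 : i < 2 ^ n := (Nat.lt_size_self i).trans_le
      (Nat.pow_le_pow_right two_pos (length_encodeNat i ▸ hi))
    have h2 : esize (enc i) = 2 * i + 1 := esize_nat i
    omega
  have ht : ∀ i ≤ 8, esize (enc i) ≤ 2 * 2 ^ n + 17 := fun i hi => by
    have h2 : esize (enc i) = 2 * i + 1 := esize_nat i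
    omega
  have hb : ∀ b : Bool, esize (enc b) ≤ 2 * 2 ^ n + 17 := fun b => by
    have h2 : esize (enc b) ≤ 3 := esize_bool b
    omega
  have hz : ∀ c : ℤ, (encodeInt c).length ≤ n → esize (enc c.natAbs) ≤ 2 * 2 ^ n + 17 :=
    fun c hc => hn _ (by rw [encodeInt, List.length_append] at hc; omega)
  suffices ∀ a₀ a₁ a₂ a₃ a₄ : Data, esize a₀ ≤ 2 * 2 ^ n + 17 → esize a₁ ≤ 2 * 2 ^ n + 17 →
      esize a₂ ≤ 2 * 2 ^ n + 17 → esize a₃ ≤ 2 * 2 ^ n + 17 → esize a₄ ≤ 2 * 2 ^ n + 17 →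
      esize (enc [a₀, a₁, a₂, a₃, a₄]) ≤ 10 * 2 ^ n + 101 by
    have h0 := ht 0 (by norm_num)
    cases nd <;> simp only [Node.encode, List.length_cons, List.length_append] at h <;>
      refine this _ _ _ _ _ (ht _ (by norm_num)) ?_ ?_ (hb _) ?_ <;>
      first | exact h0 | exact hn _ (by omega) | exact hz _ (by omega)
  intro a₀ a₁ a₂ a₃ a₄ h₀ h₁ h₂ h₃ h₄
  change esize [a₀, a₁, a₂, a₃, a₄] ≤ _
  simp only [esize_cons, esize_nil]
  omega

/-- The tree that represents an entry, for `m` nodes and `n` labels. -/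
def entryTree (m n : ℕ) (T : ℕ → Bool) (V : ℕ → ℕ × ℕ) (lab : ℕ → Bool) (cs : List ℕ) : Data :=
  enc ((List.range m).map fun k => (T k, V k), ((List.range n).map lab, cs))

section entryTree

variable {m n : ℕ} {T : ℕ → Bool} {V : ℕ → ℕ × ℕ} {lab : ℕ → Bool} {cs : List ℕ}

theorem entryTruth_entryTree (hT : ∀ k, m ≤ k → T k = false) (k : ℕ) :
    entryTruth (entryTree m n T V lab cs) k = T k := by
  rw [entryTree, entryTruth, enc_pair, Data.hd]
  by_cases hk : k < m
  · rw [Data.nth_enc (a := (T k, V k)) (by simp [hk]), enc_pair, Data.hd, Data.truth_enc]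
  · rw [Data.nth_enc_of_le (by simpa using hk), hT k (not_lt.1 hk)]; rfl

theorem entryPos_entryTree (hV : ∀ k, m ≤ k → V k = 0) (k : ℕ) :
    entryPos (entryTree m n T V lab cs) k = (V k).1 := by
  rw [entryTree, entryPos, enc_pair, Data.hd]
  by_cases hk : k < m
  · rw [Data.nth_enc (a := (T k, V k)) (by simp [hk]), enc_pair, Data.tl]
    exact len_enc_nat _
  · rw [Data.nth_enc_of_le (by simpa using hk), hV k (not_lt.1 hk)]; rfl

theorem entryNeg_entryTree (hV : ∀ k, m ≤ k → V k = 0) (k : ℕ) :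
    entryNeg (entryTree m n T V lab cs) k = (V k).2 := by
  rw [entryTree, entryNeg, enc_pair, Data.hd]
  by_cases hk : k < m
  · rw [Data.nth_enc (a := (T k, V k)) (by simp [hk]), enc_pair, Data.tl]
    exact len_enc_nat _
  · rw [Data.nth_enc_of_le (by simpa using hk), hV k (not_lt.1 hk)]; rfl

theorem entryLabel_entryTree {p : ℕ} (hp : p < n) :
    entryLabel (entryTree m n T V lab cs) p = lab p := by
  rw [entryTree, entryLabel, enc_pair, Data.tl, enc_pair, Data.hd,
    Data.nth_enc (a := lab p) (by simp [hp]), Data.truth_enc]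

theorem children_entryTree : (entryTree m n T V lab cs).tl.tl = enc cs := rfl

theorem esize_entryTree_le {B y : ℕ} (hB : 0 < B) (hm : m ≤ y) (hy : 0 < y)
    (hV : ∀ k, (V k).1 + (V k).2 ≤ B * y) (hcs : cs.length ≤ B) (hcs' : ∀ c ∈ cs, c < y) :
    esize (entryTree m y T V lab cs) ≤ 23 * (B * y ^ 2) := by
  have h1 : esize ((List.range m).map fun k => (T k, V k)) ≤ 1 + y * (8 + 2 * (B * y)) := by
    refine (esize_list_le (c := 7 + 2 * (B * y)) fun a ha => ?_).trans ?_
    · obtain ⟨k, -, rfl⟩ := List.mem_map.1 ha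
      rw [esize_pair, ← Prod.mk.eta (p := V k), esize_pair, esize_nat, esize_nat]
      have := esize_bool (T k)
      have := hV k
      omega
    · rw [List.length_map, List.length_range]
      have := Nat.mul_le_mul_right (7 + 2 * (B * y) + 1) hm
      linarith
  have h2 : esize ((List.range y).map lab) ≤ 1 + y * 4 := by
    refine (esize_list_le (c := 3) fun a ha => esize_bool a).trans ?_
    rw [List.length_map, List.length_range]
  have h3 : esize cs ≤ 1 + B * (2 * y + 2) := by
    refine (esize_list_le (c := 2 * y + 1) fun a ha => ?_).trans ?_
    · rw [esize_nat]; have := hcs' a ha; omega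
    · exact Nat.add_le_add_left (Nat.mul_le_mul_right _ hcs) _
  change esize ((List.range m).map fun k => (T k, V k), ((List.range y).map lab, cs)) ≤ _
  rw [esize_pair, esize_pair]
  have hy2 : y ≤ y ^ 2 := Nat.le_self_pow two_ne_zero y
  have e1 : B * y ≤ B * y ^ 2 := Nat.mul_le_mul_left _ hy2
  have e2 : y ≤ B * y := Nat.le_mul_of_pos_left _ hB
  have e3 : B ≤ B * y := Nat.le_mul_of_pos_right _ hy
  have e4 : y * (B * y) = B * y ^ 2 := by ring
  rw [mul_add] at h1 h3
  have e5 : y * (2 * (B * y)) = 2 * (B * y ^ 2) := by ring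
  have e6 : B * (2 * y) = 2 * (B * y) := by ring
  omega

end entryTree

/-! #### Types of vertices -/

open scoped Classical in
/-- Truth at a vertex of the formula at position `k`. -/
noncomputable def truthAt {V : Type} (G : Graph V) (env : List (Form ⊕ Expr)) (v : V) (k : ℕ) :
    Bool :=
  decide (∃ φ, env[k]? = some (.inl φ) ∧ φ.Holds G v)

section truthAt

variable {V : Type} {G : Graph V} {env : List (Form ⊕ Expr)} {v : V} {k : ℕ}

theorem truthAt_iff {φ : Form} (h : env[k]? = some (.inl φ)) :
    truthAt G env v k = true ↔ φ.Holds G v := by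
  classical
  rw [truthAt, decide_eq_true_iff]
  exact ⟨fun ⟨ψ, h1, h2⟩ => by rw [h] at h1; cases h1; exact h2, fun h' => ⟨φ, h, h'⟩⟩

theorem truthAt_of_le (h : env.length ≤ k) : truthAt G env v k = false := by
  classical
  refine Bool.eq_false_iff.2 fun ht => ?_
  obtain ⟨φ, h', -⟩ := of_decide_eq_true ht
  simp [List.getElem?_eq_none h] at h'

open scoped Classical in
/-- The successors of a vertex. -/
noncomputable def succs [Fintype V] (G : Graph V) (v : V) : Finset V :=
  Finset.univ.filter fun u => G.edge v u

theorem sum_toNat_truthAt [Fintype V] {φ : Form} (h : env[k]? = some (.inl φ)) :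
    (∑ u ∈ succs G v, fun i => (truthAt G env u i).toNat) k =
      {u | G.edge v u ∧ φ.Holds G u}.ncard := by
  classical
  rw [Finset.sum_apply, succs, Finset.sum_filter, Set.ncard_eq_toFinset_card', Finset.card_eq_sum_ones,
    Set.toFinset_ofPred, Finset.sum_filter]
  refine Finset.sum_congr rfl fun u _ => ?_
  have := truthAt_iff (G := G) (v := u) h
  by_cases h1 : G.edge v u <;> by_cases h2 : φ.Holds G u <;> simp_all

/-- Values of expressions are given by `linInt`. -/
theorem value_eq_linInt [Fintype V] (G : Graph V) {l : List Node} (hl : denoteFrom [] l = some env)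
    (v : V) (k : ℕ) {E : Expr} (hE : env[k]? = some (.inr E)) :
    E.value G v = linInt l 1 (fun i => (truthAt G env v i).toNat)
      (∑ u ∈ succs G v, fun i => (truthAt G env u i).toNat) k := by
  induction k using Nat.strong_induction_on generalizing E with
  | _ k ih =>
    obtain ⟨hlen, hspec⟩ := denoteFrom_spec l env hl
    have hk : k < l.length := hlen ▸ (List.getElem?_eq_some_iff.1 hE).1
    obtain ⟨x, hx, hd⟩ := hspec k _ (List.getElem?_eq_getElem hk)
    rw [hE, Option.some.injEq] at hx
    subst hx
    have hk' : l[k]? = some l[k] := List.getElem?_eq_getElem hk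
    revert hk' hd
    generalize l[k] = nd
    intro hd hk'
    rw [linInt, linValue, hk']
    cases nd <;> simp only [Node.denote, Option.bind_eq_some_iff, Option.map_eq_some_iff,
      Option.some.injEq, reduceCtorEq, and_false, exists_false, Sum.inr.injEq] at hd
    case const c => subst hd; rw [Expr.value]; dsimp only; omega
    case ind i =>
      obtain ⟨φ, h1, rfl⟩ := hd
      have := truthAt_iff (G := G) (v := v) (formAt_take h1).2
      rw [Expr.value]
      by_cases h : φ.Holds G v <;> simp_all
    case count i =>
      obtain ⟨φ, h1, rfl⟩ := hd
      rw [Expr.value, ← sum_toNat_truthAt (formAt_take h1).2]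
      simp
    case add i j =>
      obtain ⟨E, h1, F, h2, rfl⟩ := hd
      obtain ⟨h3, h4⟩ := exprAt_take h1
      obtain ⟨h5, h6⟩ := exprAt_take h2
      rw [Expr.value, ih i h3 h4, ih j h5 h6, linInt, linInt]
      simp only [h3, h5, and_self, dif_pos, Prod.fst_add, Prod.snd_add]
      push_cast
      ring
    case smul z i =>
      obtain ⟨E, h1, rfl⟩ := hd
      obtain ⟨h3, h4⟩ := exprAt_take h1
      rw [Expr.value, ih i h3 h4, linInt]
      simp only [h3, dif_pos]
      push_cast
      nth_rw 1 [show z = (z.toNat : ℤ) - ((-z).toNat : ℤ) by omega]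
      ring

/-- Conditions under which the values at a vertex stay correct when the numbers of successors
change. -/
theorem valuesOK_of_model [Fintype V] (G : Graph V) {l : List Node}
    (hl : denoteFrom [] l = some env) (v : V) {T lab : ℕ → Bool} {P N cnt : ℕ → ℕ}
    (hT : ∀ k, T k = truthAt G env v k)
    (hP : ∀ k, P k = (linValue l 1 (fun i => (truthAt G env v i).toNat) cnt k).1)
    (hN : ∀ k, N k = (linValue l 1 (fun i => (truthAt G env v i).toNat) cnt k).2)
    (hlab : ∀ p < 2 ^ (encode l).length, lab p = true ↔ G.label v p)
    (hsign : ∀ k < l.length, 0 ≤ linInt l 1 (fun i => (truthAt G env v i).toNat) cnt k ↔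
      0 ≤ linInt l 1 (fun i => (truthAt G env v i).toNat)
        (∑ u ∈ succs G v, fun i => (truthAt G env u i).toNat) k)
    {k : ℕ} {nd : Node} (hk : l[k]? = some nd) : nd.ValuesOK T P N lab cnt k := by
  obtain ⟨hlen, hspec⟩ := denoteFrom_spec l env hl
  obtain ⟨x, hx, hd⟩ := hspec k _ hk
  have hkl : k < l.length := (List.getElem?_eq_some_iff.1 hk).1
  have hP' := hP k
  have hN' := hN k
  rw [linValue, hk] at hP' hN'
  have hb : ∀ {a b : Bool}, (a = true ↔ b = true) → a = b := fun h => Bool.eq_iff_iff.2 h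
  cases nd <;>
    simp only [Node.denote, Option.bind_eq_some_iff, Option.map_eq_some_iff, Option.some.injEq] at hd
  case atom p =>
    subst hd
    refine hb ?_
    rw [hT, truthAt_iff hx, Form.Holds, hlab p]
    refine (Nat.lt_size_self p).trans_le (Nat.pow_le_pow_right two_pos ?_)
    have h1 := length_encode_take_succ hk
    have h2 := length_encode_take_le l (Nat.succ_le_of_lt hkl)
    rw [List.take_length] at h2
    rw [Node.encode, List.length_cons, length_encodeNat] at h1
    change (encode (l.take (k + 1))).length ≤ _ at h2
    omega
  case neg i =>
    obtain ⟨φ, h1, rfl⟩ := hd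
    refine hb ?_
    rw [hT, truthAt_iff hx, Form.Holds, hT, ← truthAt_iff (formAt_take h1).2]
    simp
  case or i j =>
    obtain ⟨φ, h1, ψ, h2, rfl⟩ := hd
    refine hb ?_
    rw [hT, truthAt_iff hx, Form.Holds, hT, hT, ← truthAt_iff (formAt_take h1).2,
      ← truthAt_iff (formAt_take h2).2, Bool.or_eq_true]
  case nonneg i =>
    obtain ⟨E, h1, rfl⟩ := hd
    obtain ⟨h3, h4⟩ := exprAt_take h1
    refine hb ?_
    rw [hT, truthAt_iff hx, Form.Holds, value_eq_linInt G hl v i h4, ← hsign i (h3.trans hkl),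
      hP, hN, linInt, decide_eq_true_iff]
    omega
  case const c => exact ⟨hP'.trans (one_mul _), hN'.trans (one_mul _)⟩
  case ind i =>
    refine ⟨?_, hN'⟩
    change P k = (truthAt G env v i).toNat at hP'
    rw [hP', hT]
    cases truthAt G env v i <;> rfl
  case count i => exact ⟨hP', hN'⟩
  case add i j =>
    obtain ⟨E, h1, F, h2, rfl⟩ := hd
    have h3 := (exprAt_take h1).1
    have h4 := (exprAt_take h2).1
    simp only [h3, h4, and_self, dif_pos, Prod.fst_add, Prod.snd_add] at hP' hN'
    exact ⟨by rw [hP', hP, hP], by rw [hN', hN, hN]⟩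
  case smul c i =>
    obtain ⟨E, h1, rfl⟩ := hd
    have h3 := (exprAt_take h1).1
    simp only [h3, dif_pos] at hP' hN'
    exact ⟨by rw [hP', hP, hN], by rw [hN', hP, hN]⟩

end truthAt

theorem Node.RefsOK.congr {s s' : ℕ → Bool} {k : ℕ} {nd : Node} (h : nd.RefsOK s k)
    (hs : ∀ i < k, s i = s' i) : nd.RefsOK s' k := by
  cases nd
  case or i j => exact ⟨⟨h.1.1, hs i h.1.1 ▸ h.1.2⟩, h.2.1, hs j h.2.1 ▸ h.2.2⟩
  case add i j => exact ⟨⟨h.1.1, hs i h.1.1 ▸ h.1.2⟩, h.2.1, hs j h.2.1 ▸ h.2.2⟩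
  case atom | const => trivial
  all_goals exact ⟨h.1, hs _ h.1 ▸ h.2⟩

theorem linValue_of_le {l : List Node} {k : ℕ} (h : l.length ≤ k) (ε : ℕ) (t c : ℕ → ℕ) :
    linValue l ε t c k = 0 := by
  rw [linValue, List.getElem?_eq_none h]

/-- Finitely many vertices represent all types of vertices. -/
theorem exists_representatives {V : Type} [Fintype V] (G : Graph V) (env : List (Form ⊕ Expr)) :
    ∃ R : List V, R.length ≤ 2 ^ env.length ∧
      ∀ v, ∃ i : ℕ, ∃ v', R[i]? = some v' ∧ truthAt G env v' = truthAt G env v := by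
  classical
  let f : V → Fin env.length → Bool := fun v k => truthAt G env v k
  let A := Finset.univ.image f
  have hA : ∀ t : A, ∃ v, f v = t.1 := fun t => by
    obtain ⟨v, -, hv⟩ := Finset.mem_image.1 t.2
    exact ⟨v, hv⟩
  choose g hg using hA
  refine ⟨A.attach.toList.map g, ?_, fun v => ?_⟩
  · rw [List.length_map, Finset.length_toList, Finset.card_attach]
    exact (Finset.card_le_univ _).trans_eq (by simp)
  · have hv : f v ∈ A := Finset.mem_image_of_mem f (Finset.mem_univ v)
    have hmem : g ⟨f v, hv⟩ ∈ A.attach.toList.map g :=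
      List.mem_map_of_mem (Finset.mem_toList.2 (Finset.mem_attach _ _))
    obtain ⟨i, hi⟩ := List.mem_iff_getElem?.1 hmem
    refine ⟨i, _, hi, funext fun k => ?_⟩
    by_cases hk : k < env.length
    · exact congr_fun (hg ⟨f v, hv⟩) ⟨k, hk⟩
    · rw [truthAt_of_le (not_lt.1 hk), truthAt_of_le (not_lt.1 hk)]

theorem length_le_length_encode (l : List Node) : l.length ≤ (encode l).length := by
  induction l with
  | nil => simp
  | cons nd l ih =>
    have : 0 < nd.encode.length := by cases nd <;> simp [Node.encode]
    rw [encode, List.flatMap_cons, List.length_append, List.length_cons]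
    change _ ≤ _ + (encode l).length
    omega

/-- The bound on the size of certificates, where the first factor is the number of successors that
suffices for `m` nodes and an input of length `n`. -/
theorem size_bound {m n : ℕ} (hm : 0 < m) (hmn : m ≤ n) :
    139 * (2 * (2 * (m * 2 ^ (n + 1)) + 1) ^ m * (2 ^ n) ^ 3) ≤ 2 ^ (2 * (n + 2) ^ 2) := by
  have h1 : 2 * (m * 2 ^ (n + 1)) + 1 ≤ 2 ^ (2 * n + 3) := by
    have h2 : m ≤ 2 ^ n := hmn.trans n.lt_two_pow_self.le
    have h3 : m * 2 ^ (n + 1) ≤ 2 ^ n * 2 ^ (n + 1) := Nat.mul_le_mul_right _ h2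
    have h4 : 2 ^ (2 * n + 3) = 4 * (2 ^ n * 2 ^ (n + 1)) := by ring
    have h5 : 0 < 2 ^ n * 2 ^ (n + 1) := by positivity
    omega
  calc _ ≤ 2 ^ 8 * (2 * (2 ^ (2 * n + 3)) ^ n * (2 ^ n) ^ 3) := by
        refine Nat.mul_le_mul (by norm_num) (Nat.mul_le_mul_right _ (Nat.mul_le_mul_left _ ?_))
        exact (Nat.pow_le_pow_left h1 m).trans (Nat.pow_le_pow_right (by positivity) hmn)
    _ = 2 ^ (8 + (1 + (2 * n + 3) * n + n * 3)) := by
        rw [← pow_mul, ← pow_mul, ← pow_succ', ← pow_add, ← pow_add]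
        ring_nf
    _ ≤ _ := Nat.pow_le_pow_right two_pos (by nlinarith)

/-- A satisfiable formula has an accepted certificate of exponential size. -/
theorem exists_cert {w : List Token} (hw : w ∈ SAT) :
    ∃ C, checkCert (w.map Token.index) C = true ∧ C.size ≤ 2 ^ (2 * (w.length + 2) ^ 2) := by
  classical
  obtain ⟨l, φ, rfl, ⟨env, hl, hlast⟩, V, hfin, G, u, hu⟩ := hw
  let _ := Fintype.ofFinite V
  obtain ⟨hlen, hspec⟩ := denoteFrom_spec l env hl
  rw [List.getLast?_eq_getElem?, hlen] at hlast
  have hm : 0 < l.length := by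
    have := (List.getElem?_eq_some_iff.1 hlast).1
    omega
  obtain ⟨R, hR, hR'⟩ := exists_representatives G env
  choose pos rep hpos hrep using hR'
  -- Every vertex `v` keeps the successors in `S v` only; these suffice for the signs of all values.
  let t : V → ℕ → ℕ := fun v i => (truthAt G env v i).toNat
  have ht : ∀ v i, t v i ≤ 1 := fun v i => Bool.toNat_le _
  have hS := fun v => exists_small_subset l (t v) (ht v) (succs G v) t ht
  choose S _ hS hsign using hS
  have hmn := length_le_length_encode l
  set m := l.length
  set n := (encode l).length
  set B := 2 * (2 * (m * 2 ^ (n + 1)) + 1) ^ m with hB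
  have hB0 : 0 < B := by positivity
  have hy : 0 < 2 ^ n := by positivity
  have hmy : m ≤ 2 ^ n := hmn.trans n.lt_two_pow_self.le
  have hpos' : ∀ v, pos v < R.length := fun v => (List.getElem?_eq_some_iff.1 (hpos v)).1
  have hRy : R.length ≤ 2 ^ n := (hlen ▸ hR).trans (Nat.pow_le_pow_right two_pos hmn)
  let cnt : V → ℕ → ℕ := fun v => ∑ u ∈ S v, t u
  let tree : V → Data := fun v => entryTree m (2 ^ n) (truthAt G env v)
    (linValue l 1 (t v) (cnt v)) (fun p => decide (G.label v p)) ((S v).toList.map pos)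
  let D : Data := enc (l.map nodeTree)
  let E : Data := enc (R.map tree)
  have hDlen : D.len = m := (len_enc_list _).trans (List.length_map _)
  have hElen : E.len = R.length := (len_enc_list _).trans (List.length_map _)
  have hDlist : D.toList = l.map nodeTree := (Data.toList_enc _).trans (List.map_id _)
  have hElist : E.toList = R.map tree := (Data.toList_enc _).trans (List.map_id _)
  have hDnth : ∀ k nd, l[k]? = some nd → D.nth k = nodeTree nd := fun k nd hk =>
    Data.nth_enc (by rw [List.getElem?_map, hk]; rfl)
  have hT0 : ∀ v k, m ≤ k → truthAt G env v k = false := fun v k hk =>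
    truthAt_of_le (hlen ▸ hk)
  have hV0 : ∀ v k, m ≤ k → linValue l 1 (t v) (cnt v) k = 0 := fun v k hk =>
    linValue_of_le hk _ _ _
  have htruth : ∀ v k, entryTruth (tree v) k = truthAt G env v k := fun v =>
    entryTruth_entryTree (hT0 v)
  have hEtruth : ∀ v k, entryTruth (E.nth (pos v)) k = truthAt G env v k := fun v k => by
    rw [show E.nth (pos v) = tree (rep v) from
      Data.nth_enc (by rw [List.getElem?_map, hpos v]; rfl), htruth, hrep]
  have hcnt : ∀ v k, cnt v k = ∑ u ∈ S v, t u k := fun v k => Finset.sum_apply _ _ _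
  have hcount : ∀ v k, entryCount E (tree v) k = cnt v k := fun v k => by
    rw [entryCount, children_entryTree, Data.toList_enc, List.map_map, List.filter_map,
      List.length_map, length_filter_eq_sum, Finset.sum_map_toList, hcnt]
    refine Finset.sum_congr rfl fun u _ => ?_
    simp only [Function.comp_apply, len_enc_nat, hEtruth]
    rfl
  have hlist : ∀ k < m, ∃ nd, l[k]? = some nd ∧ D.nth k = nodeTree nd ∧
      sortOf env k = nd.isForm ∧ nd.RefsOK (sortOf env) k := fun k hk => by
    obtain ⟨x, hx, hd⟩ := hspec k _ (List.getElem?_eq_getElem hk)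
    exact ⟨_, List.getElem?_eq_getElem hk, hDnth k _ (List.getElem?_eq_getElem hk),
      isForm_of_denote hx hd⟩
  have hcntB : ∀ v i, cnt v i ≤ B := fun v i => by
    refine le_trans ?_ (hS v)
    rw [hcnt, Finset.card_eq_sum_ones]
    exact Finset.sum_le_sum fun u _ => ht u i
  refine ⟨.cons D E, ?_, ?_⟩
  · simp only [checkCert, Data.hd, Data.tl, Bool.and_eq_true, decide_eq_true_eq, List.all_eq_true,
      List.any_eq_true, List.mem_range, hDlen, hElen, hDlist, hElist]
    refine ⟨⟨⟨⟨⟨?_, fun k hk => ?_⟩, ?_⟩, hm⟩, ?_⟩, ?_⟩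
    · rw [← map_encode, List.map_map]
      simp only [Function.comp_def, toNode_nodeTree, List.map_id']
    · obtain ⟨nd, h1, h2, h3, h4⟩ := hlist k hk
      rw [checkRefs_iff, h2, toNode_nodeTree]
      refine h4.congr fun i hi => ?_
      obtain ⟨nd', h5, h6, h7, h8⟩ := hlist i (hi.trans hk)
      rw [h7, h6, toNode_nodeTree]
    · obtain ⟨nd, h1, h2, h3, h4⟩ := hlist (m - 1) (by omega)
      rw [← isForm_toNode, h2, toNode_nodeTree, ← h3, sortOf, hlast]
    · refine ⟨tree (rep u), List.mem_map_of_mem (List.mem_of_getElem? (hpos u)), ?_⟩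
      rw [htruth, hrep, truthAt_iff hlast]
      exact hu
    · rintro e he
      obtain ⟨v, -, rfl⟩ := List.mem_map.1 he
      refine ⟨fun c hc => ?_, fun k hk => ?_⟩
      · change c ∈ (tree v).tl.tl.toList at hc
        rw [children_entryTree, Data.toList_enc, List.map_map] at hc
        obtain ⟨u', -, rfl⟩ := List.mem_map.1 hc
        exact (len_enc_nat _).trans_lt (hpos' u')
      · obtain ⟨nd, h1, h2, -, -⟩ := hlist k hk
        rw [checkValues_iff, h2, toNode_nodeTree, show entryCount E (tree v) = cnt v from
          funext (hcount v)]
        refine valuesOK_of_model G hl v (htruth v) (entryPos_entryTree (hV0 v))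
          (entryNeg_entryTree (hV0 v)) (fun p hp => ?_) (hsign v) h1
        rw [entryLabel_entryTree hp, decide_eq_true_iff]
  · have hDs : D.size ≤ 1 + 2 ^ n * (10 * 2 ^ n + 102) := by
      refine (esize_list_le (c := 10 * 2 ^ n + 101) fun d hd => ?_).trans ?_
      · obtain ⟨nd, hnd, rfl⟩ := List.mem_map.1 hd
        obtain ⟨k, hk⟩ := List.mem_iff_getElem?.1 hnd
        refine esize_nodeTree ?_
        have h1 := length_encode_take_succ hk
        have h2 := length_encode_take_le l
          (Nat.succ_le_of_lt (List.getElem?_eq_some_iff.1 hk).1)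
        rw [List.take_length] at h2
        exact (Nat.le_add_left _ _).trans (h1.symm.le.trans h2)
      · rw [List.length_map]
        exact Nat.add_le_add_left (Nat.mul_le_mul_right _ hmy) _
    have hEs : E.size ≤ 1 + 2 ^ n * (23 * (B * (2 ^ n) ^ 2) + 1) := by
      refine (esize_list_le (c := 23 * (B * (2 ^ n) ^ 2)) fun d hd => ?_).trans ?_
      · obtain ⟨v, -, rfl⟩ := List.mem_map.1 hd
        refine esize_entryTree_le hB0 hmy hy (fun k => ?_) ?_ fun c hc => ?_
        · exact linValue_le' l hB0 (fun i => (ht v i).trans hB0) (hcntB v) k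
        · rw [List.length_map, Finset.length_toList]; exact hS v
        · obtain ⟨u', -, rfl⟩ := List.mem_map.1 hc
          exact (hpos' u').trans_le hRy
      · rw [List.length_map]
        exact Nat.add_le_add_left (Nat.mul_le_mul_right _ hRy) _
    refine le_trans ?_ (size_bound hm hmn)
    change D.size + E.size + 1 ≤ 139 * (B * (2 ^ n) ^ 3)
    have e1 : (2 ^ n) ^ 2 ≤ B * (2 ^ n) ^ 3 := (Nat.pow_le_pow_right hy (by norm_num)).trans
      (Nat.le_mul_of_pos_left _ hB0)
    have e2 : 2 ^ n ≤ (2 ^ n) ^ 2 := Nat.le_self_pow two_ne_zero _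
    have e3 : 2 ^ n * (23 * (B * (2 ^ n) ^ 2) + 1) = 23 * (B * (2 ^ n) ^ 3) + 2 ^ n := by ring
    have e4 : 2 ^ n * (10 * 2 ^ n + 102) = 10 * (2 ^ n) ^ 2 + 102 * 2 ^ n := by ring
    rw [e3] at hEs
    rw [e4] at hDs
    linarith

end KSharp

/-! ### Machines for polynomial-time functions -/

namespace Cmd

/-- The stacks after reading the input `l`: the main stack holds a number for every letter, in
reverse order, and the query stack holds the letters themselves, in reverse order. -/
def afterReading {A : Type} (ι : A → ℕ) (l : List A) : Stacks Reg (TapeSym A) :=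
  Function.update (Function.update (fun _ => []) .main (enc (l.map ι).reverse).code) .query
    (l.map Sum.inl).reverse

theorem clean_afterReading {A : Type} (ι : A → ℕ) (l : List A) : Clean (afterReading ι l) := by
  simp [Clean, afterReading]

/-- A program that reads the input, with a running time that is linear for each alphabet. -/
theorem exists_read {A : Type} [Finite A] (ι : A → ℕ) :
    ∃ (c : Cmd Reg (TapeSym A)) (K : ℕ), (∀ s, ι s ≤ K) ∧ ∀ l : List A,
      Does c (Function.update (fun _ => []) .inp (l.map Sum.inl)) (afterReading ι l)
        ((2 * K + 7) * l.length + 2) := by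
  obtain ⟨K, hK⟩ := (Set.finite_range ι).bddAbove
  replace hK : ∀ s, ι s ≤ K := fun s => hK ⟨s, rfl⟩
  choose w hw using fun s => PTime.rewrites_pushes (A := A) (.inr .one :: (enc (ι s)).code)
  let body : Option (TapeSym A) → Cmd Reg (TapeSym A) := fun o =>
    (o.bind Sum.getLeft?).elim skip fun s => seq (pop .inp) (seq (push .query (.inl s)) (w s))
  let c : Cmd Reg (TapeSym A) := loop .inp Option.isSome (case .inp body)
  have hc : ∀ (l : List A) (S : Stacks Reg (TapeSym A)) (L : List ℕ), Clean S →
      S .inp = l.map Sum.inl → S .main = (enc L).code → Does c S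
        (Function.update (Function.update (Function.update S .inp []) .main
          (enc ((l.map ι).reverse ++ L)).code) .query ((l.map Sum.inl).reverse ++ S .query))
        ((2 * K + 7) * l.length + 1) := by
    intro l
    induction l with
    | nil =>
      intro S L hS hi hm
      refine ((does_loop_done (by simp [hi])).mono (Nat.le_add_left _ _)).of_eq ?_
      funext m
      cases m <;> simp_all
    | cons s l ih =>
      intro S L hS hi hm
      have h1 := does_pop .inp S
      have h2 := does_push .query (.inl s) (Function.update S .inp (S .inp).tail)
      have h3 := hw s [] (Function.update (Function.update S .inp (S .inp).tail) .query
        (.inl s :: Function.update S .inp (S .inp).tail .query)) (enc L).code (by simp [hm])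
        (by simpa [Clean] using hS)
      have h4 := ih (withMain (Function.update (Function.update S .inp
        (S .inp).tail) .query (.inl s :: Function.update S .inp (S .inp).tail .query))
          (.inr .one :: (enc (ι s)).code ++ [] ++ (enc L).code)) (ι s :: L) (by simpa [Clean] using hS)
        (by simp [hi]) (by simp [enc_cons, Data.code])
      refine ((Does.loop (by simp [hi]) (Does.case (o := some (.inl s)) (f := body) (by simp [hi])
        (h1.seq (h2.seq h3))) h4).mono ?_).of_eq ?_
      · have h5 : (enc (ι s)).size = 2 * ι s + 1 := esize_nat _
        have h6 := hK s
        rw [List.length_cons, List.length_cons, Data.length_code, h5, mul_add]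
        omega
      · funext m
        cases m <;> simp
  refine ⟨seq (push .main (.inr .zero)) c, K, hK, fun l => ?_⟩
  refine (((does_push _ _ _).seq (hc l _ [] ?_ ?_ ?_)).mono (by omega)).of_eq ?_
  · simp [Clean]
  · simp
  · simp [enc_nil, Data.code]
  · funext m
    cases m <;> simp [afterReading]

end Cmd

/-- Polynomial-time functions of the list of the input letters, given as numbers, define languages
in `P`. -/
theorem PTime.inP {A : Type} [Fintype A] [DecidableEq A] (ι : A → ℕ) {f : List ℕ → Bool}
    (hf : PTime f) : Complexity.InP ({x | f (x.map ι) = true} : Language A) := by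
  open Polynomial in
  obtain ⟨c, K, hK, hc⟩ := Cmd.exists_read ι
  obtain ⟨d, p, hd⟩ := (show PTime fun l : List ℕ => f l.reverse from
    hf.comp (PTime.reverse PTime.id)).prog A
  refine ⟨(Cmd.seq c d).toMachine Function.Embedding.inl .inp .query .main (.inr .one),
    C (2 * K + 7) * X + C 3 + p.comp (1 + X * C (2 * K + 2)),
    Cmd.toMachine_decides (Cmd.seq c d) fun x => ?_⟩
  have h1 := hd (x.map ι).reverse (Cmd.afterReading ι x) []
    (by simp [Cmd.afterReading]) (Cmd.clean_afterReading ι x)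
  obtain ⟨t, ht, hr⟩ := ((hc x).seq h1) .query 0
  refine ⟨_, t, ?_, hr, ?_⟩
  · have h2 : esize (x.map ι).reverse ≤ 1 + x.length * (2 * K + 2) := by
      refine (esize_list_le (c := 2 * K + 1) fun n hn => ?_).trans (by simp)
      simp only [List.mem_reverse, List.mem_map] at hn
      obtain ⟨s, -, rfl⟩ := hn
      rw [esize_nat]
      have := hK s
      omega
    have h3 := p.eval_mono_nat h2
    simp only [eval_add, eval_mul, eval_C, eval_X, eval_comp, eval_one]
    omega
  · simp only [List.reverse_reverse]
    change _ ↔ f (x.map ι) = true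
    cases f (x.map ι) <;> simp [enc, Data.code]

/-! ### Binary codes of trees -/

namespace Data

/-- Binary prefix code of a tree. -/
def bits : Data → List Bool
  | nil => [false]
  | cons x y => true :: (x.bits ++ y.bits)

theorem length_bits (d : Data) : d.bits.length = d.size := by
  induction d with
  | nil => rfl
  | cons x y hx hy => simp [bits, size, hx, hy]

/-- One step of decoding from right to left, with a stack of trees. -/
def decodeStep (b : Bool) (s : Data) : Data :=
  bif b then cons (cons s.hd s.tl.hd) s.tl.tl else cons nil s

/-- The list of the trees whose codes are concatenated. -/
def ofBits (l : List Bool) : Data := l.foldr decodeStep nil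

theorem ofBits_bits_append (d : Data) : ∀ l, ofBits (d.bits ++ l) = cons d (ofBits l) := by
  induction d with
  | nil => intro l; rfl
  | cons x y hx hy =>
    intro l
    rw [bits, List.cons_append, List.append_assoc, ofBits, List.foldr_cons, ← ofBits, hx, hy]
    rfl

theorem hd_ofBits_bits (d : Data) : (ofBits d.bits).hd = d := by
  rw [← List.append_nil d.bits, ofBits_bits_append]; rfl

end Data

open Polynomial in
@[fun_prop]
theorem PTime.ofBits {α : Type} [Enc α] {f : α → List Bool} (hf : PTime f) :
    PTime fun a => Data.ofBits (f a) := by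
  unfold Data.ofBits
  refine PTime.foldr_of_add (h := fun _ b s => Data.decodeStep b s) hf (PTime.const _)
    (by unfold Data.decodeStep; fun_prop) ⟨C 4, fun a b s => ?_⟩
  rw [eval_C]
  change (Data.decodeStep b s).size ≤ s.size + 4
  cases b
  · simp only [Data.decodeStep, cond_false, Data.size]; omega
  · rcases s with _ | ⟨x, _ | ⟨y, z⟩⟩ <;>
      simp only [Data.decodeStep, cond_true, Data.size, Data.hd, Data.tl] <;> omega

/-! ### The oracle -/

namespace KSharp

/-- Numbers for the letters of query words and certificates. -/
def symIndex : TapeSym Token ⊕ Bool → ℕ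
  | .inl (.inl t) => t.index
  | .inl (.inr _) => 13
  | .inr b => bif b then 15 else 14

/-- The verifier for query words. The input of `SAT` is written backwards in the query word, and the
bits that follow it are the code of a certificate. -/
def checkWord (z : List ℕ) : Bool :=
  checkCert (z.filter fun k => decide (k ≤ 12)).reverse
    (Data.ofBits ((z.filter fun k => decide (14 ≤ k)).map fun k => decide (k = 15))).hd

theorem pTime_checkWord : PTime checkWord := by
  unfold checkWord
  exact PTime.checkCert.comp (g := fun z : List ℕ => ((z.filter fun k => decide (k ≤ 12)).reverse,
    (Data.ofBits ((z.filter fun k => decide (14 ≤ k)).map fun k => decide (k = 15))).hd))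
    (by fun_prop)

/-- The oracle: words with a certificate that is not longer than the word. -/
def oracle : Language (TapeSym Token) :=
  {x | ∃ y : List Bool, y.length ≤ x.length ∧
    checkWord ((x.map Sum.inl ++ y.map Sum.inr).map symIndex) = true}

theorem inNP_oracle : Complexity.InNP oracle :=
  ⟨{z | checkWord (z.map symIndex) = true}, Polynomial.X, pTime_checkWord.inP symIndex, fun x => by
    rw [Polynomial.eval_X]; rfl⟩

/-- The query word for an input: pads make room for certificates. -/
def queryWord (N : ℕ) (w : List Token) : List (TapeSym Token) :=
  List.replicate N (.inr .pad) ++ (w.map Sum.inl).reverse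

/-- The verifier recovers the input from the query word and ignores the pads. -/
theorem checkWord_queryWord (N : ℕ) (w : List Token) (y : List Bool) :
    checkWord (((queryWord N w).map Sum.inl ++ y.map Sum.inr).map symIndex) =
      checkCert (w.map Token.index) (Data.ofBits y).hd := by
  have h1 : ∀ t : Token, t.index ≤ 12 := fun t => by cases t <;> decide
  have h2 : ((w.map Token.index).reverse.filter fun k => decide (k ≤ 12)) =
      (w.map Token.index).reverse := List.filter_eq_self.2 fun k hk => by
    simp only [List.mem_reverse, List.mem_map] at hk
    obtain ⟨t, -, rfl⟩ := hk
    exact decide_eq_true (h1 t)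
  have h3 : ((w.map Token.index).reverse.filter fun k => decide (14 ≤ k)) = [] :=
    List.filter_eq_nil_iff.2 fun k hk => by
      simp only [List.mem_reverse, List.mem_map] at hk
      obtain ⟨t, -, rfl⟩ := hk
      have := h1 t
      simp; omega
  have h4 : ((y.map (symIndex ∘ Sum.inr)).filter fun k => decide (k ≤ 12)) = [] :=
    List.filter_eq_nil_iff.2 fun k hk => by
      obtain ⟨b, -, rfl⟩ := List.mem_map.1 hk
      cases b <;> decide
  have h5 : ((y.map (symIndex ∘ Sum.inr)).filter fun k => decide (14 ≤ k)) =
      y.map (symIndex ∘ Sum.inr) := List.filter_eq_self.2 fun k hk => by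
    obtain ⟨b, -, rfl⟩ := List.mem_map.1 hk
    cases b <;> decide
  have h6 : (queryWord N w).map (symIndex ∘ Sum.inl) =
      List.replicate N 13 ++ (w.map Token.index).reverse := by
    simp [queryWord, symIndex, Function.comp_def]
  have h7 : ((fun k => decide (k = 15)) ∘ symIndex ∘ Sum.inr) = id := by
    funext b; cases b <;> rfl
  rw [List.map_append, List.map_map, List.map_map, h6, checkWord, List.filter_append,
    List.filter_append, List.filter_append, List.filter_append, h2, h3, h4, h5, List.map_append,
    List.map_map, h7]
  simp

theorem queryWord_mem_oracle {N : ℕ} {w : List Token} (hN : 2 ^ (2 * (w.length + 2) ^ 2) ≤ N) :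
    queryWord N w ∈ oracle ↔ w ∈ SAT := by
  constructor
  · rintro ⟨y, -, hy⟩
    rw [checkWord_queryWord] at hy
    exact mem_SAT_of_checkCert hy
  · intro hw
    obtain ⟨C, hC, hs⟩ := exists_cert hw
    refine ⟨C.bits, ?_, ?_⟩
    · rw [Data.length_bits, queryWord, List.length_append, List.length_replicate]
      omega
    · rw [checkWord_queryWord, Data.hd_ofBits_bits, hC]

end KSharp

/-! ### The oracle machine -/

namespace Cmd

/-- Double the number of symbols on stack `pad`. -/
def double {A : Type} : Cmd Reg (TapeSym A) :=
  seq (pour₂ .pad .a .b) (seq (pour .a .pad) (pour .b .pad))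

theorem does_double {A : Type} (S : Stacks Reg (TapeSym A)) (s : TapeSym A) (k : ℕ) (hS : Clean S)
    (hk : S .pad = List.replicate k s) :
    Does double S (Function.update S .pad (List.replicate (2 * k) s)) (13 * k + 3) := by
  have h1 := does_pour₂ (i := Reg.pad) (j := .a) (k := .b) (by simp) (by simp) (by simp) _ S hk
  have h2 := fun S => does_pour (K := Reg) (Γ := TapeSym A) (i := .a) (j := .pad) (by simp)
    (List.replicate k s) S
  have h3 := fun S => does_pour (K := Reg) (Γ := TapeSym A) (i := .b) (j := .pad) (by simp)
    (List.replicate k s) S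
  refine ((h1.seq ((h2 _ ?_).seq (h3 _ ?_))).mono ?_).of_eq ?_
  · simp [hS.1]
  · simp [hS.2.1]
  · simp; omega
  · funext m
    cases m <;> simp [hS.1, hS.2.1, two_mul]

/-- Double the number of symbols on stack `pad` as many times as the unary number on the main stack
says. -/
def doubles {A : Type} : Cmd Reg (TapeSym A) :=
  loop .main isOne (seq (seq (pop .main) (pop .main)) double)

/-- The bound on the time `t` sums the geometric series of the costs of `double`. -/
theorem does_doubles {A : Type} (s : TapeSym A) (n : ℕ) :
    ∀ (k : ℕ) (S : Stacks Reg (TapeSym A)), 0 < k → Clean S → S .main = (enc n).code →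
      S .pad = List.replicate k s → ∃ t, t + 19 * k ≤ 20 * (k * 2 ^ n) ∧
        Does doubles S (Function.update (Function.update S .main [.inr .zero]) .pad
          (List.replicate (k * 2 ^ n) s)) t := by
  induction n with
  | zero =>
    intro k S hk hS hm hp
    have hm' : S .main = [.inr .zero] := hm
    refine ⟨1, by omega, (does_loop_done (by simp [hm', isOne])).of_eq ?_⟩
    funext m
    cases m <;> simp [hm', hp]
  | succ n ih =>
    intro k S hk hS hm hp
    have hm' : S .main = .inr .one :: .inr .zero :: (enc n).code := hm
    have h1 := does_pop .main S
    have h2 := does_pop .main (Function.update S .main (S .main).tail)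
    have h3 := does_double (withMain (Function.update S .main (S .main).tail) (Function.update S
      .main (S .main).tail .main).tail) s k (by simpa [Clean] using hS) (by simp [hp])
    obtain ⟨t, ht, h4⟩ := ih (2 * k) (Function.update (withMain (Function.update S .main
      (S .main).tail) (Function.update S .main (S .main).tail .main).tail) .pad
        (List.replicate (2 * k) s)) (by omega) (by simpa [Clean] using hS) (by simp [hm'])
      (by simp)
    refine ⟨_, ?_, (Does.loop (by simp [hm', isOne]) ((h1.seq h2).seq h3) h4).of_eq ?_⟩
    · have : k * 2 ^ (n + 1) = 2 * k * 2 ^ n := by ring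
      omega
    · have : k * 2 ^ (n + 1) = 2 * k * 2 ^ n := by ring
      rw [this]
      funext m
      cases m <;> simp

end Cmd

namespace KSharp

open Cmd Polynomial

/-- The number of doublings of the pads, for an input with the given numbers. -/
def padExponent (l : List ℕ) : ℕ := 2 * ((l.length + 2) * (l.length + 2))

theorem pTime_padExponent : PTime padExponent := by
  unfold padExponent; fun_prop

/-- The machine reads the input, computes the exponent in unary, writes the query word and asks one
question. -/
theorem inEXPTIMEwithNP_SAT : Complexity.InEXPTIMEwithNP SAT := by
  obtain ⟨c, K, hK, hc⟩ := exists_read Token.index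
  obtain ⟨d, p, hd⟩ := pTime_padExponent.prog Token
  let e : Cmd Reg (TapeSym Token) := seq (push .pad (.inr .pad)) (seq doubles (pour .pad .query))
  let r : Polynomial ℕ := C (2 * K + 7) * X + p.comp (1 + X * C (2 * K + 2)) +
    C 2 * (X + C 2) ^ 2 + C 20
  refine ⟨(seq (seq c (seq d e)) (ask (push .main (.inr .one)) skip)).toMachine
      Function.Embedding.inl .inp .query .main (.inr .one), oracle, r, inNP_oracle,
    toMachine_decides _ fun w => ?_⟩
  set q := 2 * (w.length + 2) ^ 2 with hq
  have hq' : padExponent (w.map Token.index).reverse = q := by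
    rw [padExponent, List.length_reverse, List.length_map, hq, sq]
  have h1 := hd (w.map Token.index).reverse (afterReading Token.index w) []
    (by simp [afterReading]) (clean_afterReading _ w)
  rw [hq', List.append_nil] at h1
  set S₁ := withMain (afterReading Token.index w) (enc q).code with hS₁
  have hclean : Clean S₁ := (clean_afterReading _ w).withMain _
  have h2 := does_push .pad (.inr .pad) S₁
  obtain ⟨t₀, ht₀, h3⟩ := does_doubles (.inr .pad) q 1
    (Function.update S₁ .pad (.inr .pad :: S₁ .pad)) one_pos (by simpa [Clean] using hclean)
    (by simp [hS₁]) (by simp [hS₁, afterReading])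
  have h4 := does_pour (i := Reg.pad) (j := .query) (by simp)
    (List.replicate (1 * 2 ^ q) (.inr .pad)) _
    (show Function.update (Function.update (Function.update S₁ .pad (.inr .pad :: S₁ .pad)) .main
      [.inr .zero]) .pad (List.replicate (1 * 2 ^ q) (.inr .pad)) .pad = _ by simp)
  have h5 := ((hc w).seq (h1.seq (h2.seq (h3.seq h4))))
  revert h5
  generalize hS₂ : Function.update (Function.update (Function.update (Function.update (Function.update
    S₁ Reg.pad _) _ _) _ _) _ _) _ _ = S₂
  intro h5
  have hquery : S₂ .query = queryWord (2 ^ q) w := by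
    simp [← hS₂, hS₁, queryWord, afterReading]
  have hmain : S₂ .main = [.inr .zero] := by simp [← hS₂]
  obtain ⟨t, ht, hr⟩ := h5 .query oracle
  have htime : t + 3 ≤ 2 ^ r.eval w.length := by
    have h6 : esize (w.map Token.index).reverse ≤ 1 + w.length * (2 * K + 2) := by
      refine (esize_list_le (c := 2 * K + 1) fun n hn => ?_).trans (by simp)
      simp only [List.mem_reverse, List.mem_map] at hn
      obtain ⟨s, -, rfl⟩ := hn
      rw [esize_nat]
      have := hK s
      omega
    have h7 := p.eval_mono_nat h6
    have h8 : r.eval w.length = (2 * K + 7) * w.length + p.eval (1 + w.length * (2 * K + 2)) +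
        q + 20 := by
      simp only [r, eval_add, eval_mul, eval_C, eval_X, eval_comp, eval_one, eval_pow, hq]
    rw [h8]
    generalize hx : (2 * K + 7) * w.length = x at *
    generalize p.eval (1 + w.length * (2 * K + 2)) = y at *
    have h9 : x + y < 2 ^ (x + y) := Nat.lt_two_pow_self
    have h10 : 0 < 2 ^ q := by positivity
    have h11 : 2 ^ (x + y + q + 20) = 2 ^ 20 * (2 ^ (x + y) * 2 ^ q) := by ring
    have h12 : 2 ^ (x + y) ≤ 2 ^ (x + y) * 2 ^ q := Nat.le_mul_of_pos_right _ h10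
    have h13 : 2 ^ q ≤ 2 ^ (x + y) * 2 ^ q := Nat.le_mul_of_pos_left _ (by positivity)
    rw [List.length_replicate] at ht
    omega
  by_cases hw : w ∈ SAT
  · refine ⟨_, t + (1 + 1), by omega, .seq hr (.ask_yes ?_ (.push _ _ _)), ?_⟩
    · rw [hquery]; exact (queryWord_mem_oracle le_rfl).2 hw
    · simp [hw]
  · refine ⟨_, t + (1 + 1), by omega, .seq hr (.ask_no ?_ (.skip _)), ?_⟩
    · rw [hquery]; exact fun h => hw ((queryWord_mem_oracle le_rfl).1 h)
    · simp [hw, hmain]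

end KSharp

/-! ### Decidability -/

namespace Data

/-- A bound for the numbers of the trees of a given size. -/
def toNatBound (n : ℕ) : ℕ := (fun k => (k + 2) ^ 2)^[n] 0

theorem toNatBound_succ (n : ℕ) : toNatBound (n + 1) = (toNatBound n + 2) ^ 2 :=
  Function.iterate_succ_apply' _ _ _

theorem toNatBound_mono : Monotone toNatBound := monotone_nat_of_le_succ fun n => by
  rw [toNatBound_succ]; nlinarith

theorem toNat_lt (d : Data) : d.toNat < toNatBound d.size := by
  induction d with
  | nil => decide
  | cons x y hx hy =>
    rw [size, toNatBound_succ, toNat]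
    have h1 := hx.trans_le (toNatBound_mono (Nat.le_add_right x.size y.size))
    have h2 := hy.trans_le (toNatBound_mono (Nat.le_add_left y.size x.size))
    have h3 := Nat.pair_lt_max_add_one_sq x.toNat y.toNat
    have h4 : max x.toNat y.toNat + 1 ≤ toNatBound (x.size + y.size) := max_lt h1 h2
    have h5 := Nat.pow_le_pow_left h4 2
    nlinarith

theorem primrec_toNatBound : Primrec toNatBound :=
  Primrec.nat_iterate Primrec.id (Primrec.const 0)
    ((Primrec.nat_mul.comp (Primrec.nat_add.comp Primrec.snd (Primrec.const 2))
      (Primrec.nat_add.comp Primrec.snd (Primrec.const 2))).of_eq fun _ => (sq _).symm).to₂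

end Data

namespace KSharp

theorem primrec_enc_index : Primrec fun w : List Token => enc (w.map Token.index) := by
  have h : Primrec fun w : List Token =>
      w.foldr (fun t d => Data.cons (enc t.index) d) Data.nil :=
    Primrec.list_foldr Primrec.id (Primrec.const _) (Data.primrec_cons.comp
      ((Primrec.dom_finite fun t : Token => enc t.index).comp (Primrec.fst.comp Primrec.snd))
      (Primrec.snd.comp Primrec.snd)).to₂
  refine h.of_eq fun w => ?_
  induction w with
  | nil => rfl
  | cons t w ih => rw [List.foldr_cons, ih]; rfl

theorem primrec_two_pow : Primrec fun n : ℕ => 2 ^ n :=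
  (Primrec.nat_iterate Primrec.id (Primrec.const 1)
    (Primrec.nat_mul.comp (Primrec.const 2) Primrec.snd).to₂).of_eq fun n => by
      induction n with
      | zero => rfl
      | succ n ih => rw [id, Function.iterate_succ_apply', pow_succ', ← ih]; rfl

/-- Search through all certificates up to the size bound. -/
theorem computablePred_SAT : ComputablePred fun w : List Token => w ∈ SAT := by
  obtain ⟨F, hF, hF'⟩ := PTime.checkCert.primrec
  let N : List Token → ℕ := fun w => Data.toNatBound (2 ^ (2 * ((w.length + 2) * (w.length + 2))))
  have hlen : Primrec fun w : List Token => w.length + 2 :=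
    Primrec.nat_add.comp Primrec.list_length (Primrec.const 2)
  have hN : Primrec N := Data.primrec_toNatBound.comp (primrec_two_pow.comp
    (Primrec.nat_mul.comp (Primrec.const 2) (Primrec.nat_mul.comp hlen hlen)))
  have hR : PrimrecRel fun (k : ℕ) (w : List Token) =>
      F (.cons (enc (w.map Token.index)) (Data.equivNat.symm k)) = enc true :=
    Primrec.eq.comp (hF.comp (Data.primrec_cons.comp (primrec_enc_index.comp Primrec.snd)
      (Primrec.of_equiv_symm.comp Primrec.fst))) (Primrec.const _)
  have hS : PrimrecPred fun w => ∃ k < N w,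
      F (.cons (enc (w.map Token.index)) (Data.equivNat.symm k)) = enc true :=
    (hR.exists_mem_list.comp (Primrec.list_range.comp hN) Primrec.id).of_eq (by simp)
  refine hS.computablePred.of_eq fun w => ?_
  have hcheck : ∀ C : Data, F (.cons (enc (w.map Token.index)) C) = enc true ↔
      checkCert (w.map Token.index) C = true := fun C => by
    rw [show Data.cons (enc (w.map Token.index)) C = enc (w.map Token.index, C) from rfl, hF']
    cases checkCert (w.map Token.index) C <;> simp [enc]
  constructor
  · rintro ⟨k, -, hk⟩
    exact mem_SAT_of_checkCert ((hcheck _).1 hk)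
  · intro hw
    obtain ⟨C, hC, hs⟩ := exists_cert hw
    refine ⟨Data.equivNat C, (Data.toNat_lt C).trans_le (Data.toNatBound_mono ?_), ?_⟩
    · rwa [← sq]
    · rw [Equiv.symm_apply_apply]
      exact (hcheck C).2 hC

end KSharp

theorem theorem3 :
    ComputablePred (fun w : List KSharp.Token => w ∈ KSharp.SAT) ∧
      Complexity.InEXPTIMEwithNP KSharp.SAT :=
  ⟨KSharp.computablePred_SAT, KSharp.inEXPTIMEwithNP_SAT⟩
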